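/- **Setting.** Let $\Theta\subset\mathbb R^d$ be open and bounded, $\nu$ a measure on a measurable space $S$, and $\mathbf P_\theta$, $\theta\in\Theta$, probability measures with densities $f(x,\theta)=\frac{d\mathbf P_\theta}{d\nu}(x)>0$ for all $x\in S$. Let $X_1,\dots,X_n$ be i.i.d. with law $\mathbf P_\theta$ (we write $\mathbf P_\theta$ also for the law of the sample and $\mathbf E_\theta$ for the expectation). Fix $\theta_0\in\Theta$ and a sequence $u_n>0$ with $u_n\to0$ and $nu_n^2\to\infty$. Put $g(x,\tau)=(f(x,\theta_0+\tau)/f(x,\theta_0))^{1/2}-1$. *Finite Fisher information at $\theta_0$*: there are $\phi:S\to\mathbb R^d$ and an increasing function $\omega$ with $\omega(s)\to0$ as $s\to0$ such that $\int_S(g(x,\tau)-\tau^T\phi(x))^2\,d\mathbf P_{\theta_0}<|\tau|^2\omega(|\tau|)$ for all $\tau\neq0$ with $\theta_0+\tau\in\Theta$. Put $I(\theta_0)=4\int_S\phi\phi^T\,d\mathbf P_{\theta_0}$ and assume that $I(\theta_0)$ has rank $d$. **Conditions.** * **A0.** For every compact $K\subset\Theta$ and $\delta>0$, $\inf_{\theta\in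 K}\inf_{\tau:\,\theta+\tau\in\Theta,\,|\tau|\ge\delta}\int_S(f^{1/2}(x,\theta+\tau)-f^{1/2}(x,\theta))^2d\nu>0$. * **B1.** There are a neighbourhood $U\subset\Theta$ of $\theta_0$, constants $\varepsilon'>0$ and $K$, and a sequence $\gamma_n\to\infty$ such that for every $C_1$ there is $n_0(C_1)$ with $$\mathbf E_\theta\Bigl(\tfrac{f(X_1,\theta+\tau)}{f(X_1,\theta)}\mathbf 1\Bigl(\Bigl|\log\tfrac{f(X_1,\theta+\tau)}{f(X_1,\theta)}\Bigr|>\varepsilon'\Bigr)\Bigr)^{\gamma_n}<K$$ for all $n>n_0(C_1)$, $\theta\in U$ and $|\tau|<C_1u_n$ with $\theta+\tau\in\Theta$. * **B2.** The same, with a sequence $\gamma_n>c|\log u_n|$ for some $c>0$. * **C1.** There are positive $K,\lambda,\gamma,\varepsilon',s_0$ and a neighbourhood $U\subset\Theta$ of $\theta_0$ such that $\omega(s)<Ks^\lambda$ and $\mathbf E_\theta[|\phi(X_1)|^2\mathbf 1(|\phi(X_1)|>\varepsilon's^{-1})]<Ks^\gamma$ for $0<s<s_0$, $\theta\in U$.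 * **C2.** There are positive $K,\gamma,s_0$ such that $|\mathbf E_{\theta_0}[g^2(X_1,\tau)]-\frac14\tau^TI(\theta_0)\tau|<K|\tau|^{2+\gamma}$ for $0<|\tau|<s_0$, $\theta_0+\tau\in\Theta$. * **D.** $\Theta$ is convex, $f(x,\cdot)$ is differentiable on $\Theta$, and $\sup_{\theta\in\Theta}\int_S(|\nabla f(x,\theta)|/f(x,\theta))^mf(x,\theta)\,d\nu<\infty$ for some $m>d$ with $m\ge2$ (the requirement $m\ge2$ matters only for $d=1$). * **E** (for a given $\varepsilon>0$). With $\phi_\varepsilon(x)=\phi(x)\mathbf 1(|\phi(x)|<u_n^{-1}\varepsilon)$, there are $\beta_1,\beta_2>d$, a constant $K$ and a neighbourhood $U\subset\Theta$ of $\theta_0$ such that for all $n$, all $\theta\in U$ and all $v,w$ with $\theta_0+v,\theta_0+w\in U$, $$\mathbf E_\theta\Bigl|\log\tfrac{f(X_1,\theta_0+w)}{f(X_1,\theta_0+v)}-2(w-v)^T\phi_\varepsilon(X_1)\Bigr|^{\beta_1}\le K|w-v|^{\beta_2}.$$ **Notation.** For $b,u\in\mathbb R^d$ let $\xi_n(x,u_nb,u)=\log\dfrac{f(x,\theta_0+u_nb+u)}{f(x,\theta_0+u_nb)}$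 and $$\zeta_n(u_nb,u)=2u^T\sum_{i=1}^n\phi_\varepsilon(X_i)-\tfrac12nu^TI(\theta_0)u-nu_n\,b^TI(\theta_0)u .$$ Thus $\zeta_n(u_nb,u)=\zeta_n(u_nb+u)-\zeta_n(u_nb)$, where $\zeta_n(u)=\zeta_n(0,u)=2u^T\sum_i\phi_\varepsilon(X_i)-\frac12nu^TI(\theta_0)u$. **Theorem 1.** Suppose that the experiment has finite Fisher information at $\theta_0$, that $I(\theta_0)$ has rank $d$, and that A0 and either B2, or B1 together with C1 and C2, hold. Let $\varepsilon>0$. (i) For every $C>0$ there are positive functions $\omega_1,\omega_2$ on $(0,\infty)$, with $\omega_1(s)\to0$ and $\omega_2(s)\to0$ as $s\to0$, such that for every $R>0$ there is $C_1>0$ with $$\mathbf P_{\theta_0+u_nb}\Bigl(\Bigl|\sum_{i=1}^n\xi_n(X_i,u_nb,u)-\zeta_n(u_nb,u)\Bigr|>nu_n^2\omega_1(u_n)\Bigr)<C_1\exp\{-nu_n^2/\omega_2(u_n)\}$$ for all $|b|\le R$, all $n$ and all $|u|<Cu_n$ with $\theta_0+u_nb,\ \theta_0+u_nb+u\in\Theta$.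 (ii) If in addition D and E hold, then for every $C>0$ there are positive functions $\omega_3,\omega_4$ on $(0,\infty)$, with $\omega_3(s)\to0$ and $\omega_4(s)\to0$ as $s\to0$, such that for every $R>0$ there is $C_1>0$ with $$\mathbf P_{\theta_0+u_nb}\Bigl(\sup_{|u|<Cu_n}\Bigl|\sum_{i=1}^n\xi_n(X_i,u_nb,u)-\zeta_n(u_nb,u)\Bigr|>nu_n^2\omega_3(u_n)\Bigr)<C_1\exp\{-nu_n^2/\omega_4(u_n)\}$$ for all $|b|\le R$ and all $n$ with $\theta_0+u_nb\in\Theta$, the supremum being over those $u$ with $\theta_0+u_nb+u\in\Theta$. -/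

import Mathlib

open MeasureTheory Filter Topology

open scoped ENNReal

noncomputable section

namespace ModDev

/-- A dominated statistical experiment with an open bounded parameter set `Θ ⊆ ℝ^d`: a measure `ν`
on `S` and densities `f x θ` that are strictly positive on all of `S` (common carrier). -/
structure Experiment (S : Type*) [MeasurableSpace S] (d : ℕ) where
  /-- the parameter set -/
  Θ : Set (EuclideanSpace ℝ (Fin d))
  /-- the dominating measure -/
  ν : Measure S
  /-- the density `f(x, θ)` -/
  f : S → EuclideanSpace ℝ (Fin d) → ℝ
  isOpen : IsOpen Θ
  isBounded : Bornology.IsBounded Θ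
  measurable_f : ∀ θ ∈ Θ, Measurable fun x => f x θ
  pos_f : ∀ θ ∈ Θ, ∀ x, 0 < f x θ
  lintegral_f : ∀ θ ∈ Θ, ∫⁻ x, ENNReal.ofReal (f x θ) ∂ν = 1

namespace Experiment

variable {S : Type*} [MeasurableSpace S] {d : ℕ} (𝓔 : Experiment S d)

/-- The measure `P_θ` with density `f(·, θ)` with respect to `ν`. -/
def P (θ : EuclideanSpace ℝ (Fin d)) : Measure S :=
  𝓔.ν.withDensity fun x => ENNReal.ofReal (𝓔.f x θ)

theorem isProbabilityMeasure_P {θ : EuclideanSpace ℝ (Fin d)} (hθ : θ ∈ 𝓔.Θ) :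
    IsProbabilityMeasure (𝓔.P θ) :=
  ⟨by simpa [P, withDensity_apply] using 𝓔.lintegral_f θ hθ⟩

/-- The law of an i.i.d. sample `(X_1, …, X_n)` from `P_θ`. -/
def sampleLaw (n : ℕ) (θ : EuclideanSpace ℝ (Fin d)) : Measure (Fin n → S) :=
  Measure.pi fun _ => 𝓔.P θ

/-- The likelihood ratio `f(x, θ') / f(x, θ)`. -/
def ratio (θ θ' : EuclideanSpace ℝ (Fin d)) (x : S) : ℝ :=
  𝓔.f x θ' / 𝓔.f x θ

/-- `g(x, τ) = (f(x, θ₀ + τ) / f(x, θ₀))^{1/2} - 1`. -/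
def g (θ₀ τ : EuclideanSpace ℝ (Fin d)) (x : S) : ℝ :=
  √(𝓔.ratio θ₀ (θ₀ + τ) x) - 1

/-- Finite Fisher information at `θ₀`, with derivative `φ` and (increasing) remainder modulus `ω`.
The integral is taken with values in `[0, ∞]`, so its finiteness is part of the condition. -/
structure FiniteFisher (θ₀ : EuclideanSpace ℝ (Fin d)) (φ : S → EuclideanSpace ℝ (Fin d))
    (ω : ℝ → ℝ) : Prop where
  measurable_φ : Measurable φ
  monotone_ω : MonotoneOn ω (Set.Ioi 0)
  tendsto_ω : Tendsto ω (𝓝[>] 0) (𝓝 0)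
  bound : ∀ τ, τ ≠ 0 → θ₀ + τ ∈ 𝓔.Θ →
    ∫⁻ x, ENNReal.ofReal ((𝓔.g θ₀ τ x - inner ℝ τ (φ x)) ^ 2) ∂(𝓔.P θ₀)
      < ENNReal.ofReal (‖τ‖ ^ 2 * ω ‖τ‖)

/-- The Fisher information matrix `I(θ₀) = 4 ∫ φ φᵀ dP_{θ₀}`. -/
def fisherInfo (θ₀ : EuclideanSpace ℝ (Fin d)) (φ : S → EuclideanSpace ℝ (Fin d)) :
    Matrix (Fin d) (Fin d) ℝ :=
  Matrix.of fun i j => 4 * ∫ x, φ x i * φ x j ∂(𝓔.P θ₀)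

/-- The bilinear form `uᵀ I(θ₀) v`. -/
def fisherForm (θ₀ : EuclideanSpace ℝ (Fin d)) (φ : S → EuclideanSpace ℝ (Fin d))
    (u v : EuclideanSpace ℝ (Fin d)) : ℝ :=
  u.ofLp ⬝ᵥ (𝓔.fisherInfo θ₀ φ).mulVec v.ofLp

/-- Condition A0 (identifiability); the infima are taken in `[0, ∞]`. -/
def CondA0 : Prop :=
  ∀ K : Set (EuclideanSpace ℝ (Fin d)), K ⊆ 𝓔.Θ → IsCompact K → ∀ δ : ℝ, 0 < δ →
    0 < ⨅ θ ∈ K, ⨅ τ ∈ {τ : EuclideanSpace ℝ (Fin d) | θ + τ ∈ 𝓔.Θ ∧ δ ≤ ‖τ‖},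
      ∫⁻ x, ENNReal.ofReal ((√(𝓔.f x (θ + τ)) - √(𝓔.f x θ)) ^ 2) ∂𝓔.ν

/-- The moment bound shared by B1 and B2: on a neighbourhood `U ⊆ Θ` of `θ₀`, with constants
`ε > 0` and `C`, for every `C₁` and all large `n`,
`E_θ (f(X,θ+τ)/f(X,θ) · 1(|log (f(X,θ+τ)/f(X,θ))| > ε))^{γ_n} < C`
for all `θ ∈ U` and `|τ| < C₁ u_n`. -/
def MomentBound (θ₀ : EuclideanSpace ℝ (Fin d)) (u γ : ℕ → ℝ) : Prop :=
  ∃ U ∈ 𝓝 θ₀, U ⊆ 𝓔.Θ ∧ ∃ ε C : ℝ, 0 < ε ∧ 0 < C ∧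
    ∀ C₁ : ℝ, 0 < C₁ → ∃ n₀ : ℕ, ∀ n, n₀ < n → ∀ θ ∈ U, ∀ τ, ‖τ‖ < C₁ * u n → θ + τ ∈ 𝓔.Θ →
      ∫⁻ x, ENNReal.ofReal
        (({x | ε < |Real.log (𝓔.ratio θ (θ + τ) x)|}.indicator (𝓔.ratio θ (θ + τ)) x) ^ γ n)
        ∂(𝓔.P θ) < ENNReal.ofReal C

/-- Condition B1 at `θ₀`: the moment bound holds with some `γ_n → ∞`. -/
def CondB1 (θ₀ : EuclideanSpace ℝ (Fin d)) (u : ℕ → ℝ) : Prop :=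
  ∃ γ : ℕ → ℝ, Tendsto γ atTop atTop ∧ 𝓔.MomentBound θ₀ u γ

/-- Condition B2 at `θ₀`: the moment bound holds with some `γ_n > c |log u_n|`, `c > 0`. -/
def CondB2 (θ₀ : EuclideanSpace ℝ (Fin d)) (u : ℕ → ℝ) : Prop :=
  ∃ c : ℝ, 0 < c ∧ ∃ γ : ℕ → ℝ, (∀ n, c * |Real.log (u n)| < γ n) ∧ 𝓔.MomentBound θ₀ u γ

/-- Condition C1 at `θ₀`. -/
def CondC1 (θ₀ : EuclideanSpace ℝ (Fin d)) (φ : S → EuclideanSpace ℝ (Fin d)) (ω : ℝ → ℝ) :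
    Prop :=
  ∃ C lam γ ε u₀ : ℝ, 0 < C ∧ 0 < lam ∧ 0 < γ ∧ 0 < ε ∧ 0 < u₀ ∧
    (∀ s, 0 < s → s < u₀ → ω s < C * s ^ lam) ∧
    ∃ U ∈ 𝓝 θ₀, U ⊆ 𝓔.Θ ∧ ∀ θ ∈ U, ∀ s, 0 < s → s < u₀ →
      ∫⁻ x, ENNReal.ofReal ({x | ε * s⁻¹ < ‖φ x‖}.indicator (fun x => ‖φ x‖ ^ 2) x) ∂(𝓔.P θ)
        < ENNReal.ofReal (C * s ^ γ)

/-- Condition C2 at `θ₀`. -/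
def CondC2 (θ₀ : EuclideanSpace ℝ (Fin d)) (φ : S → EuclideanSpace ℝ (Fin d)) : Prop :=
  ∃ C γ u₀ : ℝ, 0 < C ∧ 0 < γ ∧ 0 < u₀ ∧
    ∀ τ : EuclideanSpace ℝ (Fin d), 0 < ‖τ‖ → ‖τ‖ < u₀ → θ₀ + τ ∈ 𝓔.Θ →
      |(∫ x, (𝓔.g θ₀ τ x) ^ 2 ∂(𝓔.P θ₀)) - 1 / 4 * 𝓔.fisherForm θ₀ φ τ τ| < C * ‖τ‖ ^ (2 + γ)

/-- Condition D: `Θ` is convex (and bounded), `f(x, ·)` is differentiable on `Θ`, and for some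
`m > d` with `m ≥ 2` (automatic when `d ≥ 2`) the `m`-th moments of `|∇f| / f` are bounded. -/
def CondD : Prop :=
  Convex ℝ 𝓔.Θ ∧ (∀ x, ∀ θ ∈ 𝓔.Θ, DifferentiableAt ℝ (𝓔.f x) θ) ∧
    ∃ m : ℝ, (d : ℝ) < m ∧ 2 ≤ m ∧
      (⨆ θ ∈ 𝓔.Θ, ∫⁻ x, ENNReal.ofReal ((‖gradient (𝓔.f x) θ‖ / 𝓔.f x θ) ^ m * 𝓔.f x θ) ∂𝓔.ν) < ⊤

/-- The truncation `φ_ε = φ · 1(|φ| < ε / r)`, used with `r = u_n`. -/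
def trunc (φ : S → EuclideanSpace ℝ (Fin d)) (ε r : ℝ) : S → EuclideanSpace ℝ (Fin d) :=
  {x | ‖φ x‖ < r⁻¹ * ε}.indicator φ

/-- Condition E at `θ₀`; the truncation depends on `n`, the constants do not. -/
def CondE (θ₀ : EuclideanSpace ℝ (Fin d)) (φ : S → EuclideanSpace ℝ (Fin d)) (ε : ℝ)
    (u : ℕ → ℝ) : Prop :=
  ∃ β₁ β₂ C : ℝ, (d : ℝ) < β₁ ∧ (d : ℝ) < β₂ ∧ 0 < C ∧
    ∃ U ∈ 𝓝 θ₀, U ⊆ 𝓔.Θ ∧ ∀ n, ∀ θ ∈ U, ∀ v w, θ₀ + v ∈ U → θ₀ + w ∈ U →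
      ∫⁻ x, ENNReal.ofReal (|Real.log (𝓔.ratio (θ₀ + v) (θ₀ + w) x)
          - 2 * inner ℝ (w - v) (trunc φ ε (u n) x)| ^ β₁) ∂(𝓔.P θ)
        ≤ ENNReal.ofReal (C * ‖w - v‖ ^ β₂)

/-- `ξ(x, h, v) = log (f(x, θ₀ + h + v) / f(x, θ₀ + h))`, used with `h = u_n b`. -/
def xi (θ₀ h v : EuclideanSpace ℝ (Fin d)) (x : S) : ℝ :=
  Real.log (𝓔.ratio (θ₀ + h) (θ₀ + h + v) x)

/-- The LAN quadratic `2 vᵀ ∑ φ_ε(X_i) - (n/2) vᵀ I(θ₀) v - n hᵀ I(θ₀) v` at the shifted point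
`θ₀ + h`, used with `r = u_n` and `h = u_n b`. It equals `ζ_n(h + v) - ζ_n(h)` where
`ζ_n(v) = 2 vᵀ ∑ φ_ε(X_i) - (n/2) vᵀ I(θ₀) v`; for `h = 0` it is `ζ_n(v)`. -/
def zeta (θ₀ : EuclideanSpace ℝ (Fin d)) (φ : S → EuclideanSpace ℝ (Fin d)) (ε r : ℝ) {n : ℕ}
    (h v : EuclideanSpace ℝ (Fin d)) (X : Fin n → S) : ℝ :=
  2 * inner ℝ v (∑ i, trunc φ ε r (X i)) - 1 / 2 * n * 𝓔.fisherForm θ₀ φ v v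
    - n * 𝓔.fisherForm θ₀ φ h v

/-- `|∑ ξ_n(X_i, h, v) - ζ_n(h, v)|`. -/
def lanError (θ₀ : EuclideanSpace ℝ (Fin d)) (φ : S → EuclideanSpace ℝ (Fin d)) (ε r : ℝ) {n : ℕ}
    (h v : EuclideanSpace ℝ (Fin d)) (X : Fin n → S) : ℝ :=
  |(∑ i, 𝓔.xi θ₀ h v (X i)) - 𝓔.zeta θ₀ φ ε r h v X|

end Experiment

/-- `ω` is a positive function on `(0, ∞)` with `ω(s) → 0` as `s → 0`. -/
def IsRate (ω : ℝ → ℝ) : Prop :=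
  (∀ s, 0 < s → 0 < ω s) ∧ Tendsto ω (𝓝[>] 0) (𝓝 0)

end ModDev

end

/-! Write `N = n u_n²`. Both parts reduce to one kind of estimate: for every fixed radius `R`,
threshold `δ` and exponent `M`, the error exceeds `δN` with probability at most `exp(-MN)` once `n`
is large. Since `δ` and `M` are arbitrary, a diagonal choice (`exists_rates`) makes the threshold
vanish and the exponent diverge along `n`, and a constant absorbs the finitely many small `n`.

For a fixed displacement `v` the estimate is Chernoff's bound for an i.i.d. sum, so it suffices
that, for every fixed `λ`, the exponential moment of the centred one-observation term is at most
`exp(κ u_n²)` with `κ` as small as desired (`exists_lanTerm_mgf_le`). With `q`, `p`, `p'` the root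
densities at `θ₀`, `θ₀ + h`, `θ₀ + h + v`, a Taylor expansion of `2 log(p'/p)`, truncated at a small
`ε'`, expresses its mean and second moment through the mean-square remainder of the roots
(`exists_expansion_bound`, `exists_incr_expansion`). The linear term integrates to zero because the
score is centred, the quadratic terms give the Fisher form, and the rest is `o(u_n²)`. The event
`|ξ| > ε'` has probability `o(u_n²)`, but the likelihood ratio may be huge there. It is split at a
level `z`: below `z` the small probability is used, above `z` the moment of order `γ_n`. With `γ_n`
of order `|log u_n|` a constant `z` suffices; with an arbitrary `γ_n → ∞` the level is a negative
power of `u_n`, which needs the polynomial rate of C1. Nonpositive `λ` are reduced to positive ones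
by exchanging the two measures.

For the uniform bound the process to chain is the `m`-th root of the likelihood ratio, `m > d`. Its
derivative along a segment is itself times a multiple of a score sum, and its `m`-th power is the
density of a sample law; so the `m`-th moment of its derivative is controlled by that of a centred
i.i.d. sum under that law, and the Marcinkiewicz–Zygmund inequality gives increments of size `√n |w
- w'|` in `L^m`. Dyadic chaining then starts at a level `k` proportional to `N`. The number of grid
points is `exp(O(N))`, which the pointwise bound affords because its exponent is arbitrary. At the
grid points the root is at least `exp(-BN/m)` off a negligible event, so relative control of it,
hence control of its logarithm, requires fluctuations of at most half this size; the factor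
`2^((d-m)k)` beats the resulting loss `exp(BN)`. -/

noncomputable section

namespace ModDev

/-! ### Rates along the sequence: from fixed to vanishing thresholds -/

/-- A monotone envelope, as a function of `s > 0`, of a bounded sequence of rates `r` along `u`. -/
def envelope (u r : ℕ → ℝ) (s : ℝ) : ℝ :=
  s + ⨆ n, if u n ≤ s then r n else 0

theorem bddAbove_envelope {u r : ℕ → ℝ} (hr1 : ∀ n, r n ≤ 1) (s : ℝ) :
    BddAbove (Set.range fun n => if u n ≤ s then r n else 0) := by
  refine ⟨1, ?_⟩
  rintro _ ⟨n, rfl⟩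
  dsimp only
  split_ifs
  · exact hr1 n
  · norm_num

theorem le_envelope {u r : ℕ → ℝ} (hu : ∀ n, 0 < u n) (hr1 : ∀ n, r n ≤ 1) (n : ℕ) :
    r n ≤ envelope u r (u n) := by
  have h := le_ciSup (bddAbove_envelope (u := u) hr1 (u n)) n
  simp only [le_refl, if_true] at h
  have := hu n
  unfold envelope
  linarith

/-- Each of the finitely many early `u n` is positive, so for small `s` the supremum only sees late
indices, where `r` is small. The summand `s` serves only to make the envelope positive. -/
theorem isRate_envelope {u r : ℕ → ℝ} (hu : ∀ n, 0 < u n)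
    (hr0 : ∀ n, 0 ≤ r n) (hr : Tendsto r atTop (𝓝 0)) :
    IsRate (envelope u r) := by
  have hnn : ∀ s, 0 ≤ ⨆ n, if u n ≤ s then r n else 0 := fun s =>
    Real.iSup_nonneg fun n => by split_ifs; exacts [hr0 n, le_rfl]
  refine ⟨fun s hs => by have := hnn s; unfold envelope; linarith, ?_⟩
  rw [Metric.tendsto_nhdsWithin_nhds]
  intro η hη
  obtain ⟨n₀, hn₀⟩ :=
    (hr.eventually (gt_mem_nhds (show (0 : ℝ) < η / 2 by linarith))).exists_forall_of_atTop
  have hmin : ∃ a > 0, ∀ n < n₀, a < u n := by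
    clear hn₀
    induction n₀ with
    | zero => exact ⟨1, one_pos, by simp⟩
    | succ k ih =>
      obtain ⟨a, ha, h⟩ := ih
      refine ⟨min a (u k / 2), lt_min ha (by have := hu k; linarith), fun n hn => ?_⟩
      rcases Nat.lt_succ_iff_lt_or_eq.1 hn with h1 | rfl
      · exact (min_le_left _ _).trans_lt (h n h1)
      · exact (min_le_right _ _).trans_lt (by have := hu n; linarith)
  obtain ⟨a, ha, h⟩ := hmin
  refine ⟨min a (η / 2), lt_min ha (by linarith), fun {s} hs hd => ?_⟩
  have hs0 : 0 < s := hs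
  rw [Real.dist_eq, sub_zero, abs_of_pos hs0] at hd
  have hsup : (⨆ n, if u n ≤ s then r n else 0) ≤ η / 2 := by
    refine ciSup_le fun n => ?_
    split_ifs with hn
    · refine (hn₀ n ?_).le
      by_contra hlt
      exact absurd (h n (not_le.1 hlt)) (not_lt.2 (hn.trans (hd.le.trans (min_le_left _ _))))
    · linarith
  have hs2 : s < η / 2 := hd.trans_le (min_le_right _ _)
  have := hnn s
  unfold envelope
  rw [Real.dist_eq, sub_zero, abs_of_nonneg (by linarith)]
  linarith

/-- Diagonal choice of an index: eventual statements `p k n`, one for each `k`, hold along some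
`k n → ∞`. -/
theorem exists_tendsto_eventually_diag {p : ℕ → ℕ → Prop} (h : ∀ k, ∀ᶠ n in atTop, p k n) :
    ∃ κ : ℕ → ℕ, Tendsto κ atTop atTop ∧ ∀ᶠ n in atTop, p (κ n) n := by
  classical
  choose N hN using fun k => eventually_atTop.1 (h k)
  -- The largest `k ≤ n` whose statement already holds from `n` on. Before `N 0` the default value
  -- `0` carries no information, hence the restriction to `n ≥ N 0` below.
  let κ : ℕ → ℕ := fun n => Nat.findGreatest (fun k => N k ≤ n) n
  refine ⟨κ, ?_, ?_⟩
  · refine tendsto_atTop.2 fun k => ?_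
    filter_upwards [eventually_ge_atTop (max k (N k))] with n hn
    exact Nat.le_findGreatest (le_trans (le_max_left _ _) hn) (le_trans (le_max_right _ _) hn)
  · filter_upwards [eventually_ge_atTop (N 0)] with n hn
    exact hN _ _ (Nat.findGreatest_spec (P := fun k => N k ≤ n) (Nat.zero_le n) hn)

/-- A large-deviation bound with every fixed threshold `δ` and every fixed exponent `M` turns into
a bound with vanishing thresholds and diverging exponents. -/
theorem exists_rates {ι : Type*} {E : Type*} [SeminormedAddCommGroup E] {u : ℕ → ℝ}
    (hu : ∀ n, 0 < u n)
    (dom : ℕ → E → ι → Prop) (prob : ℕ → E → ι → ℝ → ℝ)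
    (hanti : ∀ n b i, dom n b i → Antitone (prob n b i))
    (hone : ∀ n b i δ, dom n b i → prob n b i δ ≤ 1)
    (h : ∀ R δ M : ℝ, 0 < R → 0 < δ → 0 < M → ∀ᶠ n : ℕ in atTop, ∀ b i, ‖b‖ ≤ R → dom n b i →
      prob n b i δ ≤ Real.exp (-(M * (n * u n ^ 2)))) :
    ∃ ω₁ ω₂ : ℝ → ℝ, IsRate ω₁ ∧ IsRate ω₂ ∧ ∀ R : ℝ, 0 < R → ∃ C₁ : ℝ, 0 < C₁ ∧
      ∀ b, ‖b‖ ≤ R → ∀ n i, dom n b i →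
        prob n b i (ω₁ (u n)) < C₁ * Real.exp (-(n * u n ^ 2 / ω₂ (u n))) := by
  -- Radius, threshold and exponent are tied to the same index, which is what makes the rates
  -- independent of `R`.
  obtain ⟨κ, hκ, hev⟩ := exists_tendsto_eventually_diag (p := fun k n => ∀ b i, ‖b‖ ≤ (k : ℝ) + 1 →
    dom n b i → prob n b i (1 / ((k : ℝ) + 1)) ≤ Real.exp (-(((k : ℝ) + 1) * (n * u n ^ 2))))
    (fun k => h _ _ _ (by positivity) (by positivity) (by positivity))
  let r : ℕ → ℝ := fun n => 1 / ((κ n : ℝ) + 1)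
  have hr0 : ∀ n, 0 ≤ r n := fun n => by positivity
  have hr1 : ∀ n, r n ≤ 1 := fun n => by
    show 1 / ((κ n : ℝ) + 1) ≤ 1
    rw [div_le_one (by positivity)]
    linarith [(Nat.cast_nonneg (κ n) : (0 : ℝ) ≤ κ n)]
  have hr : Tendsto r atTop (𝓝 0) := tendsto_one_div_add_atTop_nhds_zero_nat.comp hκ
  have hrate := isRate_envelope hu hr0 hr
  refine ⟨envelope u r, envelope u r, hrate, hrate, fun R hR => ?_⟩
  obtain ⟨k₀, hk₀⟩ := exists_nat_ge R
  obtain ⟨N, hN⟩ := eventually_atTop.1 (hev.and (hκ.eventually_ge_atTop k₀))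
  -- For `n < N` the probability is only known to be at most one; the corresponding summand makes
  -- the right-hand side at least two.
  refine ⟨2 + ∑ n ∈ Finset.range N, 2 * Real.exp (n * u n ^ 2 / envelope u r (u n)),
    by positivity, fun b hb n i hd => ?_⟩
  set W := envelope u r (u n) with hW
  have hWpos : 0 < W := hrate.1 _ (hu n)
  by_cases hn : N ≤ n
  · obtain ⟨h1, h2⟩ := hN n hn
    have hkR : ‖b‖ ≤ (κ n : ℝ) + 1 := by
      have : (k₀ : ℝ) ≤ κ n := by exact_mod_cast h2
      linarith
    have hrW : r n ≤ W := le_envelope hu hr1 n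
    calc prob n b i W ≤ prob n b i (r n) := hanti n b i hd hrW
      _ ≤ Real.exp (-(((κ n : ℝ) + 1) * (n * u n ^ 2))) := h1 b i hkR hd
      _ ≤ Real.exp (-(n * u n ^ 2 / W)) := by
        apply Real.exp_le_exp.2
        apply neg_le_neg
        rw [div_le_iff₀ hWpos]
        have h3 : 1 ≤ ((κ n : ℝ) + 1) * W := by
          have : 1 / ((κ n : ℝ) + 1) ≤ W := hrW
          rwa [div_le_iff₀ (by positivity), mul_comm] at this
        have h4 : 0 ≤ (n : ℝ) * u n ^ 2 := by positivity
        nlinarith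
      _ < _ := by
        refine lt_mul_of_one_lt_left (Real.exp_pos _) ?_
        have : 0 ≤ ∑ n ∈ Finset.range N, 2 * Real.exp (n * u n ^ 2 / envelope u r (u n)) := by
          positivity
        linarith
  · calc prob n b i W ≤ 1 := hone n b i _ hd
      _ < 2 * Real.exp (n * u n ^ 2 / W) * Real.exp (-(n * u n ^ 2 / W)) := by
        rw [mul_assoc, ← Real.exp_add]; simp
      _ ≤ _ := by
        gcongr
        have := Finset.single_le_sum (f := fun n : ℕ => 2 * Real.exp (n * u n ^ 2 / envelope u r (u n)))
          (fun i _ => by positivity) (Finset.mem_range.2 (not_le.1 hn))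
        simp only [← hW] at this
        linarith


/-! ### Deterministic expansion of the log-likelihood increment -/

theorem abs_log_one_add_sub_le {x : ℝ} (hx : |x| ≤ 1 / 2) :
    |Real.log (1 + x) - x| ≤ 2 * x ^ 2 := by
  have h := Real.abs_log_sub_add_sum_range_le (x := -x) (by rw [abs_neg]; linarith) 1
  simp only [Finset.sum_range_one, abs_neg, sub_neg_eq_add] at h
  norm_num at h
  rw [show -x + Real.log (1 + x) = Real.log (1 + x) - x by ring] at h
  refine h.trans ?_
  rw [div_le_iff₀ (by linarith)]
  nlinarith [sq_nonneg x]

theorem abs_log_one_add_sub_add_sq_le {x : ℝ} (hx : |x| ≤ 1 / 2) :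
    |Real.log (1 + x) - x + x ^ 2 / 2| ≤ 2 * |x| ^ 3 := by
  have h := Real.abs_log_sub_add_sum_range_le (x := -x) (by rw [abs_neg]; linarith) 2
  simp only [Finset.sum_range_succ, Finset.sum_range_zero, abs_neg, sub_neg_eq_add] at h
  norm_num at h
  rw [show -x + x ^ 2 / 2 + Real.log (1 + x) = Real.log (1 + x) - x + x ^ 2 / 2 by ring] at h
  refine h.trans ?_
  rw [div_le_iff₀ (by linarith)]
  nlinarith [pow_nonneg (abs_nonneg x) 3]

/-- The remainder functional controlling all errors in the local expansion of a log-likelihood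
ratio, in terms of square roots of densities `q`, `p`, `p'`. -/
def expansionRemainder (e q p p' F α β : ℝ) : ℝ :=
  (if e < F then q ^ 2 * F ^ 2 else 0) + (p' - p - α * q) ^ 2 + (p - q - β * q) ^ 2

/-- The truncated and centred log-likelihood increment. -/
def truncatedIncrement (ε ε' p p' F α : ℝ) : ℝ :=
  (if |2 * Real.log (p' / p)| ≤ ε' then 2 * Real.log (p' / p) else 0)
    - 2 * (if F < ε then α else 0)

theorem add_add_sq_le (a b c : ℝ) : (a + b + c) ^ 2 ≤ 3 * (a ^ 2 + b ^ 2 + c ^ 2) := by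
  nlinarith [sq_nonneg (a - b), sq_nonneg (a - c), sq_nonneg (b - c)]

theorem mul_sq_le_of_abs_le {α C F : ℝ} (q : ℝ) (h : |α| ≤ C * F) :
    (q * α) ^ 2 ≤ C ^ 2 * (q ^ 2 * F ^ 2) := by
  have h1 : α ^ 2 ≤ (C * F) ^ 2 := sq_le_sq' (abs_le.1 h).1 (abs_le.1 h).2
  have := mul_le_mul_of_nonneg_right h1 (sq_nonneg q)
  linarith [this]

theorem expansionRemainder_nonneg (e q p p' F α β : ℝ) :
    0 ≤ expansionRemainder e q p p' F α β := by
  rw [expansionRemainder]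
  split_ifs <;> positivity

/-- When `F > e`, the first term of the remainder is present and `q² ≤ q²F²/e²`; then `p` is a sum
of three controlled terms. -/
theorem far_of_lt {R e : ℝ} (he : 0 < e) {q p r F β Q : ℝ}
    (hF : e < F) (hβ : |β| ≤ R * F) (hpq : p = q + q * β + r) (hQF : q ^ 2 * F ^ 2 ≤ Q)
    (hQr : r ^ 2 ≤ Q) :
    q ^ 2 ≤ 1 / e ^ 2 * Q ∧ p ^ 2 ≤ 3 * (1 / e ^ 2 + R ^ 2 + 1) * Q := by
  have h1 : q ^ 2 ≤ 1 / e ^ 2 * Q := by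
    rw [div_mul_eq_mul_div, one_mul, le_div_iff₀ (by positivity)]
    refine le_trans ?_ hQF
    gcongr
  refine ⟨h1, ?_⟩
  have h2 := mul_sq_le_of_abs_le q hβ
  have h3 : R ^ 2 * (q ^ 2 * F ^ 2) ≤ R ^ 2 * Q := by gcongr
  have h4 := add_add_sq_le q (q * β) r
  rw [← hpq] at h4
  linarith

/-- Here the errors `r`, `ρ` are large relative to `p`, so they bound `p`; since `|β| ≤ 1/2`, `q` is
comparable with `p + |r|`. -/
theorem far_of_le {R e : ℝ} (hR : 0 ≤ R) (he : 0 < e) (hRe : R * e ≤ 1 / 2)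
    {q p r ρ F β Q : ℝ} (hq : 0 < q) (hp : 0 < p) (hF0 : 0 ≤ F)
    (hF : F ≤ e) (hβ : |β| ≤ R * F) (hpq : p = q + q * β + r) (hor : e * p < |r| + |ρ|)
    (hQ : r ^ 2 + ρ ^ 2 ≤ Q) :
    p ^ 2 ≤ 2 / e ^ 2 * Q ∧ q ^ 2 ≤ 8 * (2 / e ^ 2 + 1) * Q ∧
      q ^ 2 * F ^ 2 ≤ e ^ 2 * (8 * (2 / e ^ 2 + 1)) * Q := by
  have h1 : p ^ 2 ≤ 2 / e ^ 2 * Q := by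
    rw [div_mul_eq_mul_div, le_div_iff₀ (by positivity), ← mul_pow, mul_comm]
    have : (e * p) ^ 2 ≤ (|r| + |ρ|) ^ 2 := by gcongr
    have h3 := add_sq_le (a := |r|) (b := |ρ|)
    rw [sq_abs, sq_abs] at h3
    linarith
  have hβ1 : |β| ≤ 1 / 2 := hβ.trans ((mul_le_mul_of_nonneg_left hF hR).trans hRe)
  have hq1 : q ≤ 2 * (p + |r|) := by
    have h2 : q * (-(1 / 2)) ≤ q * β := by gcongr; exact (abs_le.1 hβ1).1
    have := neg_abs_le r
    linarith
  have h2 : q ^ 2 ≤ 8 * (2 / e ^ 2 + 1) * Q := by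
    have h3 : q ^ 2 ≤ (2 * (p + |r|)) ^ 2 := by gcongr
    have h4 := add_sq_le (a := p) (b := |r|)
    rw [sq_abs] at h4
    have := sq_nonneg ρ
    rw [mul_pow] at h3
    linarith
  refine ⟨h1, h2, ?_⟩
  have h3 : 0 ≤ 8 * (2 / e ^ 2 + 1) * Q := (sq_nonneg q).trans h2
  calc q ^ 2 * F ^ 2 ≤ (8 * (2 / e ^ 2 + 1) * Q) * e ^ 2 := by gcongr
    _ = _ := by ring

/-- Outside the region where Taylor expansion is possible, the remainder dominates every quantity in
sight, so any crude bound on the increment is good enough there. -/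
theorem expansionRemainder_far {R C e : ℝ} (hR : 0 ≤ R) (he : 0 < e) (hRe : R * e ≤ 1 / 2) :
    ∃ K, 0 < K ∧ ∀ q p p' F α β : ℝ, 0 < q → 0 < p → 0 < p' → 0 ≤ F → |α| ≤ C * F → |β| ≤ R * F →
      (e < F ∨ e * p < |p - q - β * q| + |p' - p - α * q|) →
      q ^ 2 ≤ K * expansionRemainder e q p p' F α β ∧
      p ^ 2 ≤ K * expansionRemainder e q p p' F α β ∧
      p' ^ 2 ≤ K * expansionRemainder e q p p' F α β ∧
      q ^ 2 * F ^ 2 ≤ K * expansionRemainder e q p p' F α β := by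
  obtain ⟨K₀, hK₀, H⟩ : ∃ K, 0 < K ∧ ∀ q p p' F α β : ℝ, 0 < q → 0 < p → 0 < p' → 0 ≤ F →
      |α| ≤ C * F → |β| ≤ R * F → (e < F ∨ e * p < |p - q - β * q| + |p' - p - α * q|) →
      q ^ 2 ≤ K * expansionRemainder e q p p' F α β ∧
      p ^ 2 ≤ K * expansionRemainder e q p p' F α β ∧
      q ^ 2 * F ^ 2 ≤ K * expansionRemainder e q p p' F α β := by
    have n1 : 0 ≤ 1 / e ^ 2 := by positivity
    have n2 : 0 ≤ 3 * (1 / e ^ 2 + R ^ 2 + 1) := by positivity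
    have n3 : 0 ≤ 2 / e ^ 2 := by positivity
    have n4 : 0 ≤ 8 * (2 / e ^ 2 + 1) := by positivity
    have n5 : 0 ≤ e ^ 2 * (8 * (2 / e ^ 2 + 1)) := by positivity
    refine ⟨1 / e ^ 2 + 3 * (1 / e ^ 2 + R ^ 2 + 1) + 1 + 2 / e ^ 2 + 8 * (2 / e ^ 2 + 1)
      + e ^ 2 * (8 * (2 / e ^ 2 + 1)), by positivity, ?_⟩
    intro q p p' F α β hq hp hp' hF hα hβ hor
    have hQ0 := expansionRemainder_nonneg e q p p' F α β
    have hpq : p = q + q * β + (p - q - β * q) := by ring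
    by_cases hFe : e < F
    · have hQ : expansionRemainder e q p p' F α β
          = q ^ 2 * F ^ 2 + (p' - p - α * q) ^ 2 + (p - q - β * q) ^ 2 := by
        simp [expansionRemainder, hFe]
      have n6 : 0 ≤ q ^ 2 * F ^ 2 := by positivity
      have n7 := sq_nonneg (p' - p - α * q)
      have n8 := sq_nonneg (p - q - β * q)
      have hQF : q ^ 2 * F ^ 2 ≤ expansionRemainder e q p p' F α β := by rw [hQ]; linarith
      obtain ⟨h1, h2⟩ := far_of_lt he hFe hβ hpq hQF (by rw [hQ]; linarith)
      refine ⟨h1.trans ?_, h2.trans ?_, (hQF.trans_eq (one_mul _).symm).trans ?_⟩ <;>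
      · refine mul_le_mul_of_nonneg_right ?_ hQ0
        linarith
    · have hQ : expansionRemainder e q p p' F α β
          = (p' - p - α * q) ^ 2 + (p - q - β * q) ^ 2 := by
        simp [expansionRemainder, hFe]
      obtain ⟨h1, h2, h3⟩ := far_of_le hR he hRe hq hp hF (not_lt.1 hFe) hβ hpq
        (hor.resolve_left hFe) (Q := expansionRemainder e q p p' F α β) (by rw [hQ]; linarith)
      refine ⟨h2.trans ?_, h1.trans ?_, h3.trans ?_⟩ <;>
      · refine mul_le_mul_of_nonneg_right ?_ hQ0
        linarith
  have n1 : 0 ≤ C ^ 2 * K₀ := by positivity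
  refine ⟨K₀ + 3 * (K₀ + C ^ 2 * K₀ + 1), by positivity, ?_⟩
  intro q p p' F α β hq hp hp' hF hα hβ hor
  obtain ⟨h1, h2, h3⟩ := H q p p' F α β hq hp hp' hF hα hβ hor
  have hQ0 := expansionRemainder_nonneg e q p p' F α β
  have hρQ : (p' - p - α * q) ^ 2 ≤ expansionRemainder e q p p' F α β := by
    have n7 : 0 ≤ q ^ 2 * F ^ 2 := by positivity
    have n8 := sq_nonneg (p - q - β * q)
    rw [expansionRemainder]
    split_ifs <;> linarith
  have hα2 := mul_sq_le_of_abs_le q hα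
  have h4 := add_add_sq_le p (q * α) (p' - p - α * q)
  rw [show p + q * α + (p' - p - α * q) = p' by ring] at h4
  have h5 := mul_le_mul_of_nonneg_left h3 (sq_nonneg C)
  have h6 := mul_nonneg hK₀.le hQ0
  have h7 := mul_nonneg n1 hQ0
  refine ⟨?_, ?_, ?_, ?_⟩ <;> linarith

/-- Since `p x = qα + ρ` and `αp = αq + αβq + αr`, the linear terms `qα` cancel. What is left is
either a remainder or a product of two small factors, which gains a power of `e`. -/
theorem near_sq_le {R C e L : ℝ} (hC : 0 ≤ C) (he : 0 < e) (he1 : e ≤ 1)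
    (hL : 0 < L) (hLe : L * e ≤ 1 / 2) {q p D r ρ F α β x l : ℝ} (hq : 0 < q) (hp : 0 < p)
    (hpq : p = q + q * β + r) (hDa : D = q * α + ρ) (hpx : p * x = D)
    (hxle : |x| ≤ L * e) (hl : |l - x| ≤ 2 * x ^ 2) (hDle : |D| ≤ C * (F * q) + |ρ|)
    (hαe : |α| ≤ C * e) (hβ : |β| ≤ R * F) :
    (p * (2 * l - 2 * α)) ^ 2 ≤ (48 + 12 * C ^ 2) * (ρ ^ 2 + r ^ 2)
      + 3 * e * (4 * L * C + 2 * C * R) ^ 2 * (q ^ 2 * F ^ 2) := by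
  have e1 : p * (2 * l - 2 * α)
      = 2 * (p * (l - x)) + 2 * ρ + (-2 * (α * (β * q))) + (-2 * (α * r)) := by
    linear_combination 2 * hpx + 2 * hDa - 2 * α * hpq
  have a1 : |2 * (p * (l - x))| ≤ 4 * (L * e) * (C * (F * q) + |ρ|) := by
    rw [abs_mul, abs_mul, abs_two, abs_of_pos hp]
    have h3 : p * |l - x| ≤ p * (2 * x ^ 2) := by gcongr
    have h4 : p * (2 * x ^ 2) = 2 * (|x| * |D|) := by
      rw [← hpx, abs_mul, abs_of_pos hp, ← sq_abs x]; ring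
    have h5 : |x| * |D| ≤ (L * e) * (C * (F * q) + |ρ|) := by gcongr
    linarith
  have a2 : |2 * ρ| = 2 * |ρ| := by rw [abs_mul, abs_two]
  have a3 : |-2 * (α * (β * q))| ≤ 2 * (C * e * (R * F * q)) := by
    rw [abs_mul, abs_mul, abs_mul, abs_of_pos hq, abs_neg, abs_two]
    gcongr
  have a4 : |-2 * (α * r)| ≤ 2 * (C * e * |r|) := by
    rw [abs_mul, abs_mul, abs_neg, abs_two]
    gcongr
  have b1 : C * e * |r| ≤ C * 1 * |r| := by gcongr
  have b2 : (L * e) * |ρ| ≤ 1 / 2 * |ρ| := by gcongr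
  obtain ⟨A, hA⟩ : ∃ A, A = e * (4 * L * C + 2 * C * R) * (F * q) := ⟨_, rfl⟩
  have h1 : |p * (2 * l - 2 * α)| ≤ A + 4 * |ρ| + 2 * C * |r| := by
    rw [e1, hA]
    have c1 := abs_add_le (2 * (p * (l - x)) + 2 * ρ + (-2 * (α * (β * q)))) (-2 * (α * r))
    have c2 := abs_add_le (2 * (p * (l - x)) + 2 * ρ) (-2 * (α * (β * q)))
    have c3 := abs_add_le (2 * (p * (l - x))) (2 * ρ)
    linarith
  have h2 : (p * (2 * l - 2 * α)) ^ 2 ≤ (A + 4 * |ρ| + 2 * C * |r|) ^ 2 := by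
    rw [← sq_abs (p * (2 * l - 2 * α))]; gcongr
  have h3 := add_add_sq_le A (4 * |ρ|) (2 * C * |r|)
  rw [mul_pow, mul_pow, sq_abs, sq_abs] at h3
  have h4 : 3 * A ^ 2 ≤ 3 * e * (4 * L * C + 2 * C * R) ^ 2 * (q ^ 2 * F ^ 2) := by
    have : 3 * A ^ 2 = e * (3 * e * (4 * L * C + 2 * C * R) ^ 2 * (q ^ 2 * F ^ 2)) := by
      rw [hA]; ring
    rw [this]
    exact mul_le_of_le_one_left (by positivity) he1
  have h6 : 0 ≤ C ^ 2 * ρ ^ 2 := by positivity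
  have h7 := sq_nonneg r
  linarith

/-- To second order `2p² log(p'/p)` is `2pD - D²`, whereas `p'² - p² = 2pD + D²`; the difference is
`-2D² ≈ -2(qα)²`. Likewise `-2αp² ≈ -2αq² - 4αβq²`. All main terms therefore cancel. The cross terms
of `qα` with `r` and `ρ` are split by the weighted arithmetic-geometric inequality with free weight
`η₁`. -/
theorem near_mean_le {R C e η₁ L : ℝ} (hC : 0 ≤ C) (he1 : e ≤ 1)
    (hη₁ : 0 < η₁) (hLe : L * e ≤ 1 / 2) {q p p' D r ρ F α β x l : ℝ}
    (hp : 0 < p) (hp' : p' = p + D) (hpq : p = q + q * β + r) (hDa : D = q * α + ρ)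
    (hpx : p * x = D) (hxle : |x| ≤ L * e) (hl : |l - x + x ^ 2 / 2| ≤ 2 * |x| ^ 3)
    (hαe : |α| ≤ C * e) (hα2 : (q * α) ^ 2 ≤ C ^ 2 * (q ^ 2 * F ^ 2))
    (hβ2 : (q * β) ^ 2 ≤ R ^ 2 * (q ^ 2 * F ^ 2)) :
    |p ^ 2 * (2 * l - 2 * α) - (p' ^ 2 - p ^ 2) + 2 * (q * α) ^ 2
        + 2 * q ^ 2 * α + 4 * ((q * β) * (q * α))|
        ≤ (6 + 2 * (1 / η₁) + 4 * C) * (ρ ^ 2 + r ^ 2) + (8 * L * e * C ^ 2 + 4 * C * e * R ^ 2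
          + 4 * η₁ * C ^ 2) * (q ^ 2 * F ^ 2) := by
  obtain ⟨D₀, hD₀⟩ : ∃ D₀, D₀ = q * β + r := ⟨_, rfl⟩
  have e1 : p ^ 2 * (2 * l - 2 * α) - (p' ^ 2 - p ^ 2) + 2 * (q * α) ^ 2
      + 2 * q ^ 2 * α + 4 * ((q * β) * (q * α))
      = 2 * (p ^ 2 * (l - x + x ^ 2 / 2)) + -4 * ((q * α) * ρ) + -2 * ρ ^ 2 +
        -4 * ((q * α) * r) + -2 * (D₀ ^ 2 * α) := by
    have h1 : p = q + D₀ := by rw [hD₀, hpq]; ring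
    have h3 : p ^ 2 * x = p * D := by rw [← hpx]; ring
    have h4 : p ^ 2 * x ^ 2 = D ^ 2 := by rw [← hpx]; ring
    have h5 : p' ^ 2 - p ^ 2 = 2 * p * D + D ^ 2 := by rw [hp']; ring
    have h6 : p ^ 2 = q ^ 2 + 2 * q * D₀ + D₀ ^ 2 := by rw [h1]; ring
    have h7 : D ^ 2 = (q * α) ^ 2 + 2 * (q * α) * ρ + ρ ^ 2 := by rw [hDa]; ring
    rw [h5]
    linear_combination 2 * h3 - h4 - 2 * h7 - 2 * α * h6 - 4 * α * q * hD₀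
  rw [e1]
  have a1 : |2 * (p ^ 2 * (l - x + x ^ 2 / 2))|
      ≤ 8 * (L * e) * (C ^ 2 * (q ^ 2 * F ^ 2)) + 4 * ρ ^ 2 := by
    rw [abs_mul, abs_mul, abs_two, abs_of_pos (by positivity : 0 < p ^ 2)]
    have h3 : p ^ 2 * |l - x + x ^ 2 / 2| ≤ p ^ 2 * (2 * |x| ^ 3) := by gcongr
    have h4 : p ^ 2 * (2 * |x| ^ 3) = 2 * (|x| * D ^ 2) := by
      rw [← hpx, mul_pow, ← sq_abs x]; ring
    have h5 : D ^ 2 ≤ 2 * (C ^ 2 * (q ^ 2 * F ^ 2) + ρ ^ 2) := by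
      have := add_sq_le (a := q * α) (b := ρ)
      rw [hDa]; linarith
    have h8 : 0 ≤ L * e := (abs_nonneg x).trans hxle
    have h6 : |x| * D ^ 2 ≤ (L * e) * (2 * (C ^ 2 * (q ^ 2 * F ^ 2) + ρ ^ 2)) := by gcongr
    have h7 : (L * e) * ρ ^ 2 ≤ 1 / 2 * ρ ^ 2 := by gcongr
    linarith [sq_nonneg ρ]
  have amgm : ∀ y : ℝ, |-4 * ((q * α) * y)|
      ≤ 2 * η₁ * (C ^ 2 * (q ^ 2 * F ^ 2)) + 2 * (1 / η₁) * y ^ 2 := by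
    intro y
    have h1 : 2 * (|q * α| * |y|) ≤ η₁ * (q * α) ^ 2 + (1 / η₁) * y ^ 2 := by
      have h2 : 0 ≤ (1 / η₁) * (η₁ * |q * α| - |y|) ^ 2 := by positivity
      have h3 : (1 / η₁) * (η₁ * |q * α| - |y|) ^ 2
          = η₁ * |q * α| ^ 2 - 2 * (|q * α| * |y|) + (1 / η₁) * |y| ^ 2 := by
        field_simp; ring
      rw [h3, sq_abs, sq_abs] at h2
      linarith
    rw [abs_mul, abs_mul, abs_neg]
    have h4 : |(4 : ℝ)| = 4 := by norm_num
    rw [h4]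
    have h5 : η₁ * (q * α) ^ 2 ≤ η₁ * (C ^ 2 * (q ^ 2 * F ^ 2)) := by gcongr
    linarith
  have a2 := amgm ρ
  have a4 := amgm r
  have a3 : |-2 * ρ ^ 2| = 2 * ρ ^ 2 := by
    rw [abs_mul, abs_neg, abs_two, abs_of_nonneg (sq_nonneg _)]
  have a5 : |-2 * (D₀ ^ 2 * α)| ≤ 4 * (C * e) * (R ^ 2 * (q ^ 2 * F ^ 2)) + 4 * C * r ^ 2 := by
    rw [abs_mul, abs_mul, abs_neg, abs_two, abs_of_nonneg (sq_nonneg _)]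
    have h5 : D₀ ^ 2 ≤ 2 * (R ^ 2 * (q ^ 2 * F ^ 2) + r ^ 2) := by
      have := add_sq_le (a := q * β) (b := r)
      rw [hD₀]; linarith
    have h6 : D₀ ^ 2 * |α| ≤ (2 * (R ^ 2 * (q ^ 2 * F ^ 2) + r ^ 2)) * (C * e) := by gcongr
    have h7 : C * e * r ^ 2 ≤ C * 1 * r ^ 2 := by gcongr
    linarith
  have c1 := abs_add_le (2 * (p ^ 2 * (l - x + x ^ 2 / 2)) + -4 * ((q * α) * ρ) + -2 * ρ ^ 2 +
        -4 * ((q * α) * r)) (-2 * (D₀ ^ 2 * α))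
  have c2 := abs_add_le (2 * (p ^ 2 * (l - x + x ^ 2 / 2)) + -4 * ((q * α) * ρ) + -2 * ρ ^ 2)
        (-4 * ((q * α) * r))
  have c3 := abs_add_le (2 * (p ^ 2 * (l - x + x ^ 2 / 2)) + -4 * ((q * α) * ρ)) (-2 * ρ ^ 2)
  have c4 := abs_add_le (2 * (p ^ 2 * (l - x + x ^ 2 / 2))) (-4 * ((q * α) * ρ))
  have g4 : 0 ≤ 4 * C * ρ ^ 2 := by positivity
  have g5 := sq_nonneg r
  linarith

/-- In this region `q ≤ 4p`, so the relative increment `x = p'/p - 1` satisfies `|x| ≤ (4C + 1)e`;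
this is the origin of `L`. For small `e` neither truncation is active and the increment is exactly
`2 log(1 + x) - 2α`. -/
theorem truncatedIncrement_near {R C ε ε' η η₁ e L : ℝ} (hR : 0 ≤ R) (hC : 0 ≤ C)
    (he : 0 < e) (hη₁ : 0 < η₁) (hL : L = 4 * C + 1)
    (hRe : R * e ≤ 1 / 2) (he4 : e ≤ 1 / 4) (hLe : L * e ≤ 1 / 2) (hLε : 4 * (L * e) ≤ ε')
    (heε : e < ε) (hη : 3 * e * (4 * L * C + 2 * C * R) ^ 2 ≤ η)
    (hη' : 8 * L * e * C ^ 2 + 4 * C * e * R ^ 2 + 4 * η₁ * C ^ 2 ≤ η)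
    {K : ℝ} (hK : 48 + 12 * C ^ 2 ≤ K) (hK' : 6 + 2 * (1 / η₁) + 4 * C ≤ K)
    {q p p' F α β : ℝ} (hq : 0 < q) (hp : 0 < p)
    (hα : |α| ≤ C * F) (hβ : |β| ≤ R * F) (hFe : F ≤ e)
    (hsmall : |p - q - β * q| + |p' - p - α * q| ≤ e * p) :
    (p * truncatedIncrement ε ε' p p' F α) ^ 2
        ≤ K * expansionRemainder e q p p' F α β + η * (q ^ 2 * F ^ 2) ∧
    |p ^ 2 * truncatedIncrement ε ε' p p' F α - (p' ^ 2 - p ^ 2) + 2 * (q * α) ^ 2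
        + 2 * q ^ 2 * α + 4 * ((q * β) * (q * α))|
        ≤ K * expansionRemainder e q p p' F α β + η * (q ^ 2 * F ^ 2) ∧
    |2 * Real.log (p' / p)| ≤ ε' := by
  have hQ : expansionRemainder e q p p' F α β = (p' - p - α * q) ^ 2 + (p - q - β * q) ^ 2 := by
    simp [expansionRemainder, not_lt.2 hFe]
  rw [hQ]
  obtain ⟨r, hr⟩ : ∃ r, r = p - q - β * q := ⟨_, rfl⟩
  obtain ⟨ρ, hρ⟩ : ∃ ρ, ρ = p' - p - α * q := ⟨_, rfl⟩
  rw [← hr, ← hρ] at hsmall ⊢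
  have hpq : p = q + q * β + r := by rw [hr]; ring
  have hβ1 : |β| ≤ 1 / 2 := hβ.trans ((mul_le_mul_of_nonneg_left hFe hR).trans hRe)
  have hr0 := abs_nonneg r
  have hρ0 := abs_nonneg ρ
  have hq1 : q ≤ 4 * p := by
    have h2 : q * (-(1 / 2)) ≤ q * β := by gcongr; exact (abs_le.1 hβ1).1
    have h3 := neg_abs_le r
    have h4 : e * p ≤ 1 / 4 * p := by gcongr
    linarith
  have hLpos : 0 < L := by rw [hL]; positivity
  obtain ⟨D, hD⟩ : ∃ D, D = p' - p := ⟨_, rfl⟩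
  have hDa : D = q * α + ρ := by rw [hρ, hD]; ring
  have hDle : |D| ≤ C * (F * q) + |ρ| := by
    rw [hDa]
    refine (abs_add_le _ _).trans ?_
    rw [abs_mul, abs_of_pos hq]
    have : q * |α| ≤ q * (C * F) := by gcongr
    linarith
  have hDp : |D| ≤ L * e * p := by
    have h1 : C * (F * q) ≤ C * (e * (4 * p)) := by gcongr
    rw [hL]; linarith
  obtain ⟨x, hx⟩ : ∃ x, x = D / p := ⟨_, rfl⟩
  have hpx : p * x = D := by rw [hx]; field_simp
  have hxle : |x| ≤ L * e := by
    rw [hx, abs_div, abs_of_pos hp, div_le_iff₀ hp]; exact hDp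
  have hx2 : |x| ≤ 1 / 2 := hxle.trans hLe
  have hratio : p' / p = 1 + x := by rw [hx, hD]; field_simp; ring
  have hl1 := abs_log_one_add_sub_le hx2
  have hl2 := abs_log_one_add_sub_add_sq_le hx2
  obtain ⟨l, hl⟩ : ∃ l, l = Real.log (1 + x) := ⟨_, rfl⟩
  rw [← hl] at hl1 hl2
  have hξ : |2 * l| ≤ ε' := by
    have h1 : |l| ≤ |x| + 2 * x ^ 2 := by
      have := abs_add_le (l - x) x
      rw [sub_add_cancel] at this
      linarith
    have h2 : 2 * x ^ 2 ≤ |x| := by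
      rw [← sq_abs x, sq]
      have := mul_le_mul_of_nonneg_right hx2 (abs_nonneg x)
      linarith
    rw [abs_mul, abs_two]
    linarith
  have hY : truncatedIncrement ε ε' p p' F α = 2 * l - 2 * α := by
    rw [truncatedIncrement, hratio, ← hl, if_pos hξ, if_pos (hFe.trans_lt heε)]
  rw [hY]
  have hαe : |α| ≤ C * e := hα.trans (by gcongr)
  have hS : 0 ≤ ρ ^ 2 + r ^ 2 := by positivity
  have hqF : 0 ≤ q ^ 2 * F ^ 2 := by positivity
  refine ⟨?_, ?_, by rw [hratio, ← hl]; exact hξ⟩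
  · refine (near_sq_le hC he (by linarith) hLpos hLe hq hp hpq hDa hpx hxle hl1 hDle hαe
      hβ).trans ?_
    gcongr
  · refine (near_mean_le hC (by linarith) hη₁ hLe hp (by rw [hD]; ring) hpq hDa hpx hxle hl2
      hαe (mul_sq_le_of_abs_le q hα) (mul_sq_le_of_abs_le q hβ)).trans ?_
    gcongr

/-- The bound in the region where the increments are not small. -/
theorem truncatedIncrement_far {R C ε ε' B K Q q p p' F α β : ℝ}
    (hR : 0 ≤ R) (hC : 0 ≤ C) (hε' : 0 < ε')
    (hB : B = ε' + 2 * (C * ε)) (hε : 0 < ε) (hq : 0 < q) (hF : 0 ≤ F)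
    (hα : |α| ≤ C * F) (hβ : |β| ≤ R * F)
    (b1 : q ^ 2 ≤ K * Q) (b2 : p ^ 2 ≤ K * Q) (b3 : p' ^ 2 ≤ K * Q) (b4 : q ^ 2 * F ^ 2 ≤ K * Q) :
    (p * truncatedIncrement ε ε' p p' F α) ^ 2 ≤ B ^ 2 * (K * Q) ∧
    |p ^ 2 * truncatedIncrement ε ε' p p' F α - (p' ^ 2 - p ^ 2) + 2 * (q * α) ^ 2
        + 2 * q ^ 2 * α + 4 * ((q * β) * (q * α))|
        ≤ (B + 2 + 2 * C ^ 2 + 2 * C + 4 * (R * C)) * (K * Q) := by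
  obtain ⟨T, hT⟩ : ∃ T, T = truncatedIncrement ε ε' p p' F α := ⟨_, rfl⟩
  have hTB : |T| ≤ B := by
    rw [hT, truncatedIncrement, hB]
    refine (abs_sub _ _).trans (add_le_add ?_ ?_)
    · split_ifs with h
      · exact h
      · simpa using hε'.le
    · rw [abs_mul, abs_two]
      split_ifs with h
      · have : |α| ≤ C * ε := hα.trans (by gcongr)
        linarith
      · rw [abs_zero, mul_zero]; positivity
  rw [← hT]
  obtain ⟨V, hV⟩ : ∃ V, V = K * Q := ⟨_, rfl⟩
  rw [← hV] at b1 b2 b3 b4 ⊢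
  have hV0 : 0 ≤ V := (sq_nonneg q).trans b1
  have hB0 : 0 ≤ B := (abs_nonneg T).trans hTB
  constructor
  · rw [mul_pow, mul_comm (B ^ 2)]
    have : T ^ 2 ≤ B ^ 2 := by rw [← sq_abs]; gcongr
    gcongr
  · have i1 : |p ^ 2 * T| ≤ V * B := by
      rw [abs_mul, abs_of_nonneg (by positivity : 0 ≤ p ^ 2)]
      gcongr
    have i2 : |p' ^ 2 - p ^ 2| ≤ 2 * V := by
      have := sq_nonneg p
      have := sq_nonneg p'
      rw [abs_le]; constructor <;> linarith
    have i3 : |2 * (q * α) ^ 2| ≤ 2 * (C ^ 2 * V) := by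
      rw [abs_of_nonneg (by positivity)]
      have h1 := mul_sq_le_of_abs_le q hα
      have h2 : C ^ 2 * (q ^ 2 * F ^ 2) ≤ C ^ 2 * V := by gcongr
      linarith
    -- The first power of `F` is interpolated between `q²` and `q²F²` through `q²(F - 1)² ≥ 0`.
    have hqF : q ^ 2 * F ≤ V := by
      have h1 := mul_nonneg (sq_nonneg q) (sq_nonneg (F - 1))
      rw [sub_sq] at h1
      linarith
    have i4 : |2 * q ^ 2 * α| ≤ 2 * (C * V) := by
      rw [abs_mul, abs_of_pos (by positivity : 0 < 2 * q ^ 2)]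
      calc 2 * q ^ 2 * |α| ≤ 2 * q ^ 2 * (C * F) := by gcongr
        _ = 2 * (C * (q ^ 2 * F)) := by ring
        _ ≤ 2 * (C * V) := by gcongr
    have i5 : |4 * ((q * β) * (q * α))| ≤ 4 * (R * C * V) := by
      rw [abs_mul, abs_mul, abs_mul, abs_mul, abs_of_pos hq]
      have h4 : |(4 : ℝ)| = 4 := by norm_num
      rw [h4]
      calc 4 * (q * |β| * (q * |α|)) ≤ 4 * (q * (R * F) * (q * (C * F))) := by gcongr
        _ = 4 * (R * C * (q ^ 2 * F ^ 2)) := by ring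
        _ ≤ 4 * (R * C * V) := by gcongr
    have c1 := abs_add_le (p ^ 2 * T - (p' ^ 2 - p ^ 2) + 2 * (q * α) ^ 2
      + 2 * q ^ 2 * α) (4 * ((q * β) * (q * α)))
    have c2 := abs_add_le (p ^ 2 * T - (p' ^ 2 - p ^ 2) + 2 * (q * α) ^ 2) (2 * q ^ 2 * α)
    have c3 := abs_add_le (p ^ 2 * T - (p' ^ 2 - p ^ 2)) (2 * (q * α) ^ 2)
    have c4 := abs_sub (p ^ 2 * T) (p' ^ 2 - p ^ 2)
    linarith

/-- Pointwise local expansion of the truncated log-likelihood increment, uniformly in all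
parameters. -/
theorem exists_expansion_bound {R C ε ε' η : ℝ} (hR : 0 ≤ R) (hC : 0 ≤ C) (hε : 0 < ε)
    (hε' : 0 < ε') (hη : 0 < η) :
    ∃ e K, 0 < e ∧ 0 < K ∧ ∀ q p p' F α β : ℝ, 0 < q → 0 < p → 0 < p' → 0 ≤ F →
      |α| ≤ C * F → |β| ≤ R * F →
      (p * truncatedIncrement ε ε' p p' F α) ^ 2
        ≤ K * expansionRemainder e q p p' F α β + η * (q ^ 2 * F ^ 2) ∧
      |p ^ 2 * truncatedIncrement ε ε' p p' F α - (p' ^ 2 - p ^ 2) + 2 * (q * α) ^ 2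
        + 2 * q ^ 2 * α + 4 * ((q * β) * (q * α))|
        ≤ K * expansionRemainder e q p p' F α β + η * (q ^ 2 * F ^ 2) ∧
      (ε' < |2 * Real.log (p' / p)| → p ^ 2 ≤ K * expansionRemainder e q p p' F α β) := by
  obtain ⟨L, hL⟩ : ∃ L, L = 4 * C + 1 := ⟨_, rfl⟩
  have hL0 : 0 < L := by rw [hL]; positivity
  have small : ∀ a b : ℝ, 0 ≤ a → 0 < b → ∀ᶠ e in 𝓝[>] (0 : ℝ), a * e ≤ b := by
    intro a b ha hb
    have h : Tendsto (fun e : ℝ => a * e) (𝓝[>] 0) (𝓝 (a * 0)) :=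
      ((continuous_const.mul continuous_id).tendsto 0).mono_left nhdsWithin_le_nhds
    rw [mul_zero] at h
    filter_upwards [h.eventually (gt_mem_nhds hb)] with e he using he.le
  obtain ⟨e, h1, h2, h3, h4, h5, h6, h7, he⟩ :=
    ((small R (1 / 2) hR (by norm_num)).and ((small 1 (1 / 4) (by norm_num) (by norm_num)).and
    ((small L (1 / 2) hL0.le (by norm_num)).and ((small (4 * L) ε' (by positivity) hε').and
    ((small 1 (ε / 2) (by norm_num) (by positivity)).and
    ((small (3 * (4 * L * C + 2 * C * R) ^ 2) η (by positivity) hη).and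
    ((small (8 * L * C ^ 2 + 4 * C * R ^ 2) (η / 2) (by positivity) (by positivity)).and
    (self_mem_nhdsWithin (a := (0 : ℝ)) (s := Set.Ioi 0))))))))).exists
  have he0 : 0 < e := he
  -- The weight must make `4η₁C²` at most half of `η`; the other half pays for the terms linear in
  -- `e`. The summand `8` covers `C = 0`.
  set η₁ := η / (8 * C ^ 2 + 8) with hη₁
  have hη₁0 : 0 < η₁ := by positivity
  have hη₁' : 4 * η₁ * C ^ 2 ≤ η / 2 := by
    rw [hη₁, mul_div_assoc', div_mul_eq_mul_div, div_le_div_iff₀ (by positivity) (by norm_num)]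
    linarith [mul_nonneg hη.le (sq_nonneg C)]
  obtain ⟨K₁, hK₁, hfar⟩ := expansionRemainder_far (R := R) (C := C) (e := e) hR he0 h1
  obtain ⟨B, hB⟩ : ∃ B, B = ε' + 2 * (C * ε) := ⟨_, rfl⟩
  have hB0 : 0 < B := by rw [hB]; positivity
  have n1 : 0 ≤ 48 + 12 * C ^ 2 := by positivity
  have n2 : 0 ≤ 6 + 2 * (1 / η₁) + 4 * C := by positivity
  have n3 : 0 ≤ B ^ 2 * K₁ := by positivity
  have n4 : 0 ≤ (B + 2 + 2 * C ^ 2 + 2 * C + 4 * (R * C)) * K₁ := by positivity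
  obtain ⟨K, hK⟩ : ∃ K, K = (48 + 12 * C ^ 2) + (6 + 2 * (1 / η₁) + 4 * C) + B ^ 2 * K₁
    + (B + 2 + 2 * C ^ 2 + 2 * C + 4 * (R * C)) * K₁ + K₁ := ⟨_, rfl⟩
  refine ⟨e, K, he0, by linarith, ?_⟩
  intro q p p' F α β hq hp hp' hF hα hβ
  have hQ0 := expansionRemainder_nonneg e q p p' F α β
  have hη0 : 0 ≤ η * (q ^ 2 * F ^ 2) := by positivity
  by_cases hor : e < F ∨ e * p < |p - q - β * q| + |p' - p - α * q|
  · obtain ⟨b1, b2, b3, b4⟩ := hfar q p p' F α β hq hp hp' hF hα hβ hor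
    obtain ⟨f1, f2⟩ := truncatedIncrement_far hR hC hε' hB hε hq hF hα hβ b1 b2 b3 b4
    rw [← mul_assoc (B ^ 2)] at f1
    rw [← mul_assoc (B + 2 + 2 * C ^ 2 + 2 * C + 4 * (R * C))] at f2
    refine ⟨?_, ?_, fun _ => b2.trans (mul_le_mul_of_nonneg_right (by linarith) hQ0)⟩
    · exact (f1.trans (mul_le_mul_of_nonneg_right (by linarith) hQ0)).trans
        (le_add_of_nonneg_right hη0)
    · exact (f2.trans (mul_le_mul_of_nonneg_right (by linarith) hQ0)).trans
        (le_add_of_nonneg_right hη0)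
  · push Not at hor
    obtain ⟨m1, m2, m3⟩ := truncatedIncrement_near (ε := ε) (ε' := ε') (η := η) (η₁ := η₁) (e := e)
      (L := L) (K := K) hR hC he0 hη₁0 hL h1 (by linarith) h3 (by linarith) (by linarith)
      (by linarith) (by linarith) (by linarith) (by linarith) hq hp hα hβ hor.1 hor.2
    exact ⟨m1, m2, fun h => absurd m3 (not_le.2 h)⟩

/-! ### Root densities, square integrability and centring of the score -/

namespace Experiment

variable {S : Type*} [MeasurableSpace S] {d : ℕ} (𝓔 : Experiment S d)

/-- The root density `f(x, θ)^{1/2}`. -/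
def root (θ : EuclideanSpace ℝ (Fin d)) (x : S) : ℝ := √(𝓔.f x θ)

/-- The remainder in the mean-square expansion of the root density at `θ₀`. -/
def rootRem (θ₀ : EuclideanSpace ℝ (Fin d)) (φ : S → EuclideanSpace ℝ (Fin d))
    (τ : EuclideanSpace ℝ (Fin d)) (x : S) : ℝ :=
  𝓔.root (θ₀ + τ) x - 𝓔.root θ₀ x - inner ℝ τ (φ x) * 𝓔.root θ₀ x

variable {𝓔}

theorem root_pos {θ : EuclideanSpace ℝ (Fin d)} (hθ : θ ∈ 𝓔.Θ) (x : S) : 0 < 𝓔.root θ x :=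
  Real.sqrt_pos.2 (𝓔.pos_f θ hθ x)

theorem root_sq {θ : EuclideanSpace ℝ (Fin d)} (hθ : θ ∈ 𝓔.Θ) (x : S) :
    𝓔.root θ x ^ 2 = 𝓔.f x θ :=
  Real.sq_sqrt (𝓔.pos_f θ hθ x).le

theorem measurable_root {θ : EuclideanSpace ℝ (Fin d)} (hθ : θ ∈ 𝓔.Θ) : Measurable (𝓔.root θ) :=
  (𝓔.measurable_f θ hθ).sqrt

theorem integrable_root_sq {θ : EuclideanSpace ℝ (Fin d)} (hθ : θ ∈ 𝓔.Θ) :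
    Integrable (fun x => 𝓔.root θ x ^ 2) 𝓔.ν := by
  simp_rw [root_sq hθ]
  refine ⟨(𝓔.measurable_f θ hθ).aestronglyMeasurable, ?_⟩
  rw [hasFiniteIntegral_iff_ofReal (Eventually.of_forall fun x => (𝓔.pos_f θ hθ x).le),
    𝓔.lintegral_f θ hθ]
  exact ENNReal.one_lt_top

theorem integral_root_sq {θ : EuclideanSpace ℝ (Fin d)} (hθ : θ ∈ 𝓔.Θ) :
    ∫ x, 𝓔.root θ x ^ 2 ∂𝓔.ν = 1 := by
  simp_rw [root_sq hθ]
  rw [integral_eq_lintegral_of_nonneg_ae (Eventually.of_forall fun x => (𝓔.pos_f θ hθ x).le)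
    (𝓔.measurable_f θ hθ).aestronglyMeasurable, 𝓔.lintegral_f θ hθ, ENNReal.toReal_one]

theorem lintegral_P {θ : EuclideanSpace ℝ (Fin d)} (hθ : θ ∈ 𝓔.Θ) (F : S → ℝ≥0∞) :
    ∫⁻ x, F x ∂(𝓔.P θ) = ∫⁻ x, ENNReal.ofReal (𝓔.f x θ) * F x ∂𝓔.ν := by
  rw [P, lintegral_withDensity_eq_lintegral_mul_non_measurable _
    (𝓔.measurable_f θ hθ).ennreal_ofReal (Eventually.of_forall fun _ => ENNReal.ofReal_lt_top)]
  rfl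

theorem integral_P {θ : EuclideanSpace ℝ (Fin d)} (hθ : θ ∈ 𝓔.Θ) (F : S → ℝ) :
    ∫ x, F x ∂(𝓔.P θ) = ∫ x, 𝓔.root θ x ^ 2 * F x ∂𝓔.ν := by
  rw [P, integral_withDensity_eq_integral_toReal_smul (𝓔.measurable_f θ hθ).ennreal_ofReal
    (Eventually.of_forall fun _ => ENNReal.ofReal_lt_top)]
  refine integral_congr_ae (Eventually.of_forall fun x => ?_)
  simp only [smul_eq_mul]
  rw [ENNReal.toReal_ofReal (𝓔.pos_f θ hθ x).le, root_sq hθ]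

theorem integrable_P_iff {θ : EuclideanSpace ℝ (Fin d)} (hθ : θ ∈ 𝓔.Θ) {F : S → ℝ} :
    Integrable F (𝓔.P θ) ↔ Integrable (fun x => 𝓔.root θ x ^ 2 * F x) 𝓔.ν := by
  rw [P, integrable_withDensity_iff_integrable_smul' (𝓔.measurable_f θ hθ).ennreal_ofReal
    (Eventually.of_forall fun _ => ENNReal.ofReal_lt_top)]
  refine integrable_congr (Eventually.of_forall fun x => ?_)
  simp only [smul_eq_mul]
  rw [ENNReal.toReal_ofReal (𝓔.pos_f θ hθ x).le, root_sq hθ]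

theorem xi_eq {θ₀ h v : EuclideanSpace ℝ (Fin d)} (hh : θ₀ + h ∈ 𝓔.Θ) (hv : θ₀ + h + v ∈ 𝓔.Θ)
    (x : S) : 𝓔.xi θ₀ h v x = 2 * Real.log (𝓔.root (θ₀ + h + v) x / 𝓔.root (θ₀ + h) x) := by
  rw [xi, ratio, ← root_sq hh, ← root_sq hv, ← div_pow, Real.log_pow]
  norm_num

section Fisher

variable {θ₀ : EuclideanSpace ℝ (Fin d)} {φ : S → EuclideanSpace ℝ (Fin d)} {ω : ℝ → ℝ}

theorem measurable_rootRem (hF : 𝓔.FiniteFisher θ₀ φ ω) (hθ₀ : θ₀ ∈ 𝓔.Θ)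
    {τ : EuclideanSpace ℝ (Fin d)} (hτ : θ₀ + τ ∈ 𝓔.Θ) : Measurable (𝓔.rootRem θ₀ φ τ) := by
  have := hF.measurable_φ
  exact ((measurable_root hτ).sub (measurable_root hθ₀)).sub
    ((measurable_const.inner this).mul (measurable_root hθ₀))

theorem rootRem_zero (x : S) : 𝓔.rootRem θ₀ φ 0 x = 0 := by simp [rootRem]

theorem lintegral_rootRem_sq_le (hF : 𝓔.FiniteFisher θ₀ φ ω) (hθ₀ : θ₀ ∈ 𝓔.Θ)
    {τ : EuclideanSpace ℝ (Fin d)} (hτ0 : τ ≠ 0) (hτ : θ₀ + τ ∈ 𝓔.Θ) :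
    ∫⁻ x, ENNReal.ofReal (𝓔.rootRem θ₀ φ τ x ^ 2) ∂𝓔.ν ≤ ENNReal.ofReal (‖τ‖ ^ 2 * ω ‖τ‖) := by
  refine le_trans (le_of_eq ?_) (hF.bound τ hτ0 hτ).le
  rw [lintegral_P hθ₀]
  refine lintegral_congr fun x => ?_
  rw [← ENNReal.ofReal_mul (𝓔.pos_f θ₀ hθ₀ x).le, ← root_sq hθ₀, ← mul_pow]
  congr 2
  have h0 := root_pos hθ₀ x
  rw [rootRem, g, ratio, Real.sqrt_div (𝓔.pos_f _ hτ x).le]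
  change _ = 𝓔.root θ₀ x * (𝓔.root (θ₀ + τ) x / 𝓔.root θ₀ x - 1 - _)
  field_simp

theorem integrable_rootRem_sq (hF : 𝓔.FiniteFisher θ₀ φ ω) (hθ₀ : θ₀ ∈ 𝓔.Θ)
    {τ : EuclideanSpace ℝ (Fin d)} (hτ : θ₀ + τ ∈ 𝓔.Θ) :
    Integrable (fun x => 𝓔.rootRem θ₀ φ τ x ^ 2) 𝓔.ν := by
  rcases eq_or_ne τ 0 with rfl | h0
  · simp [rootRem_zero]
  refine ⟨((measurable_rootRem hF hθ₀ hτ).pow_const 2).aestronglyMeasurable, ?_⟩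
  rw [hasFiniteIntegral_iff_ofReal (Eventually.of_forall fun x => sq_nonneg _)]
  exact (lintegral_rootRem_sq_le hF hθ₀ h0 hτ).trans_lt ENNReal.ofReal_lt_top

/-- Monotonicity of `ω` makes the bound uniform over a ball; the positive part also covers `τ = 0`,
for which the Fisher condition says nothing. -/
theorem integral_rootRem_sq_le (hF : 𝓔.FiniteFisher θ₀ φ ω) (hθ₀ : θ₀ ∈ 𝓔.Θ)
    {τ : EuclideanSpace ℝ (Fin d)} (hτ : θ₀ + τ ∈ 𝓔.Θ) {s : ℝ} (hs : 0 < s) (hτs : ‖τ‖ ≤ s) :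
    ∫ x, 𝓔.rootRem θ₀ φ τ x ^ 2 ∂𝓔.ν ≤ s ^ 2 * max (ω s) 0 := by
  rcases eq_or_ne τ 0 with rfl | h0
  · simp only [rootRem_zero]
    simp only [ne_eq, OfNat.ofNat_ne_zero, not_false_eq_true, zero_pow, integral_zero]
    positivity
  rw [integral_eq_lintegral_of_nonneg_ae (Eventually.of_forall fun x => sq_nonneg _)
    ((measurable_rootRem hF hθ₀ hτ).pow_const 2).aestronglyMeasurable]
  refine ENNReal.toReal_le_of_le_ofReal (by positivity)
    ((lintegral_rootRem_sq_le hF hθ₀ h0 hτ).trans (ENNReal.ofReal_le_ofReal ?_))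
  have h1 : ω ‖τ‖ ≤ max (ω s) 0 :=
    (hF.monotone_ω (norm_pos_iff.2 h0) hs hτs).trans (le_max_left _ _)
  calc ‖τ‖ ^ 2 * ω ‖τ‖ ≤ ‖τ‖ ^ 2 * max (ω s) 0 := by gcongr
    _ ≤ _ := by gcongr

theorem memLp_root {θ : EuclideanSpace ℝ (Fin d)} (hθ : θ ∈ 𝓔.Θ) : MemLp (𝓔.root θ) 2 𝓔.ν :=
  (memLp_two_iff_integrable_sq (measurable_root hθ).aestronglyMeasurable).2 (integrable_root_sq hθ)

theorem memLp_rootRem (hF : 𝓔.FiniteFisher θ₀ φ ω) (hθ₀ : θ₀ ∈ 𝓔.Θ)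
    {τ : EuclideanSpace ℝ (Fin d)} (hτ : θ₀ + τ ∈ 𝓔.Θ) : MemLp (𝓔.rootRem θ₀ φ τ) 2 𝓔.ν :=
  (memLp_two_iff_integrable_sq (measurable_rootRem hF hθ₀ hτ).aestronglyMeasurable).2
    (integrable_rootRem_sq hF hθ₀ hτ)

/-- Small multiples of a direction stay in the parameter set. -/
theorem eventually_add_smul_mem (hθ₀ : θ₀ ∈ 𝓔.Θ) (v : EuclideanSpace ℝ (Fin d)) :
    ∀ᶠ s in 𝓝[>] (0 : ℝ), θ₀ + s • v ∈ 𝓔.Θ := by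
  have h : Tendsto (fun s : ℝ => θ₀ + s • v) (𝓝[>] 0) (𝓝 (θ₀ + (0 : ℝ) • v)) :=
    ((continuous_const.add (continuous_id.smul continuous_const)).tendsto 0).mono_left
      nhdsWithin_le_nhds
  rw [zero_smul, add_zero] at h
  exact h.eventually (𝓔.isOpen.mem_nhds hθ₀)

/-- Square integrability of the score is a consequence of the expansion: for one small `s > 0`,
`s⟨v, φ⟩` times the root at `θ₀` is a difference of roots minus the remainder, all of them in `L²`.
-/
theorem memLp_inner_mul_root (hF : 𝓔.FiniteFisher θ₀ φ ω) (hθ₀ : θ₀ ∈ 𝓔.Θ)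
    (v : EuclideanSpace ℝ (Fin d)) :
    MemLp (fun x => inner ℝ v (φ x) * 𝓔.root θ₀ x) 2 𝓔.ν := by
  obtain ⟨s, hs, hs0⟩ := ((eventually_add_smul_mem hθ₀ v).and self_mem_nhdsWithin).exists
  have hs0' : s ≠ 0 := ne_of_gt hs0
  have h := (((memLp_root hs).sub (memLp_root hθ₀)).sub (memLp_rootRem hF hθ₀ hs)).const_mul s⁻¹
  refine h.congr_norm ?_ (Eventually.of_forall fun x => ?_)
  · exact ((measurable_const.inner hF.measurable_φ).mul
      (measurable_root hθ₀)).aestronglyMeasurable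
  · simp only [Pi.sub_apply, rootRem, inner_smul_left]
    congr 1
    simp only [conj_trivial]
    field_simp
    ring

theorem integrable_inner_mul_inner (hF : 𝓔.FiniteFisher θ₀ φ ω) (hθ₀ : θ₀ ∈ 𝓔.Θ)
    (v w : EuclideanSpace ℝ (Fin d)) :
    Integrable (fun x => 𝓔.root θ₀ x ^ 2 * (inner ℝ v (φ x) * inner ℝ w (φ x))) 𝓔.ν := by
  refine ((memLp_inner_mul_root hF hθ₀ v).integrable_mul
    (memLp_inner_mul_root hF hθ₀ w)).congr (Eventually.of_forall fun x => ?_)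
  simp only [Pi.mul_apply]
  ring

theorem integrable_norm_sq (hF : 𝓔.FiniteFisher θ₀ φ ω) (hθ₀ : θ₀ ∈ 𝓔.Θ) :
    Integrable (fun x => 𝓔.root θ₀ x ^ 2 * ‖φ x‖ ^ 2) 𝓔.ν := by
  have h := integrable_finsetSum (Finset.univ : Finset (Fin d)) fun i _ =>
    integrable_inner_mul_inner hF hθ₀ (EuclideanSpace.single i 1) (EuclideanSpace.single i 1)
  refine h.congr (Eventually.of_forall fun x => ?_)
  simp only [EuclideanSpace.inner_single_left, map_one, one_mul]
  rw [← Finset.mul_sum, EuclideanSpace.norm_sq_eq]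
  congr 1
  refine Finset.sum_congr rfl fun i _ => ?_
  rw [Real.norm_eq_abs, sq_abs, sq]

theorem integrable_inner (hF : 𝓔.FiniteFisher θ₀ φ ω) (hθ₀ : θ₀ ∈ 𝓔.Θ)
    (v : EuclideanSpace ℝ (Fin d)) :
    Integrable (fun x => 𝓔.root θ₀ x ^ 2 * inner ℝ v (φ x)) 𝓔.ν := by
  refine ((memLp_root hθ₀).integrable_mul
    (memLp_inner_mul_root hF hθ₀ v)).congr (Eventually.of_forall fun x => ?_)
  simp only [Pi.mul_apply]
  ring

theorem fisherForm_eq (hF : 𝓔.FiniteFisher θ₀ φ ω) (hθ₀ : θ₀ ∈ 𝓔.Θ)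
    (v w : EuclideanSpace ℝ (Fin d)) :
    𝓔.fisherForm θ₀ φ v w
      = 4 * ∫ x, 𝓔.root θ₀ x ^ 2 * (inner ℝ v (φ x) * inner ℝ w (φ x)) ∂𝓔.ν := by
  have hij : ∀ i j : Fin d, Integrable (fun x => 𝓔.root θ₀ x ^ 2 * (φ x i * φ x j)) 𝓔.ν := by
    intro i j
    have := integrable_inner_mul_inner hF hθ₀ (EuclideanSpace.single i 1)
      (EuclideanSpace.single j 1)
    simpa only [EuclideanSpace.inner_single_left, map_one, one_mul] using this
  have hexp : ∀ x, 𝓔.root θ₀ x ^ 2 * (inner ℝ v (φ x) * inner ℝ w (φ x))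
      = ∑ i, ∑ j, v i * w j * (𝓔.root θ₀ x ^ 2 * (φ x i * φ x j)) := by
    intro x
    simp only [PiLp.inner_apply, RCLike.inner_apply, conj_trivial]
    rw [Finset.sum_mul_sum, Finset.mul_sum]
    refine Finset.sum_congr rfl fun i _ => ?_
    rw [Finset.mul_sum]
    exact Finset.sum_congr rfl fun j _ => by ring
  simp_rw [hexp]
  rw [integral_finsetSum _ fun i _ => integrable_finsetSum _ fun j _ => (hij i j).const_mul _]
  simp_rw [integral_finsetSum _ fun j _ => (hij _ j).const_mul _, integral_const_mul]
  simp only [fisherForm, fisherInfo, dotProduct, Matrix.mulVec, Matrix.of_apply,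
    integral_P hθ₀]
  rw [Finset.mul_sum]
  refine Finset.sum_congr rfl fun i _ => ?_
  rw [Finset.mul_sum, Finset.mul_sum]
  exact Finset.sum_congr rfl fun j _ => by ring

/-- The score at `θ₀` is centred. -/
theorem integral_inner_eq_zero (hF : 𝓔.FiniteFisher θ₀ φ ω) (hθ₀ : θ₀ ∈ 𝓔.Θ)
    (v : EuclideanSpace ℝ (Fin d)) :
    ∫ x, 𝓔.root θ₀ x ^ 2 * inner ℝ v (φ x) ∂𝓔.ν = 0 := by
  set A := ∫ x, 𝓔.root θ₀ x ^ 2 * inner ℝ v (φ x) ∂𝓔.ν with hA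
  set J := ∫ x, 𝓔.root θ₀ x ^ 2 * (inner ℝ v (φ x) * inner ℝ v (φ x)) ∂𝓔.ν with hJ
  have hb : ∀ κ : ℝ, 0 < κ → 2 * |A| ≤ κ := by
    intro κ hκ
    set c := ‖v‖ + 1 with hc
    have hc0 : 0 < c := by positivity
    -- Both densities have mass one, so `2sA` equals, up to sign, the integral of the second-order
    -- error along the step `s • v`. The cross term of root and remainder is split with weight `sκ`;
    -- after division by `s` it contributes `κ` plus a multiple of `ω(sc)/κ`. First `s → 0`, then `κ
    -- → 0`.
    have key : ∀ᶠ s in 𝓝[>] (0 : ℝ), 2 * |A| ≤ κ + (c ^ 2 * max (ω (s * c)) 0) * (1 / κ)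
        + 2 * s * J + 2 * s * (c ^ 2 * max (ω (s * c)) 0) := by
      filter_upwards [eventually_add_smul_mem hθ₀ v, self_mem_nhdsWithin] with s hs hs0
      have hs0 : 0 < s := hs0
      have hr := integral_rootRem_sq_le hF hθ₀ hs (s := s * c) (by positivity)
        (by rw [norm_smul, Real.norm_eq_abs, abs_of_pos hs0]; gcongr; linarith)
      have hpt : ∀ x, |(𝓔.root (θ₀ + s • v) x ^ 2 - 𝓔.root θ₀ x ^ 2)
          - 2 * s * (𝓔.root θ₀ x ^ 2 * inner ℝ v (φ x))|
          ≤ s * κ * 𝓔.root θ₀ x ^ 2 + (1 / (s * κ) + 2) * 𝓔.rootRem θ₀ φ (s • v) x ^ 2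
            + 2 * s ^ 2 * (𝓔.root θ₀ x ^ 2 * (inner ℝ v (φ x) * inner ℝ v (φ x))) := by
        intro x
        obtain ⟨r, hr⟩ : ∃ r, r = 𝓔.rootRem θ₀ φ (s • v) x := ⟨_, rfl⟩
        obtain ⟨q, hq⟩ : ∃ q, q = 𝓔.root θ₀ x := ⟨_, rfl⟩
        obtain ⟨α, hα⟩ : ∃ α : ℝ, α = inner ℝ v (φ x) := ⟨_, rfl⟩
        have hp : 𝓔.root (θ₀ + s • v) x = q + s * (q * α) + r := by
          rw [hr, hq, hα, rootRem, inner_smul_left]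
          simp only [conj_trivial]
          ring
        rw [hp, ← hr, ← hq, ← hα]
        have e1 : (q + s * (q * α) + r) ^ 2 - q ^ 2 - 2 * s * (q ^ 2 * α)
            = 2 * (q * r) + (s * (q * α) + r) ^ 2 := by ring
        rw [e1]
        have h1 : |2 * (q * r)| ≤ s * κ * q ^ 2 + 1 / (s * κ) * r ^ 2 := by
          have h2 : 0 ≤ (1 / (s * κ)) * (s * κ * |q| - |r|) ^ 2 := by positivity
          have h3 : (1 / (s * κ)) * (s * κ * |q| - |r|) ^ 2
              = s * κ * |q| ^ 2 - 2 * (|q| * |r|) + 1 / (s * κ) * |r| ^ 2 := by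
            field_simp; ring
          rw [h3, sq_abs, sq_abs] at h2
          rw [abs_mul, abs_mul, abs_two]
          linarith
        have h4 : |(s * (q * α) + r) ^ 2| ≤ 2 * ((s * (q * α)) ^ 2 + r ^ 2) := by
          rw [abs_of_nonneg (sq_nonneg _)]
          exact add_sq_le
        have h5 := abs_add_le (2 * (q * r)) ((s * (q * α) + r) ^ 2)
        have h6 : 2 * s ^ 2 * (q ^ 2 * (α * α)) = 2 * (s * (q * α)) ^ 2 := by ring
        rw [h6]
        linarith
      have i1 := (integrable_root_sq hs).sub (integrable_root_sq hθ₀)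
      have i2 := (integrable_inner hF hθ₀ v).const_mul (2 * s)
      have i3 := (integrable_root_sq hθ₀).const_mul (s * κ)
      have i4 := (integrable_rootRem_sq hF hθ₀ hs).const_mul (1 / (s * κ) + 2)
      have i5 := (integrable_inner_mul_inner hF hθ₀ v v).const_mul (2 * s ^ 2)
      have hI := norm_integral_le_of_norm_le
        (f := fun x => (𝓔.root (θ₀ + s • v) x ^ 2 - 𝓔.root θ₀ x ^ 2)
          - 2 * s * (𝓔.root θ₀ x ^ 2 * inner ℝ v (φ x)))
        ((i3.add i4).add i5) (Eventually.of_forall fun x => hpt x)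
      have l1 : ∫ x, ((𝓔.root (θ₀ + s • v) x ^ 2 - 𝓔.root θ₀ x ^ 2)
          - 2 * s * (𝓔.root θ₀ x ^ 2 * inner ℝ v (φ x))) ∂𝓔.ν = -(2 * s * A) := by
        have := integral_sub i1 i2
        simp only [Pi.sub_apply] at this
        rw [this, integral_sub (integrable_root_sq hs) (integrable_root_sq hθ₀),
          integral_root_sq hs, integral_root_sq hθ₀, integral_const_mul, ← hA]
        ring
      have l2 : ∫ x, (s * κ * 𝓔.root θ₀ x ^ 2 + (1 / (s * κ) + 2) * 𝓔.rootRem θ₀ φ (s • v) x ^ 2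
            + 2 * s ^ 2 * (𝓔.root θ₀ x ^ 2 * (inner ℝ v (φ x) * inner ℝ v (φ x)))) ∂𝓔.ν
          = s * κ + (1 / (s * κ) + 2) * (∫ x, 𝓔.rootRem θ₀ φ (s • v) x ^ 2 ∂𝓔.ν)
            + 2 * s ^ 2 * J := by
        have h1 := integral_add (i3.add i4) i5
        have h2 := integral_add i3 i4
        simp only [Pi.add_apply] at h1 h2
        rw [h1, h2, integral_const_mul, integral_const_mul, integral_const_mul,
          integral_root_sq hθ₀, mul_one]
      have hI' : |-(2 * s * A)| ≤ s * κ + (1 / (s * κ) + 2)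
          * (∫ x, 𝓔.rootRem θ₀ φ (s • v) x ^ 2 ∂𝓔.ν) + 2 * s ^ 2 * J := by
        rw [← l1, ← l2]; exact hI
      rw [abs_neg, abs_mul, abs_of_pos (by positivity : 0 < 2 * s)] at hI'
      have h7 : (1 / (s * κ) + 2) * (∫ x, 𝓔.rootRem θ₀ φ (s • v) x ^ 2 ∂𝓔.ν)
          ≤ (1 / (s * κ) + 2) * ((s * c) ^ 2 * max (ω (s * c)) 0) := by gcongr
      have h8 : s * (2 * |A|) ≤ s * (κ + (c ^ 2 * max (ω (s * c)) 0) * (1 / κ)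
        + 2 * s * J + 2 * s * (c ^ 2 * max (ω (s * c)) 0)) := by
        calc s * (2 * |A|) ≤ s * κ + (1 / (s * κ) + 2) * ((s * c) ^ 2 * max (ω (s * c)) 0)
              + 2 * s ^ 2 * J := by linarith
          _ = _ := by field_simp; ring
      exact le_of_mul_le_mul_left h8 hs0
    have hω : Tendsto (fun s : ℝ => max (ω (s * c)) 0) (𝓝[>] 0) (𝓝 0) := by
      have h1 : Tendsto (fun s : ℝ => s * c) (𝓝[>] 0) (𝓝[>] 0) := by
        refine tendsto_nhdsWithin_iff.2 ⟨?_, ?_⟩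
        · have : Tendsto (fun s : ℝ => s * c) (𝓝[>] 0) (𝓝 (0 * c)) :=
            ((continuous_id.mul continuous_const).tendsto 0).mono_left nhdsWithin_le_nhds
          rwa [zero_mul] at this
        · filter_upwards [self_mem_nhdsWithin] with s hs
          exact mul_pos hs hc0
      have := (hF.tendsto_ω.comp h1).max (tendsto_const_nhds (x := (0 : ℝ)))
      simpa using this
    have hs : Tendsto (fun s : ℝ => s) (𝓝[>] 0) (𝓝 0) := tendsto_id.mono_left nhdsWithin_le_nhds
    have hlim : Tendsto (fun s : ℝ => κ + (c ^ 2 * max (ω (s * c)) 0) * (1 / κ)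
        + 2 * s * J + 2 * s * (c ^ 2 * max (ω (s * c)) 0)) (𝓝[>] 0)
        (𝓝 (κ + (c ^ 2 * 0) * (1 / κ) + 2 * 0 * J + 2 * 0 * (c ^ 2 * 0))) :=
      ((tendsto_const_nhds.add ((hω.const_mul _).mul_const _)).add
        ((hs.const_mul 2).mul_const J)).add ((hs.const_mul 2).mul (hω.const_mul _))
    simp only [mul_zero, zero_mul, add_zero] at hlim
    exact ge_of_tendsto hlim key
  have h0 : |A| ≤ 0 := by
    refine le_of_forall_pos_le_add fun κ hκ => ?_
    have := hb κ hκ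
    have := abs_nonneg A
    linarith
  exact abs_nonpos_iff.1 h0

end Fisher

end Experiment
-- Integrated expansion: mean, second moment and probability of large increments
namespace Experiment

variable {S : Type*} [MeasurableSpace S] {d : ℕ} (𝓔 : Experiment S d)

/-- The remainder functional of `exists_expansion_bound` along the experiment. -/
def remFun (θ₀ : EuclideanSpace ℝ (Fin d)) (φ : S → EuclideanSpace ℝ (Fin d)) (e t : ℝ)
    (h v : EuclideanSpace ℝ (Fin d)) (x : S) : ℝ :=
  expansionRemainder e (𝓔.root θ₀ x) (𝓔.root (θ₀ + h) x) (𝓔.root (θ₀ + h + v) x) (t * ‖φ x‖)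
    (inner ℝ v (φ x)) (inner ℝ h (φ x))

/-- The truncated centred increment of the log-likelihood along the experiment. -/
def incr (θ₀ : EuclideanSpace ℝ (Fin d)) (φ : S → EuclideanSpace ℝ (Fin d)) (ε ε' t : ℝ)
    (h v : EuclideanSpace ℝ (Fin d)) (x : S) : ℝ :=
  truncatedIncrement ε ε' (𝓔.root (θ₀ + h) x) (𝓔.root (θ₀ + h + v) x) (t * ‖φ x‖)
    (inner ℝ v (φ x))

/-- The truncated second moment of `φ` under `P_{θ₀}`. -/
def tailMoment (θ₀ : EuclideanSpace ℝ (Fin d)) (φ : S → EuclideanSpace ℝ (Fin d)) (e t : ℝ) : ℝ :=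
  ∫ x, (if e < t * ‖φ x‖ then 𝓔.root θ₀ x ^ 2 * ‖φ x‖ ^ 2 else 0) ∂𝓔.ν

variable {𝓔} {θ₀ : EuclideanSpace ℝ (Fin d)} {φ : S → EuclideanSpace ℝ (Fin d)} {ω : ℝ → ℝ}

theorem measurableSet_lt_mul_norm (hF : 𝓔.FiniteFisher θ₀ φ ω) (e t : ℝ) :
    MeasurableSet {x | e < t * ‖φ x‖} :=
  measurableSet_lt measurable_const (measurable_const.mul hF.measurable_φ.norm)

theorem integrable_tail (hF : 𝓔.FiniteFisher θ₀ φ ω) (hθ₀ : θ₀ ∈ 𝓔.Θ) (e t : ℝ) :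
    Integrable (fun x => if e < t * ‖φ x‖ then 𝓔.root θ₀ x ^ 2 * ‖φ x‖ ^ 2 else 0) 𝓔.ν :=
  (integrable_norm_sq hF hθ₀).indicator (measurableSet_lt_mul_norm hF e t)

theorem tendsto_tailMoment (hF : 𝓔.FiniteFisher θ₀ φ ω) (hθ₀ : θ₀ ∈ 𝓔.Θ) {e : ℝ} (he : 0 < e) :
    Tendsto (𝓔.tailMoment θ₀ φ e) (𝓝[>] 0) (𝓝 0) := by
  have h : Tendsto (𝓔.tailMoment θ₀ φ e) (𝓝[>] 0) (𝓝 (∫ _, (0 : ℝ) ∂𝓔.ν)) := by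
    refine tendsto_integral_filter_of_dominated_convergence _
      (Eventually.of_forall fun t => (integrable_tail hF hθ₀ e t).aestronglyMeasurable)
      (Eventually.of_forall fun t => Eventually.of_forall fun x => ?_)
      (integrable_norm_sq hF hθ₀) (Eventually.of_forall fun x => ?_)
    · have h0 : 0 ≤ 𝓔.root θ₀ x ^ 2 * ‖φ x‖ ^ 2 := by positivity
      split_ifs
      · rw [Real.norm_eq_abs, abs_of_nonneg h0]
      · simpa using h0
    · refine tendsto_const_nhds.congr' ?_
      have h1 : Tendsto (fun t : ℝ => t * ‖φ x‖) (𝓝[>] 0) (𝓝 (0 * ‖φ x‖)) :=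
        ((continuous_id.mul continuous_const).tendsto 0).mono_left nhdsWithin_le_nhds
      rw [zero_mul] at h1
      filter_upwards [h1.eventually (gt_mem_nhds he)] with t ht
      rw [if_neg (not_lt.2 ht.le)]
  simpa using h

/-- The truncation levels of C1 and of the expansion differ only by a scale: with `s = δt/e` the
event `δ/s < |φ|` is `e < t|φ|`. -/
theorem tailMoment_le_of_condC1 (hF : 𝓔.FiniteFisher θ₀ φ ω) (hθ₀ : θ₀ ∈ 𝓔.Θ)
    (hC : 𝓔.CondC1 θ₀ φ ω) {e : ℝ} (he : 0 < e) :
    ∃ K γ : ℝ, 0 < K ∧ 0 < γ ∧ ∀ᶠ t in 𝓝[>] (0 : ℝ), 𝓔.tailMoment θ₀ φ e t ≤ K * t ^ γ := by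
  obtain ⟨C, lam, γ, δ, u₀, hC0, -, hγ, hδ, hu₀, -, U, hU, -, hb⟩ := hC
  refine ⟨C * (δ / e) ^ γ, γ, by positivity, hγ, ?_⟩
  have hmem : Set.Ioo (0 : ℝ) (u₀ * e / δ) ∈ 𝓝[>] (0 : ℝ) := Ioo_mem_nhdsGT (by positivity)
  filter_upwards [hmem] with t ht
  have ht0 : 0 < t := ht.1
  have hs0 : 0 < δ * t / e := by positivity
  have hs1 : δ * t / e < u₀ := by
    have := ht.2
    rw [lt_div_iff₀ hδ] at this
    rw [div_lt_iff₀ he]; linarith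
  have hlt := hb θ₀ (mem_of_mem_nhds hU) _ hs0 hs1
  have hrw : C * (δ * t / e) ^ γ = C * (δ / e) ^ γ * t ^ γ := by
    rw [mul_assoc, ← Real.mul_rpow (by positivity) ht0.le]
    congr 2; ring
  rw [← hrw, tailMoment, integral_eq_lintegral_of_nonneg_ae
    (Eventually.of_forall fun x => by dsimp only [Pi.zero_apply]; split_ifs <;> positivity)
    (integrable_tail hF hθ₀ e t).aestronglyMeasurable]
  refine ENNReal.toReal_le_of_le_ofReal (by positivity) (le_trans (le_of_eq ?_) hlt.le)
  rw [lintegral_P hθ₀]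
  refine lintegral_congr fun x => ?_
  rw [← ENNReal.ofReal_mul (𝓔.pos_f θ₀ hθ₀ x).le, ← root_sq hθ₀]
  congr 1
  have hiff : (δ * (δ * t / e)⁻¹ < ‖φ x‖) ↔ e < t * ‖φ x‖ := by
    have : δ * (δ * t / e)⁻¹ = e / t := by field_simp
    rw [this, div_lt_iff₀ ht0, mul_comm]
  by_cases hx : e < t * ‖φ x‖
  · have hx' : x ∈ {x | δ * (δ * t / e)⁻¹ < ‖φ x‖} := hiff.2 hx
    rw [if_pos hx, Set.indicator_of_mem hx']
  · have hx' : x ∉ {x | δ * (δ * t / e)⁻¹ < ‖φ x‖} := fun h => hx (hiff.1 h)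
    rw [if_neg hx, Set.indicator_of_notMem hx', mul_zero]

/-- The increment error `p' - p - αq` is the difference of the root remainders at `h + v` and at
`h`, so only remainders based at `θ₀` need to be controlled. -/
theorem remFun_eq (e t : ℝ) (h v : EuclideanSpace ℝ (Fin d)) (x : S) :
    𝓔.remFun θ₀ φ e t h v x
      = t ^ 2 * (if e < t * ‖φ x‖ then 𝓔.root θ₀ x ^ 2 * ‖φ x‖ ^ 2 else 0)
        + (𝓔.rootRem θ₀ φ (h + v) x - 𝓔.rootRem θ₀ φ h x) ^ 2 + 𝓔.rootRem θ₀ φ h x ^ 2 := by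
  rw [remFun, expansionRemainder, rootRem, rootRem, ← add_assoc, inner_add_left]
  congr 2
  · split_ifs <;> ring
  · congr 1; ring

theorem integrable_remFun (hF : 𝓔.FiniteFisher θ₀ φ ω) (hθ₀ : θ₀ ∈ 𝓔.Θ) (e t : ℝ)
    {h v : EuclideanSpace ℝ (Fin d)} (hh : θ₀ + h ∈ 𝓔.Θ) (hv : θ₀ + h + v ∈ 𝓔.Θ) :
    Integrable (𝓔.remFun θ₀ φ e t h v) 𝓔.ν := by
  have hv' : θ₀ + (h + v) ∈ 𝓔.Θ := by rwa [← add_assoc]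
  have := (((integrable_tail hF hθ₀ e t).const_mul (t ^ 2)).add
    ((memLp_rootRem hF hθ₀ hv').sub (memLp_rootRem hF hθ₀ hh)).integrable_sq).add
    (integrable_rootRem_sq hF hθ₀ hh)
  exact this.congr (Eventually.of_forall fun x => (remFun_eq e t h v x).symm)

theorem integral_remFun_le (hF : 𝓔.FiniteFisher θ₀ φ ω) (hθ₀ : θ₀ ∈ 𝓔.Θ) (e : ℝ) {t R C : ℝ}
    (ht : 0 < t) (hR : 0 ≤ R) (hC : 0 ≤ C)
    {h v : EuclideanSpace ℝ (Fin d)} (hhR : ‖h‖ ≤ R * t) (hvC : ‖v‖ ≤ C * t)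
    (hh : θ₀ + h ∈ 𝓔.Θ) (hv : θ₀ + h + v ∈ 𝓔.Θ) :
    ∫ x, 𝓔.remFun θ₀ φ e t h v x ∂𝓔.ν ≤ t ^ 2 * (𝓔.tailMoment θ₀ φ e t
      + 5 * (R + C + 1) ^ 2 * max (ω ((R + C + 1) * t)) 0) := by
  have hv' : θ₀ + (h + v) ∈ 𝓔.Θ := by rwa [← add_assoc]
  have hL : 0 < (R + C + 1) * t := by positivity
  have b1 := integral_rootRem_sq_le hF hθ₀ hh hL (by nlinarith)
  have b2 := integral_rootRem_sq_le hF hθ₀ hv' hL ((norm_add_le _ _).trans (by nlinarith))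
  have hle : ∫ x, 𝓔.remFun θ₀ φ e t h v x ∂𝓔.ν ≤ ∫ x, (t ^ 2 * (if e < t * ‖φ x‖ then
      𝓔.root θ₀ x ^ 2 * ‖φ x‖ ^ 2 else 0) + (2 * 𝓔.rootRem θ₀ φ (h + v) x ^ 2
        + 3 * 𝓔.rootRem θ₀ φ h x ^ 2)) ∂𝓔.ν := by
    refine integral_mono (integrable_remFun hF hθ₀ e t hh hv)
      (((integrable_tail hF hθ₀ e t).const_mul (t ^ 2)).add
        (((integrable_rootRem_sq hF hθ₀ hv').const_mul 2).add
        ((integrable_rootRem_sq hF hθ₀ hh).const_mul 3))) fun x => ?_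
    dsimp only
    rw [remFun_eq]
    nlinarith [sq_nonneg (𝓔.rootRem θ₀ φ (h + v) x + 𝓔.rootRem θ₀ φ h x)]
  refine hle.trans ?_
  have e1 := integral_add ((integrable_tail hF hθ₀ e t).const_mul (t ^ 2))
    (((integrable_rootRem_sq hF hθ₀ hv').const_mul 2).add
        ((integrable_rootRem_sq hF hθ₀ hh).const_mul 3))
  have e2 := integral_add ((integrable_rootRem_sq hF hθ₀ hv').const_mul 2)
        ((integrable_rootRem_sq hF hθ₀ hh).const_mul 3)
  simp only [Pi.add_apply] at e1 e2
  rw [e1, e2, integral_const_mul, integral_const_mul, integral_const_mul]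
  rw [mul_pow] at b1 b2
  rw [tailMoment]
  linarith

theorem tendsto_const_mul_nhdsGT {c : ℝ} (hc : 0 < c) :
    Tendsto (fun s : ℝ => c * s) (𝓝[>] 0) (𝓝[>] 0) := by
  refine tendsto_nhdsWithin_iff.2 ⟨?_, ?_⟩
  · have : Tendsto (fun s : ℝ => c * s) (𝓝[>] 0) (𝓝 (c * 0)) :=
      ((continuous_const.mul continuous_id).tendsto 0).mono_left nhdsWithin_le_nhds
    rwa [mul_zero] at this
  · filter_upwards [self_mem_nhdsWithin] with s hs
    exact mul_pos hc hs

theorem eventually_const_mul_rpow_le (K : ℝ) {a b c : ℝ} (hab : b < a) (hc : 0 < c) :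
    ∀ᶠ t in 𝓝[>] (0 : ℝ), K * t ^ a ≤ c * t ^ b := by
  have h1 : Tendsto (fun t : ℝ => K * t ^ (a - b)) (𝓝[>] 0) (𝓝 (K * 0 ^ (a - b))) :=
    ((Real.continuousAt_rpow_const 0 (a - b) (Or.inr (by linarith))).tendsto.const_mul K).mono_left
      nhdsWithin_le_nhds
  rw [Real.zero_rpow (by linarith), mul_zero] at h1
  filter_upwards [h1.eventually (gt_mem_nhds hc), self_mem_nhdsWithin] with t ht ht0
  have ht0 : 0 < t := ht0
  have : t ^ a = t ^ (a - b) * t ^ b := by rw [← Real.rpow_add ht0]; ring_nf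
  rw [this, ← mul_assoc]
  gcongr

/-- The rate is the tail moment of `φ` plus a multiple of `ω` at a comparable scale. It tends to
zero in any case; under C1 both summands are powers of `t`. -/
theorem exists_remFun_rate (hF : 𝓔.FiniteFisher θ₀ φ ω) (hθ₀ : θ₀ ∈ 𝓔.Θ) {R C e : ℝ}
    (hR : 0 ≤ R) (hC : 0 ≤ C) (he : 0 < e) :
    ∃ Ψ : ℝ → ℝ, Tendsto Ψ (𝓝[>] 0) (𝓝 0) ∧
      (𝓔.CondC1 θ₀ φ ω → ∃ κ : ℝ, 0 < κ ∧ ∀ᶠ t in 𝓝[>] (0 : ℝ), Ψ t ≤ t ^ κ) ∧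
      ∀ t, 0 < t → ∀ h v : EuclideanSpace ℝ (Fin d), ‖h‖ ≤ R * t → ‖v‖ ≤ C * t →
        θ₀ + h ∈ 𝓔.Θ → θ₀ + h + v ∈ 𝓔.Θ →
        ∫ x, 𝓔.remFun θ₀ φ e t h v x ∂𝓔.ν ≤ t ^ 2 * Ψ t := by
  have hL : 0 < R + C + 1 := by positivity
  refine ⟨fun t => 𝓔.tailMoment θ₀ φ e t
      + 5 * (R + C + 1) ^ 2 * max (ω ((R + C + 1) * t)) 0, ?_, ?_, ?_⟩
  · have hω : Tendsto (fun s : ℝ => max (ω ((R + C + 1) * s)) 0) (𝓝[>] 0) (𝓝 0) := by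
      simpa using (hF.tendsto_ω.comp (tendsto_const_mul_nhdsGT hL)).max
        (tendsto_const_nhds (x := (0 : ℝ)))
    simpa using (tendsto_tailMoment hF hθ₀ he).add (hω.const_mul (5 * (R + C + 1) ^ 2))
  · intro hC1
    obtain ⟨K, γ, hK, hγ, htail⟩ := tailMoment_le_of_condC1 hF hθ₀ hC1 he
    obtain ⟨D, lam, -, -, u₀, hD, hlam, -, -, hu₀, hω, -⟩ := hC1
    have hmem : Set.Ioo (0 : ℝ) u₀ ∈ 𝓝[>] (0 : ℝ) := Ioo_mem_nhdsGT hu₀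
    have hκ : 0 < min γ lam / 2 := by positivity
    -- Halving the exponent absorbs the multiplicative constants for small `t`.
    refine ⟨min γ lam / 2, hκ, ?_⟩
    have g1 : min γ lam / 2 < γ := by have := min_le_left γ lam; linarith
    have g2 : min γ lam / 2 < lam := by have := min_le_right γ lam; linarith
    filter_upwards [htail, (tendsto_const_mul_nhdsGT hL).eventually hmem,
      eventually_const_mul_rpow_le K g1 (c := 1 / 2) (by norm_num),
      eventually_const_mul_rpow_le (5 * (R + C + 1) ^ 2 * (D * (R + C + 1) ^ lam)) g2 (c := 1 / 2)
        (by norm_num), self_mem_nhdsWithin]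
      with t h1 h2 h3 h4 ht
    have ht : 0 < t := ht
    have h5 : max (ω ((R + C + 1) * t)) 0 ≤ D * ((R + C + 1) * t) ^ lam :=
      max_le (hω _ h2.1 h2.2).le (by positivity)
    rw [Real.mul_rpow hL.le ht.le] at h5
    have h6 : 5 * (R + C + 1) ^ 2 * max (ω ((R + C + 1) * t)) 0
        ≤ 5 * (R + C + 1) ^ 2 * (D * ((R + C + 1) ^ lam * t ^ lam)) := by gcongr
    linarith
  · intro t ht h v hhR hvC hh hv
    exact integral_remFun_le hF hθ₀ e ht hR hC hhR hvC hh hv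

theorem measurable_incr (hF : 𝓔.FiniteFisher θ₀ φ ω) (ε ε' t : ℝ)
    {h v : EuclideanSpace ℝ (Fin d)} (hh : θ₀ + h ∈ 𝓔.Θ) (hv : θ₀ + h + v ∈ 𝓔.Θ) :
    Measurable (𝓔.incr θ₀ φ ε ε' t h v) := by
  have hl : Measurable fun x => 2 * Real.log (𝓔.root (θ₀ + h + v) x / 𝓔.root (θ₀ + h) x) :=
    ((measurable_root hv).div (measurable_root hh)).log.const_mul 2
  have hα : Measurable fun x => inner ℝ v (φ x) := measurable_const.inner hF.measurable_φ
  refine Measurable.sub (Measurable.ite (measurableSet_le hl.norm measurable_const) hl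
    measurable_const) ((Measurable.ite ?_ hα measurable_const).const_mul 2)
  exact measurableSet_lt (hF.measurable_φ.norm.const_mul t) measurable_const

theorem abs_incr_le {ε ε' t C : ℝ} (hε : 0 < ε) (hε' : 0 < ε') (hC : 0 ≤ C)
    {h v : EuclideanSpace ℝ (Fin d)} (hvC : ‖v‖ ≤ C * t) (x : S) :
    |𝓔.incr θ₀ φ ε ε' t h v x| ≤ ε' + 2 * (C * ε) := by
  rw [incr, truncatedIncrement]
  refine (abs_sub _ _).trans (add_le_add ?_ ?_)
  · split_ifs with h
    · exact h
    · simpa using hε'.le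
  · rw [abs_mul, abs_two]
    split_ifs with h
    · have h1 := abs_real_inner_le_norm v (φ x)
      have h2 : ‖v‖ * ‖φ x‖ ≤ C * t * ‖φ x‖ := by gcongr
      have h3 : C * (t * ‖φ x‖) ≤ C * ε := by gcongr
      linarith
    · rw [abs_zero, mul_zero]; positivity

/-- Second-moment and mean expansions of the truncated increment, and the probability of a large
increment, uniformly over the local neighbourhood. -/
theorem exists_incr_expansion (hF : 𝓔.FiniteFisher θ₀ φ ω) (hθ₀ : θ₀ ∈ 𝓔.Θ) {R C ε ε' κ : ℝ}
    (hR : 0 ≤ R) (hC : 0 ≤ C) (hε : 0 < ε) (hε' : 0 < ε') (hκ : 0 < κ) :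
    ∀ᶠ t in 𝓝[>] (0 : ℝ), ∀ h v : EuclideanSpace ℝ (Fin d), ‖h‖ ≤ R * t → ‖v‖ ≤ C * t →
        θ₀ + h ∈ 𝓔.Θ → θ₀ + h + v ∈ 𝓔.Θ →
        ∫ x, 𝓔.incr θ₀ φ ε ε' t h v x ^ 2 ∂(𝓔.P (θ₀ + h)) ≤ κ * t ^ 2 ∧
        |∫ x, 𝓔.incr θ₀ φ ε ε' t h v x ∂(𝓔.P (θ₀ + h)) + 1 / 2 * 𝓔.fisherForm θ₀ φ v v
          + 𝓔.fisherForm θ₀ φ h v| ≤ κ * t ^ 2 := by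
  set J := ∫ x, 𝓔.root θ₀ x ^ 2 * ‖φ x‖ ^ 2 ∂𝓔.ν with hJ
  have hJ0 : 0 ≤ J := integral_nonneg fun x => by positivity
  -- The pointwise error `η q²F²` integrates to `ηJt²`, and this `η` makes it at most `κt²/2`; the
  -- remainder takes the other half.
  obtain ⟨e, K, he, hK, hexp⟩ := exists_expansion_bound (R := R) (C := C) (ε := ε) (ε' := ε')
    (η := κ / (2 * (J + 1))) hR hC hε hε' (by positivity)
  obtain ⟨Ψ, hΨ, -, hQ⟩ := exists_remFun_rate hF hθ₀ hR hC he
  have hΨ' : ∀ᶠ t in 𝓝[>] (0 : ℝ), Ψ t < κ / (2 * K) :=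
    hΨ.eventually (gt_mem_nhds (by positivity))
  filter_upwards [hΨ', self_mem_nhdsWithin] with t htΨ ht h v hhR hvC hh hv
  have ht : 0 < t := ht
  have hpt := fun x => hexp (𝓔.root θ₀ x) (𝓔.root (θ₀ + h) x) (𝓔.root (θ₀ + h + v) x) (t * ‖φ x‖)
    (inner ℝ v (φ x)) (inner ℝ h (φ x)) (root_pos hθ₀ x) (root_pos hh x) (root_pos hv x)
    (by positivity)
    (by have := abs_real_inner_le_norm v (φ x)
        have h2 : ‖v‖ * ‖φ x‖ ≤ C * t * ‖φ x‖ := by gcongr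
        linarith)
    (by have := abs_real_inner_le_norm h (φ x)
        have h2 : ‖h‖ * ‖φ x‖ ≤ R * t * ‖φ x‖ := by gcongr
        linarith)
  set η := κ / (2 * (J + 1)) with hη
  have iQ := integrable_remFun hF hθ₀ e t hh hv
  have iB : Integrable (fun x => K * 𝓔.remFun θ₀ φ e t h v x
      + η * t ^ 2 * (𝓔.root θ₀ x ^ 2 * ‖φ x‖ ^ 2)) 𝓔.ν :=
    (iQ.const_mul K).add ((integrable_norm_sq hF hθ₀).const_mul (η * t ^ 2))
  have hbound : ∫ x, (K * 𝓔.remFun θ₀ φ e t h v x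
      + η * t ^ 2 * (𝓔.root θ₀ x ^ 2 * ‖φ x‖ ^ 2)) ∂𝓔.ν ≤ κ * t ^ 2 := by
    rw [integral_add (iQ.const_mul K) ((integrable_norm_sq hF hθ₀).const_mul (η * t ^ 2)),
      integral_const_mul, integral_const_mul, ← hJ]
    have h1 : K * ∫ x, 𝓔.remFun θ₀ φ e t h v x ∂𝓔.ν ≤ K * (t ^ 2 * (κ / (2 * K))) := by
      gcongr
      exact (hQ t ht h v hhR hvC hh hv).trans (by gcongr)
    have h2 : K * (t ^ 2 * (κ / (2 * K))) = κ / 2 * t ^ 2 := by field_simp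
    have h3 : η * J ≤ κ / 2 := by
      rw [hη, div_mul_eq_mul_div, div_le_div_iff₀ (by positivity) (by norm_num)]
      linarith
    have h4 : η * J * t ^ 2 ≤ κ / 2 * t ^ 2 := by gcongr
    linarith
  have : IsProbabilityMeasure (𝓔.P (θ₀ + h)) := 𝓔.isProbabilityMeasure_P hh
  have mI := measurable_incr (ε := ε) (ε' := ε') (t := t) hF hh hv
  have bI := fun x => abs_incr_le (𝓔 := 𝓔) (θ₀ := θ₀) (φ := φ) (h := h) hε hε' hC hvC x
  have iI : Integrable (𝓔.incr θ₀ φ ε ε' t h v) (𝓔.P (θ₀ + h)) :=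
    Integrable.of_bound mI.aestronglyMeasurable _ (Eventually.of_forall bI)
  have iI2 : Integrable (fun x => 𝓔.incr θ₀ φ ε ε' t h v x ^ 2) (𝓔.P (θ₀ + h)) := by
    refine Integrable.of_bound (mI.pow_const 2).aestronglyMeasurable
      ((ε' + 2 * (C * ε)) ^ 2) (Eventually.of_forall fun x => ?_)
    rw [Real.norm_eq_abs, abs_of_nonneg (sq_nonneg _), ← sq_abs]
    have := bI x
    gcongr
  constructor
  · rw [integral_P hh]
    refine le_trans (integral_mono ((integrable_P_iff hh).1 iI2) iB fun x => ?_) hbound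
    have := (hpt x).1
    simp only [incr, remFun]
    rw [mul_pow] at this
    linarith
  · rw [integral_P hh, fisherForm_eq hF hθ₀, fisherForm_eq hF hθ₀]
    have j1 := (integrable_P_iff hh).1 iI
    have j2 := (integrable_root_sq hv).sub (integrable_root_sq hh)
    have j3 := (integrable_inner_mul_inner hF hθ₀ v v).const_mul 2
    have j4 := (integrable_inner hF hθ₀ v).const_mul 2
    have j5 := (integrable_inner_mul_inner hF hθ₀ h v).const_mul 4
    -- On integrating, `p'² - p²` vanishes because both masses are one and `q²α` because the score
    -- is centred; the two remaining quadratic terms are the Fisher forms.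
    have key := norm_integral_le_of_norm_le (f := fun x =>
      (𝓔.root (θ₀ + h) x ^ 2 * 𝓔.incr θ₀ φ ε ε' t h v x
        - (𝓔.root (θ₀ + h + v) x ^ 2 - 𝓔.root (θ₀ + h) x ^ 2)
        + 2 * (𝓔.root θ₀ x ^ 2 * (inner ℝ v (φ x) * inner ℝ v (φ x)))
        + 2 * (𝓔.root θ₀ x ^ 2 * inner ℝ v (φ x)))
        + 4 * (𝓔.root θ₀ x ^ 2 * (inner ℝ h (φ x) * inner ℝ v (φ x)))) iB
      (Eventually.of_forall fun x => by
        have := (hpt x).2.1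
        rw [Real.norm_eq_abs]
        simp only [incr, remFun]
        refine le_trans (le_of_eq ?_) (this.trans (le_of_eq ?_))
        · congr 1; ring
        · ring)
    have e1 := integral_add (((j1.sub j2).add j3).add j4) j5
    have e2 := integral_add ((j1.sub j2).add j3) j4
    have e3 := integral_add (j1.sub j2) j3
    have e4 := integral_sub j1 j2
    have e5 := integral_sub (integrable_root_sq hv) (integrable_root_sq hh)
    simp only [Pi.add_apply, Pi.sub_apply] at e1 e2 e3 e4 e5
    rw [e1, e2, e3, e4, e5, integral_const_mul, integral_const_mul, integral_const_mul,
      integral_root_sq hv, integral_root_sq hh, integral_inner_eq_zero hF hθ₀,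
      Real.norm_eq_abs] at key
    refine le_trans (le_of_eq ?_) (key.trans hbound)
    congr 1
    ring

/-- Probability of a large log-likelihood increment. -/
theorem exists_large_increment_rate (hF : 𝓔.FiniteFisher θ₀ φ ω) (hθ₀ : θ₀ ∈ 𝓔.Θ) {R C ε' : ℝ}
    (hR : 0 ≤ R) (hC : 0 ≤ C) (hε' : 0 < ε') :
    ∃ Ψ : ℝ → ℝ, Tendsto Ψ (𝓝[>] 0) (𝓝 0) ∧
      (𝓔.CondC1 θ₀ φ ω → ∃ κ : ℝ, 0 < κ ∧ ∀ᶠ t in 𝓝[>] (0 : ℝ), Ψ t ≤ t ^ κ) ∧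
      ∀ t, 0 < t → ∀ h v : EuclideanSpace ℝ (Fin d), ‖h‖ ≤ R * t → ‖v‖ ≤ C * t →
        θ₀ + h ∈ 𝓔.Θ → θ₀ + h + v ∈ 𝓔.Θ →
        𝓔.P (θ₀ + h) {x | ε' < |𝓔.xi θ₀ h v x|} ≤ ENNReal.ofReal (t ^ 2 * Ψ t) := by
  -- Only the bound on `p²` where the increment is large is needed, and it does not involve `ε` or
  -- `η`; both are set to `1`.
  obtain ⟨e, K, he, hK, hexp⟩ := exists_expansion_bound (R := R) (C := C) (ε := 1) (ε' := ε')
    (η := 1) hR hC one_pos hε' one_pos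
  obtain ⟨Ψ, hΨ, hC1, hQ⟩ := exists_remFun_rate hF hθ₀ hR hC he
  refine ⟨fun t => K * Ψ t, by simpa using hΨ.const_mul K, fun h1 => ?_, ?_⟩
  · obtain ⟨κ, hκ, hev⟩ := hC1 h1
    refine ⟨κ / 2, by positivity, ?_⟩
    filter_upwards [hev, eventually_const_mul_rpow_le K (show κ / 2 < κ by linarith) one_pos]
      with t h2 h3
    have : K * Ψ t ≤ K * t ^ κ := by gcongr
    linarith
  · intro t ht h v hhR hvC hh hv
    have hxi : Measurable (𝓔.xi θ₀ h v) :=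
      ((𝓔.measurable_f _ hv).div (𝓔.measurable_f _ hh)).log
    have hA : MeasurableSet {x | ε' < |𝓔.xi θ₀ h v x|} :=
      measurableSet_lt measurable_const hxi.norm
    have iQ := integrable_remFun hF hθ₀ e t hh hv
    rw [P, withDensity_apply _ hA]
    calc ∫⁻ x in {x | ε' < |𝓔.xi θ₀ h v x|}, ENNReal.ofReal (𝓔.f x (θ₀ + h)) ∂𝓔.ν
        ≤ ∫⁻ x in {x | ε' < |𝓔.xi θ₀ h v x|}, ENNReal.ofReal (K * 𝓔.remFun θ₀ φ e t h v x)
          ∂𝓔.ν := by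
          refine setLIntegral_mono' hA fun x hx => ENNReal.ofReal_le_ofReal ?_
          rw [← root_sq hh]
          refine (hexp (𝓔.root θ₀ x) (𝓔.root (θ₀ + h) x) (𝓔.root (θ₀ + h + v) x) (t * ‖φ x‖)
            (inner ℝ v (φ x)) (inner ℝ h (φ x)) (root_pos hθ₀ x) (root_pos hh x) (root_pos hv x)
            (by positivity) ?_ ?_).2.2 ?_
          · have := abs_real_inner_le_norm v (φ x)
            have h2 : ‖v‖ * ‖φ x‖ ≤ C * t * ‖φ x‖ := by gcongr
            linarith
          · have := abs_real_inner_le_norm h (φ x)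
            have h2 : ‖h‖ * ‖φ x‖ ≤ R * t * ‖φ x‖ := by gcongr
            linarith
          · rw [← xi_eq hh hv]; exact hx
      _ ≤ ∫⁻ x, ENNReal.ofReal (K * 𝓔.remFun θ₀ φ e t h v x) ∂𝓔.ν := setLIntegral_le_lintegral _ _
      _ = ENNReal.ofReal (∫ x, K * 𝓔.remFun θ₀ φ e t h v x ∂𝓔.ν) := by
          rw [ofReal_integral_eq_lintegral_ofReal (iQ.const_mul K)
            (Eventually.of_forall fun x => mul_nonneg hK.le (expansionRemainder_nonneg _ _ _ _ _ _ _))]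
      _ ≤ _ := by
          refine ENNReal.ofReal_le_ofReal ?_
          rw [integral_const_mul]
          have := mul_le_mul_of_nonneg_left (hQ t ht h v hhR hvC hh hv) hK.le
          linarith

end Experiment

/-! ### Chernoff's bound and the choice of the splitting level -/

theorem exp_le_one_add_add_sq_mul_exp_abs (y : ℝ) :
    Real.exp y ≤ 1 + y + y ^ 2 * Real.exp |y| := by
  have h := Complex.norm_exp_sub_sum_le_norm_mul_exp (y : ℂ) 2
  have e : Complex.exp (y : ℂ) - ∑ m ∈ Finset.range 2, (y : ℂ) ^ m / (m.factorial : ℂ)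
      = ((Real.exp y - (1 + y) : ℝ) : ℂ) := by
    simp [Finset.sum_range_succ]
  rw [e, Complex.norm_real, Complex.norm_real, Real.norm_eq_abs, Real.norm_eq_abs, sq_abs] at h
  linarith [le_abs_self (Real.exp y - (1 + y))]

theorem lintegral_pi_prod {S : Type*} [MeasurableSpace S] (μ : Measure S) [IsProbabilityMeasure μ]
    {n : ℕ} {F : Fin n → S → ℝ≥0∞} (hF : ∀ i, Measurable (F i)) :
    ∫⁻ X : Fin n → S, ∏ i, F i (X i) ∂(Measure.pi fun _ => μ) = ∏ i, ∫⁻ x, F i x ∂μ := by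
  have h := ProbabilityTheory.iIndepFun_pi (μ := fun _ : Fin n => μ) (X := F)
    (fun i => (hF i).aemeasurable)
  rw [ProbabilityTheory.lintegral_prod_eq_prod_lintegral_of_indepFun Finset.univ
    (fun (i : Fin n) (X : Fin n → S) => F i (X i)) h fun i => (hF i).comp (measurable_pi_apply i)]
  exact Finset.prod_congr rfl fun i _ =>
    (measurePreserving_eval (fun _ : Fin n => μ) i).lintegral_comp (hF i)

/-- Chernoff bound for i.i.d. sums. -/
theorem measure_pi_lt_sum_le {S : Type*} [MeasurableSpace S] (μ : Measure S)
    [IsProbabilityMeasure μ] (n : ℕ) {G : S → ℝ} (hG : Measurable G) (s : ℝ) :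
    (Measure.pi fun _ : Fin n => μ) {X | s < ∑ i, G (X i)}
      ≤ ENNReal.ofReal (Real.exp (-s)) * (∫⁻ x, ENNReal.ofReal (Real.exp (G x)) ∂μ) ^ n := by
  have hexp : Measurable fun x => ENNReal.ofReal (Real.exp (G x)) := hG.exp.ennreal_ofReal
  have hm : Measurable fun X : Fin n → S => ∏ i, ENNReal.ofReal (Real.exp (G (X i))) :=
    Finset.measurable_prod _ fun i _ => hexp.comp (measurable_pi_apply i)
  have h := mul_meas_ge_le_lintegral (μ := Measure.pi fun _ : Fin n => μ) hm
    (ENNReal.ofReal (Real.exp s))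
  rw [lintegral_pi_prod μ fun _ => hexp, Finset.prod_const, Finset.card_univ, Fintype.card_fin] at h
  have hsub : {X : Fin n → S | s < ∑ i, G (X i)}
      ⊆ {X | ENNReal.ofReal (Real.exp s) ≤ ∏ i, ENNReal.ofReal (Real.exp (G (X i)))} := by
    intro X hX
    have hX : s < ∑ i, G (X i) := hX
    rw [Set.mem_ofPred_eq, ← ENNReal.ofReal_prod_of_nonneg fun i _ => (Real.exp_pos _).le, ← Real.exp_sum]
    exact ENNReal.ofReal_le_ofReal (Real.exp_le_exp.2 hX.le)
  calc _ ≤ (Measure.pi fun _ : Fin n => μ)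
        {X | ENNReal.ofReal (Real.exp s) ≤ ∏ i, ENNReal.ofReal (Real.exp (G (X i)))} :=
        measure_mono hsub
    _ = ENNReal.ofReal (Real.exp (-s)) * (ENNReal.ofReal (Real.exp s)
        * (Measure.pi fun _ : Fin n => μ)
        {X | ENNReal.ofReal (Real.exp s) ≤ ∏ i, ENNReal.ofReal (Real.exp (G (X i)))}) := by
        rw [← mul_assoc, ← ENNReal.ofReal_mul (Real.exp_pos _).le, ← Real.exp_add]
        simp
    _ ≤ _ := by gcongr

/-- Below `z` the power is at most `z^λ`; above `z` the negative power `y^(λ-γ)` is at most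
`z^(λ-γ)`. This trades a fixed moment for a high one. -/
theorem rpow_le_add_rpow {y z lam γ : ℝ} (hy : 0 < y) (hz : 0 < z) (hl : 0 < lam) (hγ : lam < γ) :
    y ^ lam ≤ z ^ lam + z ^ (lam - γ) * y ^ γ := by
  rcases le_total y z with h | h
  · have := Real.rpow_le_rpow hy.le h hl.le
    have : 0 ≤ z ^ (lam - γ) * y ^ γ := by positivity
    linarith
  · have h1 : y ^ lam = y ^ (lam - γ) * y ^ γ := by rw [← Real.rpow_add hy]; ring_nf
    have h2 : y ^ (lam - γ) ≤ z ^ (lam - γ) :=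
      Real.rpow_le_rpow_of_nonpos hz h (by linarith)
    have h3 : y ^ (lam - γ) * y ^ γ ≤ z ^ (lam - γ) * y ^ γ := by gcongr
    have : 0 ≤ z ^ lam := by positivity
    linarith

section Balance

variable {u γ : ℕ → ℝ} {Ψ : ℝ → ℝ}

theorem tendsto_nhdsGT_of_pos (hu : ∀ n, 0 < u n) (hu0 : Tendsto u atTop (𝓝 0)) :
    Tendsto u atTop (𝓝[>] 0) :=
  tendsto_nhdsWithin_iff.2 ⟨hu0, Eventually.of_forall hu⟩

/-- Choice of the truncation level when the moment order is logarithmic. -/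
theorem balance_of_log {c : ℝ} (hu : ∀ n, 0 < u n) (hu0 : Tendsto u atTop (𝓝 0)) (hc : 0 < c)
    (hγ : ∀ n, c * |Real.log (u n)| < γ n) (hΨ : Tendsto Ψ (𝓝[>] 0) (𝓝 0)) (K : ℝ) (hK : 0 < K)
    {lam κ : ℝ} (hκ : 0 < κ) :
    ∀ᶠ n in atTop, lam < γ n ∧ ∃ z, 0 < z ∧
      z ^ lam * (u n ^ 2 * Ψ (u n)) + K * z ^ (lam - γ n) ≤ κ * u n ^ 2 := by
  have hu' := tendsto_nhdsGT_of_pos hu hu0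
  have hlog : Tendsto (fun n => c * |Real.log (u n)|) atTop atTop :=
    (tendsto_abs_atBot_atTop.comp (Real.tendsto_log_nhdsGT_zero.comp hu')).const_mul_atTop hc
  set z := Real.exp (3 / c) with hz
  have hz0 : 0 < z := Real.exp_pos _
  have hzl : 0 < z ^ lam := by positivity
  filter_upwards [hlog.eventually_ge_atTop lam,
    hu0.eventually (gt_mem_nhds one_pos),
    (hΨ.comp hu').eventually (gt_mem_nhds (show 0 < κ / (2 * z ^ lam) by positivity)),
    hu0.eventually (gt_mem_nhds (show 0 < κ / (2 * (K * z ^ lam)) by positivity))]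
    with n h1 h2 h3 h4
  have hun := hu n
  refine ⟨h1.trans_lt (hγ n), z, hz0, ?_⟩
  have e1 : z ^ (lam - γ n) ≤ z ^ lam * u n ^ 3 := by
    rw [Real.rpow_sub hz0, div_eq_mul_inv, ← Real.rpow_neg hz0.le]
    gcongr
    rw [hz, ← Real.exp_mul]
    have hl : Real.log (u n) < 0 := Real.log_neg hun h2
    have h5 := hγ n
    rw [abs_of_neg hl] at h5
    have h6 : 3 / c * -γ n ≤ 3 * Real.log (u n) := by
      rw [div_mul_eq_mul_div, div_le_iff₀ hc]
      nlinarith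
    calc Real.exp (3 / c * -γ n) ≤ Real.exp (3 * Real.log (u n)) := Real.exp_le_exp.2 h6
      _ = u n ^ 3 := by
        rw [mul_comm, Real.exp_mul, Real.exp_log hun]; norm_cast
  have e2 : z ^ lam * Ψ (u n) ≤ κ / 2 := by
    have h3' : Ψ (u n) < κ / (2 * z ^ lam) := h3
    rw [lt_div_iff₀ (by positivity)] at h3'
    linarith
  have e3 : K * z ^ lam * u n ≤ κ / 2 := by
    rw [lt_div_iff₀ (by positivity)] at h4
    linarith
  have e4 : K * z ^ (lam - γ n) ≤ K * (z ^ lam * u n ^ 3) := by gcongr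
  have e5 := mul_le_mul_of_nonneg_right e2 (sq_nonneg (u n))
  have e6 := mul_le_mul_of_nonneg_right e3 (sq_nonneg (u n))
  nlinarith

/-- Choice of the truncation level when the tail rate is polynomial. -/
theorem balance_of_rpow {a : ℝ} (hu : ∀ n, 0 < u n) (hu0 : Tendsto u atTop (𝓝 0)) (ha : 0 < a)
    (hγ : Tendsto γ atTop atTop) (hΨ : ∀ᶠ t in 𝓝[>] (0 : ℝ), Ψ t ≤ t ^ a) (K : ℝ) (hK : 0 < K)
    {lam κ : ℝ} (hlam : 0 < lam) (hκ : 0 < κ) :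
    ∀ᶠ n in atTop, lam < γ n ∧ ∃ z, 0 < z ∧
      z ^ lam * (u n ^ 2 * Ψ (u n)) + K * z ^ (lam - γ n) ≤ κ * u n ^ 2 := by
  have hu' := tendsto_nhdsGT_of_pos hu hu0
  -- With `z = u_n^(-α)`, the factor `z^λ` costs half of the available power `u_n^a`, while
  -- `z^(λ-γ_n) ≤ u_n³` as soon as `γ_n ≥ λ + 3/α`.
  set α := a / (2 * lam) with hα
  have hα0 : 0 < α := by positivity
  filter_upwards [hγ.eventually_gt_atTop lam, hγ.eventually_ge_atTop (lam + 3 / α),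
    hu0.eventually (gt_mem_nhds one_pos), hu'.eventually hΨ,
    hu'.eventually (Experiment.eventually_const_mul_rpow_le 1 (a := a / 2) (b := 0) (show 0 < a / 2 by positivity)
      (show 0 < κ / 2 by positivity)),
    hu0.eventually (gt_mem_nhds (show 0 < κ / (2 * K) by positivity))]
    with n h1 h2 h3 h4 h5 h6
  have hun := hu n
  refine ⟨h1, (u n) ^ (-α), by positivity, ?_⟩
  have e1 : ((u n) ^ (-α)) ^ (lam - γ n) ≤ u n ^ 3 := by
    rw [← Real.rpow_mul hun.le, ← Real.rpow_natCast]
    refine Real.rpow_le_rpow_of_exponent_ge hun h3.le ?_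
    have : 3 / α ≤ γ n - lam := by linarith
    rw [div_le_iff₀ hα0] at this
    push_cast
    linarith
  have e2 : ((u n) ^ (-α)) ^ lam * Ψ (u n) ≤ κ / 2 := by
    calc ((u n) ^ (-α)) ^ lam * Ψ (u n) ≤ ((u n) ^ (-α)) ^ lam * (u n) ^ a := by gcongr
      _ = (u n) ^ (a / 2) := by
        rw [← Real.rpow_mul hun.le, ← Real.rpow_add hun]
        congr 1
        rw [hα]; field_simp; ring
      _ ≤ κ / 2 := by simpa using h5
  have e3 : K * u n ≤ κ / 2 := by
    rw [lt_div_iff₀ (by positivity)] at h6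
    linarith
  have e4 : K * ((u n) ^ (-α)) ^ (lam - γ n) ≤ K * u n ^ 3 := by gcongr
  have e5 := mul_le_mul_of_nonneg_right e2 (sq_nonneg (u n))
  have e6 := mul_le_mul_of_nonneg_right e3 (sq_nonneg (u n))
  nlinarith

end Balance

/-! ### Exponential moments and the pointwise exponential bound -/

namespace Experiment

variable {S : Type*} [MeasurableSpace S] {d : ℕ} {𝓔 : Experiment S d}
  {θ₀ : EuclideanSpace ℝ (Fin d)} {φ : S → EuclideanSpace ℝ (Fin d)} {ω : ℝ → ℝ} {u : ℕ → ℝ}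

theorem measurable_xi {h v : EuclideanSpace ℝ (Fin d)} (hh : θ₀ + h ∈ 𝓔.Θ)
    (hv : θ₀ + h + v ∈ 𝓔.Θ) : Measurable (𝓔.xi θ₀ h v) :=
  ((𝓔.measurable_f _ hv).div (𝓔.measurable_f _ hh)).log

theorem ratio_pos {θ θ' : EuclideanSpace ℝ (Fin d)} (hθ : θ ∈ 𝓔.Θ) (hθ' : θ' ∈ 𝓔.Θ) (x : S) :
    0 < 𝓔.ratio θ θ' x :=
  div_pos (𝓔.pos_f _ hθ' x) (𝓔.pos_f _ hθ x)

theorem lintegral_large_rpow_le {ε' lam γ z : ℝ} (hz : 0 < z) (hl : 0 < lam) (hγ : lam < γ)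
    {h v : EuclideanSpace ℝ (Fin d)} (hh : θ₀ + h ∈ 𝓔.Θ) (hv : θ₀ + h + v ∈ 𝓔.Θ) :
    ∫⁻ x in {x | ε' < |𝓔.xi θ₀ h v x|}, ENNReal.ofReal (Real.exp (lam * 𝓔.xi θ₀ h v x))
        ∂(𝓔.P (θ₀ + h))
      ≤ ENNReal.ofReal (z ^ lam) * 𝓔.P (θ₀ + h) {x | ε' < |𝓔.xi θ₀ h v x|}
        + ENNReal.ofReal (z ^ (lam - γ)) * ∫⁻ x, ENNReal.ofReal
          (({x | ε' < |Real.log (𝓔.ratio (θ₀ + h) (θ₀ + h + v) x)|}.indicator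
            (𝓔.ratio (θ₀ + h) (θ₀ + h + v)) x) ^ γ) ∂(𝓔.P (θ₀ + h)) := by
  have hA : MeasurableSet {x | ε' < |𝓔.xi θ₀ h v x|} :=
    measurableSet_lt measurable_const (measurable_xi hh hv).norm
  calc ∫⁻ x in {x | ε' < |𝓔.xi θ₀ h v x|}, ENNReal.ofReal (Real.exp (lam * 𝓔.xi θ₀ h v x))
        ∂(𝓔.P (θ₀ + h))
      ≤ ∫⁻ x in {x | ε' < |𝓔.xi θ₀ h v x|}, (ENNReal.ofReal (z ^ lam)
        + ENNReal.ofReal (z ^ (lam - γ)) * ENNReal.ofReal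
          (({x | ε' < |Real.log (𝓔.ratio (θ₀ + h) (θ₀ + h + v) x)|}.indicator
            (𝓔.ratio (θ₀ + h) (θ₀ + h + v)) x) ^ γ)) ∂(𝓔.P (θ₀ + h)) := by
        refine setLIntegral_mono' hA fun x hx => ?_
        have hx' : x ∈ {x | ε' < |Real.log (𝓔.ratio (θ₀ + h) (θ₀ + h + v) x)|} := hx
        have hr := ratio_pos hh hv x
        rw [Set.indicator_of_mem hx', ← ENNReal.ofReal_mul (by positivity),
          ← ENNReal.ofReal_add (by positivity) (by positivity)]
        refine ENNReal.ofReal_le_ofReal ?_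
        rw [xi, mul_comm, ← Real.rpow_def_of_pos hr]
        exact rpow_le_add_rpow hr hz hl hγ
    _ ≤ _ := by
        rw [lintegral_add_left measurable_const, setLIntegral_const]
        gcongr
        rw [lintegral_const_mul' _ _ ENNReal.ofReal_ne_top]
        gcongr
        exact Measure.restrict_le_self

/-- Under the law at `θ₀ + h + v` the reversed increment is `-ξ`, and the change of density
contributes one factor `exp ξ`. A nonpositive exponent `λ` becomes `1 - λ ≥ 1`. -/
theorem lintegral_large_swap {ε' lam : ℝ}
    {h v : EuclideanSpace ℝ (Fin d)} (hh : θ₀ + h ∈ 𝓔.Θ) (hv : θ₀ + h + v ∈ 𝓔.Θ) :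
    ∫⁻ x in {x | ε' < |𝓔.xi θ₀ h v x|}, ENNReal.ofReal (Real.exp (lam * 𝓔.xi θ₀ h v x))
        ∂(𝓔.P (θ₀ + h))
      = ∫⁻ x in {x | ε' < |𝓔.xi θ₀ (h + v) (-v) x|},
        ENNReal.ofReal (Real.exp ((1 - lam) * 𝓔.xi θ₀ (h + v) (-v) x)) ∂(𝓔.P (θ₀ + (h + v))) := by
  have hxi : ∀ x, 𝓔.xi θ₀ (h + v) (-v) x = -𝓔.xi θ₀ h v x := by
    intro x
    rw [xi, xi, ratio, ratio, ← Real.log_inv, inv_div, ← add_assoc, add_neg_cancel_right]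
  have hA : MeasurableSet {x | ε' < |𝓔.xi θ₀ h v x|} :=
    measurableSet_lt measurable_const (measurable_xi hh hv).norm
  simp only [hxi, abs_neg]
  rw [← add_assoc]
  rw [← lintegral_indicator hA, ← lintegral_indicator hA, lintegral_P hh, lintegral_P hv]
  refine lintegral_congr fun x => ?_
  by_cases hx : x ∈ {x | ε' < |𝓔.xi θ₀ h v x|}
  · rw [Set.indicator_of_mem hx, Set.indicator_of_mem hx, ← ENNReal.ofReal_mul (𝓔.pos_f _ hh x).le,
      ← ENNReal.ofReal_mul (𝓔.pos_f _ hv x).le]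
    congr 1
    have h1 : 𝓔.f x (θ₀ + h + v) = 𝓔.f x (θ₀ + h) * Real.exp (𝓔.xi θ₀ h v x) := by
      rw [xi, Real.exp_log (ratio_pos hh hv x), ratio]
      have := (𝓔.pos_f _ hh x).ne'
      field_simp
    rw [h1, mul_assoc, ← Real.exp_add]
    congr 2
    ring
  · rw [Set.indicator_of_notMem hx, Set.indicator_of_notMem hx, mul_zero, mul_zero]

/-- Exponential moments of the log-likelihood increment on the event that it is large are
negligible. -/
theorem exists_large_exp_moment_le (hF : 𝓔.FiniteFisher θ₀ φ ω) (hθ₀ : θ₀ ∈ 𝓔.Θ)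
    (hu : ∀ n, 0 < u n) (hu0 : Tendsto u atTop (𝓝 0))
    (hB : 𝓔.CondB2 θ₀ u ∨ (𝓔.CondB1 θ₀ u ∧ 𝓔.CondC1 θ₀ φ ω ∧ 𝓔.CondC2 θ₀ φ)) :
    ∃ ε', 0 < ε' ∧ ∀ lam R C κ : ℝ, 0 ≤ R → 0 ≤ C → 0 < κ → ∀ᶠ n in atTop,
      ∀ h v : EuclideanSpace ℝ (Fin d), ‖h‖ ≤ R * u n → ‖v‖ ≤ C * u n →
        θ₀ + h ∈ 𝓔.Θ → θ₀ + h + v ∈ 𝓔.Θ →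
        ∫⁻ x in {x | ε' < |𝓔.xi θ₀ h v x|}, ENNReal.ofReal (Real.exp (lam * 𝓔.xi θ₀ h v x))
          ∂(𝓔.P (θ₀ + h)) ≤ ENNReal.ofReal (κ * u n ^ 2) := by
  -- Common interface of the two alternatives: the moment bound and a level `z` balancing its two
  -- error terms. From here on they are treated alike.
  obtain ⟨γ, hM, hbal⟩ : ∃ γ : ℕ → ℝ, 𝓔.MomentBound θ₀ u γ ∧
      ∀ K lam κ R C ε' : ℝ, 0 < K → 0 < lam → 0 < κ → 0 ≤ R → 0 ≤ C → 0 < ε' → ∃ Ψ : ℝ → ℝ,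
      (∀ t, 0 < t → ∀ h v : EuclideanSpace ℝ (Fin d), ‖h‖ ≤ R * t → ‖v‖ ≤ C * t →
        θ₀ + h ∈ 𝓔.Θ → θ₀ + h + v ∈ 𝓔.Θ →
        𝓔.P (θ₀ + h) {x | ε' < |𝓔.xi θ₀ h v x|} ≤ ENNReal.ofReal (t ^ 2 * Ψ t)) ∧
      ∀ᶠ n in atTop, lam < γ n ∧ ∃ z, 0 < z ∧
        z ^ lam * (u n ^ 2 * Ψ (u n)) + K * z ^ (lam - γ n) ≤ κ * u n ^ 2 := by
    rcases hB with ⟨c, hc, γ, hγ, hM⟩ | ⟨⟨γ, hγ, hM⟩, hC1, -⟩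
    · refine ⟨γ, hM, fun K lam κ R C ε' hK hlam hκ hR hC hε' => ?_⟩
      obtain ⟨Ψ, hΨ, -, hP⟩ := exists_large_increment_rate hF hθ₀ hR hC hε'
      exact ⟨Ψ, hP, balance_of_log hu hu0 hc hγ hΨ K hK hκ⟩
    · refine ⟨γ, hM, fun K lam κ R C ε' hK hlam hκ hR hC hε' => ?_⟩
      obtain ⟨Ψ, -, hΨ, hP⟩ := exists_large_increment_rate hF hθ₀ hR hC hε'
      obtain ⟨a, ha, hΨ⟩ := hΨ hC1
      exact ⟨Ψ, hP, balance_of_rpow hu hu0 ha hγ hΨ K hK hlam hκ⟩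
  obtain ⟨U, hU, -, ε', K, hε', hK, hmom⟩ := hM
  refine ⟨ε', hε', ?_⟩
  have pos : ∀ lam R C κ : ℝ, 0 < lam → 0 ≤ R → 0 ≤ C → 0 < κ → ∀ᶠ n in atTop,
      ∀ h v : EuclideanSpace ℝ (Fin d), ‖h‖ ≤ R * u n → ‖v‖ ≤ C * u n →
        θ₀ + h ∈ 𝓔.Θ → θ₀ + h + v ∈ 𝓔.Θ →
        ∫⁻ x in {x | ε' < |𝓔.xi θ₀ h v x|}, ENNReal.ofReal (Real.exp (lam * 𝓔.xi θ₀ h v x))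
          ∂(𝓔.P (θ₀ + h)) ≤ ENNReal.ofReal (κ * u n ^ 2) := by
    intro lam R C κ hlam hR hC hκ
    obtain ⟨Ψ, hP, hz⟩ := hbal K lam κ R C ε' hK hlam hκ hR hC hε'
    obtain ⟨n₀, hn₀⟩ := hmom (C + 1) (by positivity)
    obtain ⟨ρ, hρ, hball⟩ := Metric.mem_nhds_iff.1 hU
    have hRu : Tendsto (fun n => R * u n) atTop (𝓝 0) := by simpa using hu0.const_mul R
    filter_upwards [hz, eventually_gt_atTop n₀, hRu.eventually (gt_mem_nhds hρ)]
      with n ⟨hγ, z, hz, hle⟩ hn hRn h v hhR hvC hh hv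
    have hUh : θ₀ + h ∈ U := hball (by
      rw [Metric.mem_ball, dist_eq_norm, add_sub_cancel_left]; linarith)
    have hun := hu n
    have hm := hn₀ n hn _ hUh v (by linarith) hv
    refine (lintegral_large_rpow_le hz hlam hγ hh hv).trans ?_
    have hp := hP (u n) hun h v hhR hvC hh hv
    -- The rate `Ψ` has no prescribed sign. If its value is negative, the large event is null and
    -- both terms of the bound vanish.
    rcases le_or_gt 0 (u n ^ 2 * Ψ (u n)) with h0 | h0
    · calc _ ≤ ENNReal.ofReal (z ^ lam) * ENNReal.ofReal (u n ^ 2 * Ψ (u n))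
            + ENNReal.ofReal (z ^ (lam - γ n)) * ENNReal.ofReal K := by gcongr
        _ = ENNReal.ofReal (z ^ lam * (u n ^ 2 * Ψ (u n)) + K * z ^ (lam - γ n)) := by
          rw [← ENNReal.ofReal_mul (by positivity), ← ENNReal.ofReal_mul (by positivity),
            ← ENNReal.ofReal_add (by positivity) (by positivity), mul_comm K]
        _ ≤ _ := ENNReal.ofReal_le_ofReal hle
    · rw [ENNReal.ofReal_of_nonpos h0.le, nonpos_iff_eq_zero] at hp
      rw [← nonpos_iff_eq_zero] at hp
      have hset : ∫⁻ x, ENNReal.ofReal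
          (({x | ε' < |Real.log (𝓔.ratio (θ₀ + h) (θ₀ + h + v) x)|}.indicator
            (𝓔.ratio (θ₀ + h) (θ₀ + h + v)) x) ^ γ n) ∂(𝓔.P (θ₀ + h)) = 0 := by
        have hae : ∀ᵐ x ∂(𝓔.P (θ₀ + h)), ¬ ε' < |𝓔.xi θ₀ h v x| := by
          rw [ae_iff]; simpa using hp
        rw [lintegral_eq_zero_iff' (by
          refine AEMeasurable.ennreal_ofReal ?_
          refine (Measurable.indicator ?_ ?_).aemeasurable.pow_const _
          · exact (𝓔.measurable_f _ hv).div (𝓔.measurable_f _ hh)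
          · exact measurableSet_lt measurable_const (measurable_xi hh hv).norm)]
        filter_upwards [hae] with x hx
        have hx' : x ∉ {x | ε' < |Real.log (𝓔.ratio (θ₀ + h) (θ₀ + h + v) x)|} := hx
        rw [Set.indicator_of_notMem hx', Real.zero_rpow (by linarith)]
        simp
      rw [hset, nonpos_iff_eq_zero.1 hp]
      simp
  intro lam R C κ hR hC hκ
  rcases lt_or_ge 0 lam with hlam | hlam
  · exact pos lam R C κ hlam hR hC hκ
  -- After the swap the base point is `h + v`, hence the radius `R + C`.
  · filter_upwards [pos (1 - lam) (R + C) C κ (by linarith) (by positivity) hC hκ]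
      with n hn h v hhR hvC hh hv
    rw [lintegral_large_swap hh hv]
    refine hn (h + v) (-v) ((norm_add_le _ _).trans (by linarith)) (by rwa [norm_neg])
      (by rwa [← add_assoc]) ?_
    rwa [← add_assoc, add_neg_cancel_right]

theorem trunc_eq {T : Type*} (φ : T → EuclideanSpace ℝ (Fin d)) {ε t : ℝ} (ht : 0 < t)
    (v : EuclideanSpace ℝ (Fin d)) (x : T) :
    inner ℝ v (trunc φ ε t x) = if t * ‖φ x‖ < ε then inner ℝ v (φ x) else 0 := by
  have hiff : ‖φ x‖ < t⁻¹ * ε ↔ t * ‖φ x‖ < ε := by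
    rw [inv_mul_eq_div, lt_div_iff₀ ht, mul_comm]
  rw [trunc]
  split_ifs with hx
  · rw [Set.indicator_of_mem (by exact hiff.2 hx)]
  · rw [Set.indicator_of_notMem (by exact fun h => hx (hiff.1 h)), inner_zero_right]

theorem measurable_trunc (hF : 𝓔.FiniteFisher θ₀ φ ω) (ε t : ℝ) : Measurable (trunc φ ε t) :=
  hF.measurable_φ.indicator (measurableSet_lt hF.measurable_φ.norm measurable_const)

/-- The centred one-observation term of the LAN error. -/
def lanTerm (𝓔 : Experiment S d) (θ₀ : EuclideanSpace ℝ (Fin d))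
    (φ : S → EuclideanSpace ℝ (Fin d)) (ε t : ℝ) (h v : EuclideanSpace ℝ (Fin d)) (x : S) : ℝ :=
  𝓔.xi θ₀ h v x - 2 * inner ℝ v (trunc φ ε t x)
    + (1 / 2 * 𝓔.fisherForm θ₀ φ v v + 𝓔.fisherForm θ₀ φ h v)

theorem measurable_lanTerm (hF : 𝓔.FiniteFisher θ₀ φ ω) (ε t : ℝ)
    {h v : EuclideanSpace ℝ (Fin d)} (hh : θ₀ + h ∈ 𝓔.Θ) (hv : θ₀ + h + v ∈ 𝓔.Θ) :
    Measurable (𝓔.lanTerm θ₀ φ ε t h v) :=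
  ((measurable_xi hh hv).sub
    ((measurable_const.inner (measurable_trunc hF ε t)).const_mul 2)).add measurable_const

theorem lanError_eq (ε t : ℝ) {n : ℕ} (h v : EuclideanSpace ℝ (Fin d)) (X : Fin n → S) :
    𝓔.lanError θ₀ φ ε t h v X = |∑ i, 𝓔.lanTerm θ₀ φ ε t h v (X i)| := by
  rw [lanError, zeta]
  congr 1
  simp only [lanTerm, Finset.sum_add_distrib, Finset.sum_sub_distrib, inner_sum, ← Finset.mul_sum,
    Finset.sum_const, Finset.card_univ, Fintype.card_fin, nsmul_eq_mul]
  ring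

/-- Let `m = ½ vᵀIv + hᵀIv` and let `Y` be the truncated increment. Then `E Y = -m + o(u_n²)` and `E
Y² = o(u_n²)`. As `Y` is bounded, `E exp(λY) ≤ 1 - λm + o(u_n²) ≤ exp(-λm + o(u_n²))`, and the
centring factor `exp(λm)` cancels the main term. The large increments contribute a further
`o(u_n²)`. -/
theorem exists_lanTerm_mgf_le (hF : 𝓔.FiniteFisher θ₀ φ ω) (hθ₀ : θ₀ ∈ 𝓔.Θ)
    (hu : ∀ n, 0 < u n) (hu0 : Tendsto u atTop (𝓝 0))
    (hB : 𝓔.CondB2 θ₀ u ∨ (𝓔.CondB1 θ₀ u ∧ 𝓔.CondC1 θ₀ φ ω ∧ 𝓔.CondC2 θ₀ φ))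
    {ε : ℝ} (hε : 0 < ε) (lam : ℝ) {R C κ : ℝ} (hR : 0 ≤ R) (hC : 0 ≤ C) (hκ : 0 < κ) :
    ∀ᶠ n in atTop, ∀ h v : EuclideanSpace ℝ (Fin d), ‖h‖ ≤ R * u n → ‖v‖ ≤ C * u n →
        θ₀ + h ∈ 𝓔.Θ → θ₀ + h + v ∈ 𝓔.Θ →
        ∫⁻ x, ENNReal.ofReal (Real.exp (lam * 𝓔.lanTerm θ₀ φ ε (u n) h v x)) ∂(𝓔.P (θ₀ + h))
          ≤ ENNReal.ofReal (Real.exp (κ * u n ^ 2)) := by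
  obtain ⟨ε', hε', hlarge⟩ := exists_large_exp_moment_le hF hθ₀ hu hu0 hB
  set B := ε' + 2 * (C * ε) with hBdef
  have hB0 : 0 < B := by positivity
  -- Sum of the coefficients of the three errors: mean, second moment, large increments. Each error
  -- is requested at size `κ/K`.
  set K := |lam| + lam ^ 2 * Real.exp (|lam| * B) + Real.exp (2 * |lam| * (C * ε)) with hK
  have hK0 : 0 < K := by positivity
  have hκ' : 0 < κ / K := by positivity
  filter_upwards [hlarge lam R C (κ / K) hR hC hκ',
    (tendsto_nhdsGT_of_pos hu hu0).eventually
      (exists_incr_expansion hF hθ₀ hR hC hε hε' hκ')] with n hl he h v hhR hvC hh hv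
  have hun := hu n
  obtain ⟨he2, he1⟩ := he h v hhR hvC hh hv
  have hl := hl h v hhR hvC hh hv
  have : IsProbabilityMeasure (𝓔.P (θ₀ + h)) := 𝓔.isProbabilityMeasure_P hh
  set Y := 𝓔.incr θ₀ φ ε ε' (u n) h v with hY
  have mY : Measurable Y := measurable_incr hF ε ε' (u n) hh hv
  have bY : ∀ x, |Y x| ≤ B := fun x => abs_incr_le hε hε' hC hvC x
  have iY : Integrable Y (𝓔.P (θ₀ + h)) :=
    Integrable.of_bound mY.aestronglyMeasurable _ (Eventually.of_forall bY)
  have iY2 : Integrable (fun x => Y x ^ 2) (𝓔.P (θ₀ + h)) := by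
    refine Integrable.of_bound (mY.pow_const 2).aestronglyMeasurable (B ^ 2)
      (Eventually.of_forall fun x => ?_)
    rw [Real.norm_eq_abs, abs_of_nonneg (sq_nonneg _), ← sq_abs]
    have := bY x
    gcongr
  have iexp : Integrable (fun x => Real.exp (lam * Y x)) (𝓔.P (θ₀ + h)) := by
    refine Integrable.of_bound (mY.const_mul lam).exp.aestronglyMeasurable (Real.exp (|lam| * B))
      (Eventually.of_forall fun x => ?_)
    rw [Real.norm_eq_abs, Real.abs_exp]
    refine Real.exp_le_exp.2 ((le_abs_self _).trans ?_)
    rw [abs_mul]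
    have := bY x
    gcongr
  have hA : MeasurableSet {x | ε' < |𝓔.xi θ₀ h v x|} :=
    measurableSet_lt measurable_const (measurable_xi hh hv).norm
  obtain ⟨m, hm⟩ : ∃ m, m = 1 / 2 * 𝓔.fisherForm θ₀ φ v v + 𝓔.fisherForm θ₀ φ h v := ⟨_, rfl⟩
  have hEexp : ∫ x, Real.exp (lam * Y x) ∂(𝓔.P (θ₀ + h)) ≤ 1 + lam * ∫ x, Y x ∂(𝓔.P (θ₀ + h))
      + lam ^ 2 * Real.exp (|lam| * B) * ∫ x, Y x ^ 2 ∂(𝓔.P (θ₀ + h)) := by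
    have i1 : Integrable (fun x => 1 + lam * Y x) (𝓔.P (θ₀ + h)) :=
      (integrable_const 1).add (iY.const_mul lam)
    calc ∫ x, Real.exp (lam * Y x) ∂(𝓔.P (θ₀ + h))
        ≤ ∫ x, (1 + lam * Y x + lam ^ 2 * Real.exp (|lam| * B) * Y x ^ 2) ∂(𝓔.P (θ₀ + h)) := by
          refine integral_mono iexp (i1.add (iY2.const_mul _)) fun x => ?_
          dsimp only
          refine (exp_le_one_add_add_sq_mul_exp_abs (lam * Y x)).trans ?_
          have h1 : Real.exp |lam * Y x| ≤ Real.exp (|lam| * B) := by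
            rw [abs_mul]; have := bY x; gcongr
          have h2 : (lam * Y x) ^ 2 * Real.exp |lam * Y x|
              ≤ (lam * Y x) ^ 2 * Real.exp (|lam| * B) := by gcongr
          linarith
      _ = _ := by
          rw [integral_add i1 (iY2.const_mul _), integral_add (integrable_const 1)
            (iY.const_mul lam), integral_const_mul, integral_const_mul]
          simp
  -- Where the increment is small the term is exactly `m + Y`. Where it is large, the `Y` summand is
  -- merely a nonnegative surplus and `|⟨v, φ_ε⟩| ≤ Cε` bounds the truncated score.
  have hpt : ∀ x, ENNReal.ofReal (Real.exp (lam * 𝓔.lanTerm θ₀ φ ε (u n) h v x))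
      ≤ ENNReal.ofReal (Real.exp (lam * m)) * (ENNReal.ofReal (Real.exp (lam * Y x))
        + {x | ε' < |𝓔.xi θ₀ h v x|}.indicator (fun x => ENNReal.ofReal
          (Real.exp (2 * |lam| * (C * ε))) * ENNReal.ofReal (Real.exp (lam * 𝓔.xi θ₀ h v x))) x) := by
    intro x
    have hterm : lam * 𝓔.lanTerm θ₀ φ ε (u n) h v x
        = lam * m + (lam * 𝓔.xi θ₀ h v x - 2 * lam * inner ℝ v (trunc φ ε (u n) x)) := by
      rw [lanTerm, hm]; ring
    rw [hterm, Real.exp_add, ENNReal.ofReal_mul (Real.exp_pos _).le]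
    gcongr
    by_cases hx : x ∈ {x | ε' < |𝓔.xi θ₀ h v x|}
    · rw [Set.indicator_of_mem hx, ← ENNReal.ofReal_mul (Real.exp_pos _).le, ← Real.exp_add]
      refine le_trans (ENNReal.ofReal_le_ofReal (Real.exp_le_exp.2 ?_)) le_add_self
      have h1 : |inner ℝ v (trunc φ ε (u n) x)| ≤ C * ε := by
        rw [trunc_eq φ hun]
        split_ifs with h
        · have h1 := abs_real_inner_le_norm v (φ x)
          have h2 : ‖v‖ * ‖φ x‖ ≤ C * u n * ‖φ x‖ := by gcongr
          have h3 : C * (u n * ‖φ x‖) ≤ C * ε := by gcongr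
          linarith
        · rw [abs_zero]; positivity
      have h2 : |lam * inner ℝ v (trunc φ ε (u n) x)| ≤ |lam| * (C * ε) := by
        rw [abs_mul]; gcongr
      have := neg_abs_le (lam * inner ℝ v (trunc φ ε (u n) x))
      linarith
    · rw [Set.indicator_of_notMem hx, add_zero]
      refine le_of_eq ?_
      congr 2
      have hx' : ¬ ε' < |𝓔.xi θ₀ h v x| := hx
      rw [trunc_eq φ hun, hY, incr, truncatedIncrement, ← xi_eq hh hv, if_pos (not_lt.1 hx')]
      ring
  calc ∫⁻ x, ENNReal.ofReal (Real.exp (lam * 𝓔.lanTerm θ₀ φ ε (u n) h v x)) ∂(𝓔.P (θ₀ + h))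
      ≤ ENNReal.ofReal (Real.exp (lam * m)) * (ENNReal.ofReal (∫ x, Real.exp (lam * Y x)
        ∂(𝓔.P (θ₀ + h))) + ENNReal.ofReal (Real.exp (2 * |lam| * (C * ε)))
          * ENNReal.ofReal (κ / K * u n ^ 2)) := by
        refine (lintegral_mono hpt).trans ?_
        rw [lintegral_const_mul' _ _ ENNReal.ofReal_ne_top,
          lintegral_add_left (mY.const_mul lam).exp.ennreal_ofReal,
          ← ofReal_integral_eq_lintegral_ofReal iexp
            (Eventually.of_forall fun x => (Real.exp_pos _).le),
          lintegral_indicator hA, lintegral_const_mul' _ _ ENNReal.ofReal_ne_top]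
        gcongr
    _ = ENNReal.ofReal (Real.exp (lam * m) * (∫ x, Real.exp (lam * Y x) ∂(𝓔.P (θ₀ + h))
          + Real.exp (2 * |lam| * (C * ε)) * (κ / K * u n ^ 2))) := by
        have h0 : 0 ≤ ∫ x, Real.exp (lam * Y x) ∂(𝓔.P (θ₀ + h)) :=
          integral_nonneg fun x => (Real.exp_pos _).le
        rw [← ENNReal.ofReal_mul (Real.exp_pos _).le, ← ENNReal.ofReal_add h0 (by positivity),
          ← ENNReal.ofReal_mul (Real.exp_pos _).le]
    _ ≤ _ := by
        refine ENNReal.ofReal_le_ofReal ?_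
        obtain ⟨E1, hE1⟩ : ∃ a, a = ∫ x, Y x ∂(𝓔.P (θ₀ + h)) := ⟨_, rfl⟩
        obtain ⟨E2, hE2⟩ : ∃ a, a = ∫ x, Y x ^ 2 ∂(𝓔.P (θ₀ + h)) := ⟨_, rfl⟩
        rw [← hE1, ← hE2] at hEexp
        rw [← hE1] at he1
        rw [← hE2] at he2
        have hm1 : |lam * (E1 + m)| ≤ |lam| * (κ / K * u n ^ 2) := by
          rw [abs_mul]
          gcongr
          rw [hm, ← add_assoc]; exact he1
        have hm2 : lam ^ 2 * Real.exp (|lam| * B) * E2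
            ≤ lam ^ 2 * Real.exp (|lam| * B) * (κ / K * u n ^ 2) := by gcongr
        have hsum : ∫ x, Real.exp (lam * Y x) ∂(𝓔.P (θ₀ + h))
          + Real.exp (2 * |lam| * (C * ε)) * (κ / K * u n ^ 2) ≤ 1 + (-(lam * m) + κ * u n ^ 2) := by
          have h1 : K * (κ / K * u n ^ 2) = κ * u n ^ 2 := by field_simp
          have h2 := le_abs_self (lam * (E1 + m))
          rw [← h1, hK]
          linarith
        calc Real.exp (lam * m) * (∫ x, Real.exp (lam * Y x) ∂(𝓔.P (θ₀ + h))
              + Real.exp (2 * |lam| * (C * ε)) * (κ / K * u n ^ 2))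
            ≤ Real.exp (lam * m) * Real.exp (-(lam * m) + κ * u n ^ 2) := by
              gcongr
              refine hsum.trans ?_
              have := Real.add_one_le_exp (-(lam * m) + κ * u n ^ 2)
              linarith
          _ = Real.exp (κ * u n ^ 2) := by rw [← Real.exp_add]; congr 1; ring

/-- Pointwise large-deviation bound for the LAN error. -/
theorem eventually_lanError_prob_le (hF : 𝓔.FiniteFisher θ₀ φ ω) (hθ₀ : θ₀ ∈ 𝓔.Θ)
    (hu : ∀ n, 0 < u n) (hu0 : Tendsto u atTop (𝓝 0))
    (hnu : Tendsto (fun n : ℕ => (n : ℝ) * u n ^ 2) atTop atTop)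
    (hB : 𝓔.CondB2 θ₀ u ∨ (𝓔.CondB1 θ₀ u ∧ 𝓔.CondC1 θ₀ φ ω ∧ 𝓔.CondC2 θ₀ φ))
    {ε : ℝ} (hε : 0 < ε) {R C δ M : ℝ} (hR : 0 ≤ R) (hC : 0 ≤ C) (hδ : 0 < δ) (hM : 0 < M) :
    ∀ᶠ n : ℕ in atTop, ∀ h v : EuclideanSpace ℝ (Fin d), ‖h‖ ≤ R * u n → ‖v‖ ≤ C * u n →
        θ₀ + h ∈ 𝓔.Θ → θ₀ + h + v ∈ 𝓔.Θ →
        𝓔.sampleLaw n (θ₀ + h) {X | n * u n ^ 2 * δ < 𝓔.lanError θ₀ φ ε (u n) h v X}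
          ≤ ENNReal.ofReal (Real.exp (-(M * (n * u n ^ 2)))) := by
  -- The threshold `δN` gives `exp(-(M + 2)N)`; the exponential moment costs `exp N`, and another
  -- `exp(-N) ≤ 1/2` absorbs the two signs.
  set lam := (M + 2) / δ with hlam
  have hlam0 : 0 < lam := by positivity
  filter_upwards [exists_lanTerm_mgf_le hF hθ₀ hu hu0 hB hε lam hR hC one_pos,
    exists_lanTerm_mgf_le hF hθ₀ hu hu0 hB hε (-lam) hR hC one_pos,
    hnu.eventually_ge_atTop 1] with n h1 h2 hN h v hhR hvC hh hv
  have h1 := h1 h v hhR hvC hh hv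
  have h2 := h2 h v hhR hvC hh hv
  have : IsProbabilityMeasure (𝓔.P (θ₀ + h)) := 𝓔.isProbabilityMeasure_P hh
  have mT := measurable_lanTerm hF ε (u n) hh hv
  obtain ⟨N, hNdef⟩ : ∃ N, N = (n : ℝ) * u n ^ 2 := ⟨_, rfl⟩
  have one : ∀ l : ℝ, ∫⁻ x, ENNReal.ofReal (Real.exp (l * 𝓔.lanTerm θ₀ φ ε (u n) h v x))
      ∂(𝓔.P (θ₀ + h)) ≤ ENNReal.ofReal (Real.exp (1 * u n ^ 2)) →
      𝓔.sampleLaw n (θ₀ + h) {X | (M + 2) * N < ∑ i, l * 𝓔.lanTerm θ₀ φ ε (u n) h v (X i)}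
        ≤ ENNReal.ofReal (Real.exp (-((M + 1) * N))) := by
    intro l hl
    refine (measure_pi_lt_sum_le (𝓔.P (θ₀ + h)) n (mT.const_mul l) ((M + 2) * N)).trans ?_
    calc _ ≤ ENNReal.ofReal (Real.exp (-((M + 2) * N)))
          * ENNReal.ofReal (Real.exp (1 * u n ^ 2)) ^ n := by gcongr
      _ = _ := by
        rw [← ENNReal.ofReal_pow (Real.exp_pos _).le, ← Real.exp_nat_mul,
          ← ENNReal.ofReal_mul (Real.exp_pos _).le, ← Real.exp_add, hNdef]
        congr 2
        ring
  have hsub : {X : Fin n → S | n * u n ^ 2 * δ < 𝓔.lanError θ₀ φ ε (u n) h v X}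
      ⊆ {X | (M + 2) * N < ∑ i, lam * 𝓔.lanTerm θ₀ φ ε (u n) h v (X i)}
        ∪ {X | (M + 2) * N < ∑ i, -lam * 𝓔.lanTerm θ₀ φ ε (u n) h v (X i)} := by
    intro X hX
    have hX : n * u n ^ 2 * δ < 𝓔.lanError θ₀ φ ε (u n) h v X := hX
    rw [lanError_eq, ← hNdef, lt_abs] at hX
    have e : (M + 2) * N = lam * (N * δ) := by rw [hlam]; field_simp
    rcases hX with hX | hX
    · left
      rw [Set.mem_ofPred_eq, ← Finset.mul_sum, e]
      gcongr
    · right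
      rw [Set.mem_ofPred_eq, ← Finset.mul_sum, e, neg_mul, ← mul_neg]
      gcongr
  refine (measure_mono hsub).trans ((measure_union_le _ _).trans
    ((add_le_add (one lam h1) (one (-lam) h2)).trans ?_))
  rw [← ENNReal.ofReal_add (Real.exp_pos _).le (Real.exp_pos _).le, ← hNdef]
  refine ENNReal.ofReal_le_ofReal ?_
  rw [← hNdef] at hN
  have e1 : Real.exp (-((M + 1) * N)) = Real.exp (-N) * Real.exp (-(M * N)) := by
    rw [← Real.exp_add]; congr 1; ring
  have e2 : Real.exp (-N) ≤ 1 / 2 := by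
    rw [Real.exp_neg, one_div]
    refine inv_anti₀ (by norm_num) ?_
    have := Real.add_one_le_exp N
    linarith
  have e3 := mul_le_mul_of_nonneg_right e2 (Real.exp_pos (-(M * N))).le
  rw [e1]
  linarith

end Experiment

/-! ### Marcinkiewicz–Zygmund inequality -/

theorem rpow_sub_two_mul_sq {y m : ℝ} (hy : 0 ≤ y) (hm : 2 ≤ m) : y ^ (m - 2) * y ^ 2 = y ^ m := by
  rw [← Real.rpow_two, ← Real.rpow_add_of_nonneg hy (by linarith) (by norm_num)]
  congr 1
  ring

/-- Second-order expansion of `|·|^m` with an explicit linear term, which disappears on averaging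
over a centred `b`. If `|a| ≤ 2|b|`, all terms are of order `|b|^m`; otherwise `b = ax` with `|x| ≤
1/2`, and `(1 + x)^m ≤ exp(mx)`. -/
theorem exists_abs_add_rpow_le {m : ℝ} (hm : 2 ≤ m) :
    ∃ K, 0 < K ∧ ∀ a b : ℝ, |a + b| ^ m ≤ |a| ^ m + m * (|a| ^ (m - 2) * a) * b
      + K * (|a| ^ (m - 2) * b ^ 2 + |b| ^ m) := by
  have hm0 : 0 < m := by linarith
  refine ⟨3 ^ m + m * (2 ^ (m - 2) * 2) + m ^ 2 * Real.exp m, by positivity, fun a b => ?_⟩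
  have k1 : 0 ≤ |a| ^ (m - 2) * b ^ 2 := by positivity
  have k2 : 0 ≤ |b| ^ m := by positivity
  have k3 : 0 ≤ |a| ^ m := by positivity
  have k4 : 0 ≤ (3 : ℝ) ^ m := by positivity
  have k5 : 0 ≤ m * ((2 : ℝ) ^ (m - 2) * 2) := by positivity
  have k6 : 0 ≤ m ^ 2 * Real.exp m := by positivity
  rcases le_or_gt |a| (2 * |b|) with h | h
  · have h1 : |a + b| ^ m ≤ 3 ^ m * |b| ^ m := by
      rw [← Real.mul_rpow (by norm_num) (abs_nonneg b)]
      refine Real.rpow_le_rpow (abs_nonneg _) ?_ hm0.le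
      have := abs_add_le a b
      linarith
    have h2 : |m * (|a| ^ (m - 2) * a) * b| ≤ m * (2 ^ (m - 2) * 2) * |b| ^ m := by
      rw [abs_mul, abs_mul, abs_mul, abs_of_pos hm0, abs_of_nonneg (by positivity : 0 ≤ |a| ^ (m - 2)),
        ← rpow_sub_two_mul_sq (abs_nonneg b) hm]
      have h3 : |a| ^ (m - 2) ≤ 2 ^ (m - 2) * |b| ^ (m - 2) := by
        rw [← Real.mul_rpow (by norm_num) (abs_nonneg b)]
        exact Real.rpow_le_rpow (abs_nonneg _) h (by linarith)
      calc m * (|a| ^ (m - 2) * |a|) * |b|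
          ≤ m * ((2 ^ (m - 2) * |b| ^ (m - 2)) * (2 * |b|)) * |b| := by gcongr
        _ = _ := by ring
    have h4 := neg_abs_le (m * (|a| ^ (m - 2) * a) * b)
    have k7 := mul_nonneg (add_nonneg (add_nonneg k4 k5) k6) k1
    have k8 := mul_nonneg k6 k2
    linarith
  · have ha : a ≠ 0 := by
      rintro rfl
      rw [abs_zero] at h
      have := abs_nonneg b
      linarith
    have ha0 : 0 < |a| := abs_pos.2 ha
    obtain ⟨x, hx⟩ : ∃ x, x = b / a := ⟨_, rfl⟩
    have hb : b = a * x := by rw [hx]; field_simp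
    have hx1 : |x| ≤ 1 / 2 := by
      rw [hx, abs_div, div_le_iff₀ ha0]; linarith
    have h1x : 0 ≤ 1 + x := by linarith [(abs_le.1 hx1).1]
    have h1 : (1 + x) ^ m ≤ 1 + m * x + m ^ 2 * Real.exp m * x ^ 2 := by
      have h2 : (1 + x) ^ m ≤ Real.exp (m * x) := by
        rw [mul_comm, Real.exp_mul]
        refine Real.rpow_le_rpow h1x ?_ hm0.le
        linarith [Real.add_one_le_exp x]
      have h3 := exp_le_one_add_add_sq_mul_exp_abs (m * x)
      have h4 : Real.exp |m * x| ≤ Real.exp m := by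
        refine Real.exp_le_exp.2 ?_
        rw [abs_mul, abs_of_pos hm0]
        have : m * |x| ≤ m * (1 / 2) := by gcongr
        linarith
      have h5 : (m * x) ^ 2 * Real.exp |m * x| ≤ (m * x) ^ 2 * Real.exp m := by gcongr
      linarith
    have h2 : |a + b| ^ m = |a| ^ m * (1 + x) ^ m := by
      rw [← Real.mul_rpow (abs_nonneg a) h1x, hb, ← abs_of_nonneg h1x, ← abs_mul]
      congr 2
      ring
    have h3 := rpow_sub_two_mul_sq (abs_nonneg a) hm
    rw [sq_abs] at h3
    have h4 : |a| ^ m * (1 + x) ^ m ≤ |a| ^ m * (1 + m * x + m ^ 2 * Real.exp m * x ^ 2) := by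
      gcongr
    have h5 : |a| ^ m * (1 + m * x + m ^ 2 * Real.exp m * x ^ 2) = |a| ^ m
        + m * (|a| ^ (m - 2) * a) * b + m ^ 2 * Real.exp m * (|a| ^ (m - 2) * b ^ 2) := by
      rw [← h3, hb]; ring
    have k7 := mul_nonneg (add_nonneg k4 k5) k1
    have k8 := mul_nonneg (add_nonneg (add_nonneg k4 k5) k6) k2
    rw [h2]
    linarith

/-- Splitting at `|X| = V`: beyond it `X² ≤ V^(2-m)|X|^m`. This yields integrability along with the
bound. -/
theorem integral_sq_le_of_integral_rpow_le {Ω : Type*} [MeasurableSpace Ω] {μ : Measure Ω}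
    [IsProbabilityMeasure μ] {m V : ℝ} (hm : 2 ≤ m) (hV : 0 < V) {X : Ω → ℝ} (hX : Measurable X)
    (hi : Integrable (fun ω => |X ω| ^ m) μ) (hle : ∫ ω, |X ω| ^ m ∂μ ≤ V ^ m) :
    Integrable (fun ω => X ω ^ 2) μ ∧ ∫ ω, X ω ^ 2 ∂μ ≤ 2 * V ^ 2 := by
  have hpt : ∀ ω, X ω ^ 2 ≤ V ^ 2 + V ^ (2 - m) * |X ω| ^ m := by
    intro ω
    rcases le_or_gt |X ω| V with h | h
    · have : X ω ^ 2 ≤ V ^ 2 := by rw [← sq_abs]; gcongr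
      have : 0 ≤ V ^ (2 - m) * |X ω| ^ m := by positivity
      linarith
    · have hx : 0 < |X ω| := hV.trans h
      have h1 : |X ω| ^ (2 - m) ≤ V ^ (2 - m) :=
        Real.rpow_le_rpow_of_nonpos hV h.le (by linarith)
      have h2 : X ω ^ 2 = |X ω| ^ (2 - m) * |X ω| ^ m := by
        rw [← Real.rpow_add hx, sub_add_cancel, Real.rpow_two, sq_abs]
      rw [h2]
      have : |X ω| ^ (2 - m) * |X ω| ^ m ≤ V ^ (2 - m) * |X ω| ^ m := by gcongr
      have := sq_nonneg V
      linarith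
  have hib : Integrable (fun ω => V ^ 2 + V ^ (2 - m) * |X ω| ^ m) μ :=
    (integrable_const _).add (hi.const_mul _)
  have hi2 : Integrable (fun ω => X ω ^ 2) μ := by
    refine hib.mono' (hX.pow_const 2).aestronglyMeasurable (Eventually.of_forall fun ω => ?_)
    rw [Real.norm_eq_abs, abs_of_nonneg (sq_nonneg _)]
    exact hpt ω
  refine ⟨hi2, (integral_mono hi2 hib hpt).trans ?_⟩
  rw [integral_add (integrable_const _) (hi.const_mul _), integral_const_mul]
  have h1 : V ^ (2 - m) * ∫ ω, |X ω| ^ m ∂μ ≤ V ^ (2 - m) * V ^ m := by gcongr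
  rw [← Real.rpow_add hV, sub_add_cancel, Real.rpow_two] at h1
  simp only [integral_const, probReal_univ, smul_eq_mul, one_mul]
  linarith

theorem lintegral_abs_add_rpow_le {Ω : Type*} [MeasurableSpace Ω] {μ : Measure Ω}
    [IsProbabilityMeasure μ] {m V K : ℝ} (hm : 2 ≤ m) (hV : 0 < V) (hK : 0 < K)
    (hpt : ∀ a b : ℝ, |a + b| ^ m ≤ |a| ^ m + m * (|a| ^ (m - 2) * a) * b
      + K * (|a| ^ (m - 2) * b ^ 2 + |b| ^ m))
    {X : Ω → ℝ} (hX : Measurable X)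
    (hi : Integrable (fun ω => |X ω| ^ m) μ) (hle : ∫ ω, |X ω| ^ m ∂μ ≤ V ^ m)
    (h0 : ∫ ω, X ω ∂μ = 0) (s : ℝ) :
    ∫⁻ ω, ENNReal.ofReal (|s + X ω| ^ m) ∂μ
      ≤ ENNReal.ofReal (|s| ^ m + K * (2 * V ^ 2 * |s| ^ (m - 2) + V ^ m)) := by
  obtain ⟨hi2, hle2⟩ := integral_sq_le_of_integral_rpow_le hm hV hX hi hle
  have hi1 : Integrable X μ :=
    ((memLp_two_iff_integrable_sq hX.aestronglyMeasurable).2 hi2).integrable (by norm_num)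
  have j1 : Integrable (fun ω => |s| ^ m + m * (|s| ^ (m - 2) * s) * X ω) μ :=
    (integrable_const _).add (hi1.const_mul _)
  have j2 : Integrable (fun ω => |s| ^ (m - 2) * X ω ^ 2 + |X ω| ^ m) μ :=
    (hi2.const_mul _).add hi
  have j : Integrable (fun ω => |s| ^ m + m * (|s| ^ (m - 2) * s) * X ω
      + K * (|s| ^ (m - 2) * X ω ^ 2 + |X ω| ^ m)) μ := j1.add (j2.const_mul K)
  calc ∫⁻ ω, ENNReal.ofReal (|s + X ω| ^ m) ∂μ
      ≤ ∫⁻ ω, ENNReal.ofReal (|s| ^ m + m * (|s| ^ (m - 2) * s) * X ω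
        + K * (|s| ^ (m - 2) * X ω ^ 2 + |X ω| ^ m)) ∂μ :=
        lintegral_mono fun ω => ENNReal.ofReal_le_ofReal (hpt s (X ω))
    _ = ENNReal.ofReal (∫ ω, (|s| ^ m + m * (|s| ^ (m - 2) * s) * X ω
        + K * (|s| ^ (m - 2) * X ω ^ 2 + |X ω| ^ m)) ∂μ) := by
        rw [ofReal_integral_eq_lintegral_ofReal j]
        exact Eventually.of_forall fun ω => (Real.rpow_nonneg (abs_nonneg _) m).trans (hpt s (X ω))
    _ ≤ _ := by
        refine ENNReal.ofReal_le_ofReal ?_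
        rw [integral_add j1 (j2.const_mul K), integral_add (integrable_const _) (hi1.const_mul _),
          integral_const_mul, integral_const_mul, integral_add (hi2.const_mul _) hi,
          integral_const_mul, h0]
        simp only [integral_const, probReal_univ, smul_eq_mul, one_mul, mul_zero, add_zero]
        have h1 : |s| ^ (m - 2) * ∫ ω, X ω ^ 2 ∂μ ≤ |s| ^ (m - 2) * (2 * V ^ 2) := by gcongr
        have h2 : K * (|s| ^ (m - 2) * ∫ ω, X ω ^ 2 ∂μ + ∫ ω, |X ω| ^ m ∂μ)
          ≤ K * (|s| ^ (m - 2) * (2 * V ^ 2) + V ^ m) := by gcongr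
        linarith

/-- Marcinkiewicz–Zygmund inequality for centred i.i.d. sums, in the form
`E|∑ X_i|^m ≤ A n^{m/2} V^m` for `m ≥ 2` and `E|X|^m ≤ V^m`. -/
theorem exists_lintegral_abs_sum_rpow_le {m : ℝ} (hm : 2 ≤ m) :
    ∃ A, 0 < A ∧ ∀ {Ω : Type*} [MeasurableSpace Ω] (μ : Measure Ω) [IsProbabilityMeasure μ]
      (V : ℝ) (X : Ω → ℝ), 0 < V → Measurable X → Integrable (fun ω => |X ω| ^ m) μ →
      ∫ ω, |X ω| ^ m ∂μ ≤ V ^ m → ∫ ω, X ω ∂μ = 0 → ∀ n : ℕ,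
      ∫⁻ Y : Fin n → Ω, ENNReal.ofReal (|∑ i, X (Y i)| ^ m) ∂(Measure.pi fun _ => μ)
        ≤ ENNReal.ofReal (A * (n : ℝ) ^ (m / 2) * V ^ m) := by
  obtain ⟨K, hK, hpt⟩ := exists_abs_add_rpow_le hm
  have hm0 : 0 < m := by linarith
  set A := 2 * (2 * K * (4 * K) ^ ((m - 2) / 2) + K) with hA
  have hA0 : 0 < A := by positivity
  refine ⟨A, hA0, ?_⟩
  intro Ω _ μ _ V X hV hX hi hle h0 n
  induction n with
  | zero => simp [Real.zero_rpow hm0.ne']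
  | succ k ih =>
    set N : ℝ := (k : ℝ) + 1 with hN
    have hN1 : 1 ≤ N := by rw [hN]; linarith [(Nat.cast_nonneg k : (0 : ℝ) ≤ k)]
    have hk0 : (0 : ℝ) ≤ k := Nat.cast_nonneg k
    set W := N ^ (m / 2 - 1) with hW
    have hW1 : 1 ≤ W := Real.one_le_rpow hN1 (by linarith)
    have hVm : 0 < V ^ m := by positivity
    -- The intermediate power obeys `|s|^(m-2) ≤ |s|^m/z² + z^(m-2)`. The choice `z² = 4KNV²` makes
    -- the coefficient of `|s|^m` grow only by `1/(2N)`, and `A/2` is precisely the constant of the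
    -- additive term.
    have step : ∀ s : ℝ, |s| ^ m + K * (2 * V ^ 2 * |s| ^ (m - 2) + V ^ m)
        ≤ (1 + 1 / (2 * N)) * |s| ^ m + A / 2 * W * V ^ m := by
      intro s
      set z := (4 * K * N) ^ (1 / 2 : ℝ) * V with hz
      have hz0 : 0 < z := by positivity
      have hz2 : z ^ 2 = 4 * K * N * V ^ 2 := by
        rw [hz, mul_pow, ← Real.rpow_two, ← Real.rpow_mul (by positivity)]
        norm_num
      have hzm : z ^ (m - 2) * V ^ 2 = (4 * K) ^ ((m - 2) / 2) * W * V ^ m := by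
        rw [hz, Real.mul_rpow (by positivity) hV.le, ← Real.rpow_mul (by positivity), mul_assoc,
          rpow_sub_two_mul_sq hV.le hm, Real.mul_rpow (by positivity) (by positivity), hW]
        congr 3 <;> ring
      have h1 : |s| ^ (m - 2) ≤ |s| ^ m / z ^ 2 + z ^ (m - 2) := by
        rcases le_or_gt |s| z with h | h
        · have : |s| ^ (m - 2) ≤ z ^ (m - 2) :=
            Real.rpow_le_rpow (abs_nonneg _) h (by linarith)
          have : 0 ≤ |s| ^ m / z ^ 2 := by positivity
          linarith
        · have : |s| ^ (m - 2) ≤ |s| ^ m / z ^ 2 := by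
            rw [le_div_iff₀ (by positivity), ← rpow_sub_two_mul_sq (abs_nonneg s) hm]
            gcongr
          have : 0 ≤ z ^ (m - 2) := by positivity
          linarith
      have h2 : K * (2 * V ^ 2 * |s| ^ (m - 2)) ≤ K * (2 * V ^ 2 * (|s| ^ m / z ^ 2 + z ^ (m - 2))) := by
        gcongr
      have h3 : K * (2 * V ^ 2 * (|s| ^ m / z ^ 2 + z ^ (m - 2)))
          = 1 / (2 * N) * |s| ^ m + 2 * K * (z ^ (m - 2) * V ^ 2) := by
        rw [hz2]; field_simp; ring
      rw [hzm] at h3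
      have h4 : K * V ^ m * 1 ≤ K * V ^ m * W := by gcongr
      rw [hA]
      linarith
    have hmeas : Measurable fun p : Ω × (Fin k → Ω) =>
        ENNReal.ofReal (|(∑ i, X (p.2 i)) + X p.1| ^ m) := by
      refine Measurable.ennreal_ofReal (Measurable.pow_const ?_ _)
      refine Measurable.norm (Measurable.add ?_ (hX.comp measurable_fst))
      exact Finset.measurable_sum _ fun i _ => hX.comp ((measurable_pi_apply i).comp measurable_snd)
    have hsplit : ∫⁻ Y : Fin (k + 1) → Ω, ENNReal.ofReal (|∑ i, X (Y i)| ^ m)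
          ∂(Measure.pi fun _ => μ)
        = ∫⁻ Y : Fin k → Ω, ∫⁻ ω, ENNReal.ofReal (|(∑ i, X (Y i)) + X ω| ^ m) ∂μ
          ∂(Measure.pi fun _ => μ) := by
      have hmp := measurePreserving_piFinSuccAbove (fun _ : Fin (k + 1) => μ) 0
      rw [← lintegral_prod_symm _ hmeas.aemeasurable, ← hmp.lintegral_comp hmeas]
      refine lintegral_congr fun Y => ?_
      rw [Fin.sum_univ_succ, add_comm]
      rfl
    rw [hsplit]
    calc ∫⁻ Y : Fin k → Ω, ∫⁻ ω, ENNReal.ofReal (|(∑ i, X (Y i)) + X ω| ^ m) ∂μ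
          ∂(Measure.pi fun _ => μ)
        ≤ ∫⁻ Y : Fin k → Ω, (ENNReal.ofReal (1 + 1 / (2 * N))
          * ENNReal.ofReal (|∑ i, X (Y i)| ^ m) + ENNReal.ofReal (A / 2 * W * V ^ m))
          ∂(Measure.pi fun _ => μ) := by
          refine lintegral_mono fun Y => ?_
          refine (lintegral_abs_add_rpow_le hm hV hK hpt hX hi hle h0 _).trans ?_
          rw [← ENNReal.ofReal_mul (by positivity), ← ENNReal.ofReal_add (by positivity)
            (by positivity)]
          exact ENNReal.ofReal_le_ofReal (step _)
      _ = ENNReal.ofReal (1 + 1 / (2 * N)) * ∫⁻ Y : Fin k → Ω,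
          ENNReal.ofReal (|∑ i, X (Y i)| ^ m) ∂(Measure.pi fun _ => μ)
          + ENNReal.ofReal (A / 2 * W * V ^ m) := by
          rw [lintegral_add_right _ measurable_const,
            lintegral_const_mul' _ _ ENNReal.ofReal_ne_top]
          simp
      _ ≤ ENNReal.ofReal (1 + 1 / (2 * N)) * ENNReal.ofReal (A * (k : ℝ) ^ (m / 2) * V ^ m)
          + ENNReal.ofReal (A / 2 * W * V ^ m) := by gcongr
      _ ≤ _ := by
          rw [← ENNReal.ofReal_mul (by positivity), ← ENNReal.ofReal_add (by positivity)
            (by positivity)]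
          refine ENNReal.ofReal_le_ofReal ?_
          push_cast
          rw [← hN]
          have h1 : (k : ℝ) ^ (m / 2) ≤ k * W := by
            have : (k : ℝ) ^ (m / 2) = k * (k : ℝ) ^ (m / 2 - 1) := by
              conv_rhs => rw [← Real.rpow_one (k : ℝ)]
              rw [Real.rpow_one, ← Real.rpow_one_add' hk0 (by linarith)]
              congr 1; ring
            rw [this, hW]
            have : (k : ℝ) ^ (m / 2 - 1) ≤ N ^ (m / 2 - 1) :=
              Real.rpow_le_rpow hk0 (by rw [hN]; linarith) (by linarith)
            gcongr
          have h2 : N ^ (m / 2) = N * W := by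
            rw [hW, ← Real.rpow_one_add' (by linarith) (by linarith)]
            congr 1; ring
          have h3 : 1 / (2 * N) * k ≤ 1 / 2 := by
            rw [div_mul_eq_mul_div, one_mul, div_le_div_iff₀ (by positivity) (by norm_num)]
            linarith
          rw [h2]
          -- The induction closes because `k/(2N) ≤ 1/2`, and this together with the additive `1/2`
          -- raises `k` to at most `N = k + 1`.
          calc (1 + 1 / (2 * N)) * (A * (k : ℝ) ^ (m / 2) * V ^ m) + A / 2 * W * V ^ m
              ≤ (1 + 1 / (2 * N)) * (A * (k * W) * V ^ m) + A / 2 * W * V ^ m := by gcongr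
            _ = A * W * V ^ m * (k + 1 / (2 * N) * k + 1 / 2) := by ring
            _ ≤ A * W * V ^ m * (k + 1 / 2 + 1 / 2) := by gcongr
            _ = _ := by rw [hN]; ring

/-- Product of measures with a common density. -/
theorem pi_withDensity_eq {S : Type*} [MeasurableSpace S] (μ : Measure S) [IsProbabilityMeasure μ]
    (n : ℕ) {ρ : S → ℝ≥0∞} (hρ : Measurable ρ) [SigmaFinite (μ.withDensity ρ)] :
    (Measure.pi fun _ : Fin n => μ.withDensity ρ)
      = (Measure.pi fun _ : Fin n => μ).withDensity fun X => ∏ i, ρ (X i) := by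
  refine Measure.pi_eq fun s hs => ?_
  rw [withDensity_apply _ (MeasurableSet.univ_pi hs), ← lintegral_indicator (MeasurableSet.univ_pi hs)]
  have h : ∀ X : Fin n → S, (Set.univ.pi s).indicator (fun X => ∏ i, ρ (X i)) X
      = ∏ i, (s i).indicator ρ (X i) := by
    intro X
    by_cases hX : X ∈ Set.univ.pi s
    · rw [Set.indicator_of_mem hX]
      exact Finset.prod_congr rfl fun i _ => (Set.indicator_of_mem (hX i trivial) _).symm
    · rw [Set.indicator_of_notMem hX]
      obtain ⟨i, hi⟩ : ∃ i, X i ∉ s i := by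
        by_contra hcon
        push Not at hcon
        exact hX fun i _ => hcon i
      exact (Finset.prod_eq_zero (Finset.mem_univ i) (Set.indicator_of_notMem hi _)).symm
  simp_rw [h]
  rw [lintegral_pi_prod μ fun i => hρ.indicator (hs i)]
  refine Finset.prod_congr rfl fun i _ => ?_
  rw [lintegral_indicator (hs i), withDensity_apply _ (hs i)]


/-! ### Paths of densities and the m-th root of the likelihood -/

/-- Fundamental theorem of calculus, then monotonicity of `L^p` norms on the unit interval. If the
right-hand side is infinite there is nothing to prove; otherwise it supplies the integrability of
the derivative. -/
theorem abs_sub_rpow_le_lintegral_deriv {m : ℝ} (hm : 1 ≤ m) {y y' : ℝ → ℝ}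
    (hcont : ContinuousOn y (Set.Icc 0 1)) (hd : ∀ t ∈ Set.Ioo (0 : ℝ) 1, HasDerivAt y (y' t) t)
    (hy' : Measurable y') :
    ENNReal.ofReal (|y 1 - y 0| ^ m)
      ≤ ∫⁻ t in Set.Ioc (0 : ℝ) 1, ENNReal.ofReal (|y' t| ^ m) := by
  have hm0 : 0 < m := by linarith
  set I : Measure ℝ := volume.restrict (Set.Ioc (0 : ℝ) 1) with hI
  have hprob : IsProbabilityMeasure I := ⟨by simp [hI]⟩
  have hnorm : eLpNorm y' (ENNReal.ofReal m) I
      = (∫⁻ t, ENNReal.ofReal (|y' t| ^ m) ∂I) ^ (1 / m) := by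
    rw [eLpNorm_eq_lintegral_rpow_enorm_toReal (by simpa using hm0) ENNReal.ofReal_ne_top,
      ENNReal.toReal_ofReal hm0.le]
    congr 1
    refine lintegral_congr fun t => ?_
    rw [← ofReal_norm, Real.norm_eq_abs, ENNReal.ofReal_rpow_of_nonneg (abs_nonneg _) hm0.le]
  by_cases htop : ∫⁻ t, ENNReal.ofReal (|y' t| ^ m) ∂I = ⊤
  · rw [htop]; exact le_top
  have h1 : eLpNorm y' 1 I ≤ (∫⁻ t, ENNReal.ofReal (|y' t| ^ m) ∂I) ^ (1 / m) := by
    rw [← hnorm]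
    refine eLpNorm_le_eLpNorm_of_exponent_le ?_ hy'.aestronglyMeasurable
    rw [← ENNReal.ofReal_one]
    exact ENNReal.ofReal_le_ofReal hm
  have hint : Integrable y' I := by
    rw [← memLp_one_iff_integrable]
    exact ⟨hy'.aestronglyMeasurable,
      h1.trans_lt (ENNReal.rpow_lt_top_of_nonneg (by positivity) htop)⟩
  have hftc := intervalIntegral.integral_eq_sub_of_hasDerivAt_of_le zero_le_one hcont hd
    ((intervalIntegrable_iff_integrableOn_Ioc_of_le zero_le_one).2 hint)
  rw [intervalIntegral.integral_of_le zero_le_one] at hftc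
  have h2 : ENNReal.ofReal |y 1 - y 0| ≤ eLpNorm y' 1 I := by
    rw [← hftc, ← Real.norm_eq_abs, ofReal_norm, eLpNorm_one_eq_lintegral_enorm]
    exact enorm_integral_le_lintegral_enorm _
  rw [← ENNReal.ofReal_rpow_of_nonneg (abs_nonneg _) hm0.le]
  calc ENNReal.ofReal |y 1 - y 0| ^ m
      ≤ ((∫⁻ t, ENNReal.ofReal (|y' t| ^ m) ∂I) ^ (1 / m)) ^ m := by
        gcongr; exact h2.trans h1
    _ = _ := by rw [← ENNReal.rpow_mul, one_div, inv_mul_cancel₀ hm0.ne', ENNReal.rpow_one]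

/-- A differentiable path `r t`, `t ∈ [0, 1]`, of positive probability densities with respect to
`μ`, with `m`-th absolute moments of the score bounded by `V ^ m`. -/
structure DensityPath {S : Type*} [MeasurableSpace S] (μ : Measure S) (r r' : ℝ → S → ℝ)
    (m V : ℝ) : Prop where
  meas : ∀ t ∈ Set.Icc (0 : ℝ) 1, Measurable (r t)
  pos : ∀ t ∈ Set.Icc (0 : ℝ) 1, ∀ x, 0 < r t x
  mass : ∀ t ∈ Set.Icc (0 : ℝ) 1, ∫⁻ x, ENNReal.ofReal (r t x) ∂μ = 1
  deriv : ∀ t ∈ Set.Icc (0 : ℝ) 1, ∀ x, HasDerivAt (fun s => r s x) (r' t x) t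
  moment : ∀ t ∈ Set.Icc (0 : ℝ) 1,
    ∫⁻ x, ENNReal.ofReal ((|r' t x| / r t x) ^ m * r t x) ∂μ ≤ ENNReal.ofReal (V ^ m)

/-- The path frozen outside `[0, 1]`. -/
def clampPath {S : Type*} (r : ℝ → S → ℝ) (t : ℝ) (x : S) : ℝ := r (max 0 (min t 1)) x

/-- The derivative of the frozen path from the right. -/
def clampDeriv {S : Type*} (r' : ℝ → S → ℝ) (t : ℝ) (x : S) : ℝ :=
  (Set.Ico (0 : ℝ) 1).indicator (fun t => r' t x) t

theorem clamp_mem (t : ℝ) : max 0 (min t 1) ∈ Set.Icc (0 : ℝ) 1 :=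
  ⟨le_max_left _ _, max_le zero_le_one (min_le_right _ _)⟩

theorem clampPath_of_mem {S : Type*} (r : ℝ → S → ℝ) {t : ℝ} (ht : t ∈ Set.Icc (0 : ℝ) 1) (x : S) :
    clampPath r t x = r t x := by
  rw [clampPath, min_eq_left ht.2, max_eq_right ht.1]

namespace DensityPath

variable {S : Type*} [MeasurableSpace S] {μ : Measure S} {r r' : ℝ → S → ℝ} {m V : ℝ}

/-- Freezing the path outside `[0, 1]` makes it continuous in `t` on the whole line; being
measurable in `x`, it is jointly measurable. -/
theorem measurable_clampPath (h : DensityPath μ r r' m V) :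
    Measurable (Function.uncurry (clampPath r)) := by
  refine measurable_uncurry_of_continuous_of_measurable (u := clampPath r) (fun x => ?_)
    (fun t => h.meas _ (clamp_mem t))
  rw [continuous_iff_continuousAt]
  intro t
  have h1 : ContinuousAt (fun s => r s x) (max 0 (min t 1)) :=
    (h.deriv _ (clamp_mem t) x).continuousAt
  have h2 : ContinuousAt (fun t : ℝ => max 0 (min t 1)) t :=
    (continuous_const.max (continuous_id.min continuous_const)).continuousAt
  exact ContinuousAt.comp (f := fun t : ℝ => max 0 (min t 1)) (g := fun s => r s x) h1 h2

/-- Pointwise limit of right difference quotients of the frozen path. At `t = 1` these vanish, which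
is why the derivative is cut off to `[0, 1)`. -/
theorem measurable_clampDeriv (h : DensityPath μ r r' m V) :
    Measurable (Function.uncurry (clampDeriv r')) := by
  have hlim : Tendsto (fun n : ℕ => (1 : ℝ) / ((n : ℝ) + 1)) atTop (𝓝[>] 0) :=
    tendsto_nhdsWithin_iff.2 ⟨tendsto_one_div_add_atTop_nhds_zero_nat,
      Eventually.of_forall fun n => by
        show (0 : ℝ) < _
        positivity⟩
  have hlim0 := tendsto_nhdsWithin_iff.1 hlim |>.1
  refine measurable_of_tendsto_metrizable
    (f := fun (n : ℕ) (p : ℝ × S) => ((1 : ℝ) / ((n : ℝ) + 1))⁻¹ *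
      (clampPath r (p.1 + 1 / ((n : ℝ) + 1)) p.2 - clampPath r p.1 p.2)) (fun n => ?_) ?_
  · refine measurable_const.mul (Measurable.sub ?_ h.measurable_clampPath)
    exact h.measurable_clampPath.comp ((measurable_fst.add_const _).prodMk measurable_snd)
  · rw [tendsto_pi_nhds]
    rintro ⟨t, x⟩
    simp only [Function.uncurry_apply_pair]
    rcases lt_or_ge t 0 with ht | ht
    · have h0 : clampDeriv r' t x = 0 :=
        Set.indicator_of_notMem (fun hmem => absurd hmem.1 (not_le.2 ht)) _
      rw [h0]
      refine tendsto_const_nhds.congr' ?_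
      filter_upwards [hlim0.eventually (gt_mem_nhds (show 0 < -t by linarith))] with n hn
      rw [clampPath, clampPath, max_eq_left ((min_le_left _ _).trans (by linarith)),
        max_eq_left ((min_le_left _ _).trans (by linarith)), sub_self, mul_zero]
    rcases lt_or_ge t 1 with ht1 | ht1
    · have h0 : clampDeriv r' t x = r' t x := Set.indicator_of_mem (show t ∈ Set.Ico 0 1 from ⟨ht, ht1⟩) _
      rw [h0]
      refine ((h.deriv t ⟨ht, ht1.le⟩ x).tendsto_slope_zero_right.comp hlim).congr' ?_
      filter_upwards [hlim0.eventually (gt_mem_nhds (show 0 < 1 - t by linarith))] with n hn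
      have hn0 : (0 : ℝ) < 1 / ((n : ℝ) + 1) := by positivity
      rw [clampPath_of_mem r ⟨ht, ht1.le⟩, clampPath_of_mem r ⟨by linarith, by linarith⟩]
      rfl
    · have h0 : clampDeriv r' t x = 0 :=
        Set.indicator_of_notMem (fun hmem => absurd hmem.2 (not_lt.2 ht1)) _
      rw [h0]
      refine tendsto_const_nhds.congr fun n => ?_
      have hn0 : (0 : ℝ) < 1 / ((n : ℝ) + 1) := by positivity
      rw [clampPath, clampPath, min_eq_right ht1, min_eq_right (by linarith), sub_self, mul_zero]

/-- With `l = |r'|/r`, `|r'| = l r ≤ (1 + l^m) r`. The bound is uniform in `t` and yields the joint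
integrability needed for Fubini. -/
theorem lintegral_enorm_clampDeriv_le (h : DensityPath μ r r' m V) (hm : 1 ≤ m) (t : ℝ) :
    ∫⁻ x, ‖clampDeriv r' t x‖ₑ ∂μ ≤ 1 + ENNReal.ofReal (V ^ m) := by
  by_cases ht : t ∈ Set.Ico (0 : ℝ) 1
  · have ht' : t ∈ Set.Icc (0 : ℝ) 1 := ⟨ht.1, ht.2.le⟩
    rw [← h.mass t ht']
    refine le_trans ?_ (add_le_add_right (h.moment t ht') _)
    rw [← lintegral_add_left (h.meas t ht').ennreal_ofReal]
    refine lintegral_mono fun x => ?_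
    have hpos := h.pos t ht' x
    rw [clampDeriv, Set.indicator_of_mem ht, ← ofReal_norm, Real.norm_eq_abs,
      ← ENNReal.ofReal_add hpos.le (by positivity)]
    refine ENNReal.ofReal_le_ofReal ?_
    obtain ⟨l, hl⟩ : ∃ l, l = |r' t x| / r t x := ⟨_, rfl⟩
    have hl0 : 0 ≤ l := by rw [hl]; positivity
    have h1 : |r' t x| = l * r t x := by rw [hl]; field_simp
    rw [← hl, h1]
    have h2 : l ≤ 1 + l ^ m := by
      rcases le_total l 1 with h1 | h1
      · have : 0 ≤ l ^ m := by positivity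
        linarith
      · have : l ^ (1 : ℝ) ≤ l ^ m := Real.rpow_le_rpow_of_exponent_le h1 hm
        rw [Real.rpow_one] at this
        linarith
    nlinarith
  · simp [clampDeriv, Set.indicator_of_notMem ht]

theorem integrable_uncurry_clampDeriv [IsProbabilityMeasure μ] (h : DensityPath μ r r' m V)
    (hm : 1 ≤ m) {s : Set ℝ} (hs : volume s ≠ ⊤) :
    Integrable (Function.uncurry (clampDeriv r')) ((volume.restrict s).prod μ) := by
  refine ⟨h.measurable_clampDeriv.aestronglyMeasurable, ?_⟩
  rw [hasFiniteIntegral_iff_enorm, lintegral_prod _ h.measurable_clampDeriv.enorm.aemeasurable]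
  calc ∫⁻ t in s, ∫⁻ x, ‖clampDeriv r' t x‖ₑ ∂μ
      ≤ ∫⁻ _ in s, (1 + ENNReal.ofReal (V ^ m)) :=
        lintegral_mono fun t => h.lintegral_enorm_clampDeriv_le hm t
    _ < ⊤ := by
      rw [setLIntegral_const]
      exact ENNReal.mul_lt_top (by simp) hs.lt_top

theorem integrable_path (h : DensityPath μ r r' m V) {t : ℝ}
    (ht : t ∈ Set.Icc (0 : ℝ) 1) : Integrable (r t) μ := by
  refine ⟨(h.meas t ht).aestronglyMeasurable, ?_⟩
  rw [hasFiniteIntegral_iff_ofReal (Eventually.of_forall fun x => (h.pos t ht x).le), h.mass t ht]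
  exact ENNReal.one_lt_top

theorem integral_path (h : DensityPath μ r r' m V) {t : ℝ}
    (ht : t ∈ Set.Icc (0 : ℝ) 1) : ∫ x, r t x ∂μ = 1 := by
  rw [integral_eq_lintegral_of_nonneg_ae (Eventually.of_forall fun x => (h.pos t ht x).le)
    (h.meas t ht).aestronglyMeasurable, h.mass t ht, ENNReal.toReal_one]

/-- The score is centred at almost every point of the path. -/
theorem ae_integral_clampDeriv_eq_zero [IsProbabilityMeasure μ] (h : DensityPath μ r r' m V)
    (hm : 1 ≤ m) : ∀ᵐ t : ℝ, t ∈ Set.Ioo (0 : ℝ) 1 → ∫ x, clampDeriv r' t x ∂μ = 0 := by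
  have hI := h.integrable_uncurry_clampDeriv hm (s := Set.Ioc (0 : ℝ) 1) (by simp)
  -- By Fubini the integrated mean of the derivative is the change of total mass, which is zero;
  -- Lebesgue differentiation then gives the claim for almost every `t`.
  have hzero : ∀ τ ∈ Set.Icc (0 : ℝ) 1, ∫ t in (0 : ℝ)..τ, ∫ x, clampDeriv r' t x ∂μ = 0 := by
    intro τ hτ
    have hIτ := h.integrable_uncurry_clampDeriv hm (s := Set.uIoc (0 : ℝ) τ) (by simp [Set.uIoc])
    rw [intervalIntegral_integral_swap hIτ]
    have hae : ∀ᵐ x ∂μ, ∫ t in (0 : ℝ)..τ, clampDeriv r' t x = r τ x - r 0 x := by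
      filter_upwards [hIτ.prod_left_ae] with x hx
      refine intervalIntegral.integral_eq_sub_of_hasDerivAt_of_le (f := fun t => r t x) hτ.1
        ?_ ?_ ?_
      · exact fun t ht => (h.deriv t ⟨ht.1, ht.2.trans hτ.2⟩ x).continuousAt.continuousWithinAt
      · intro t ht
        have ht1 : t < 1 := ht.2.trans_le hτ.2
        have := h.deriv t ⟨ht.1.le, ht1.le⟩ x
        rwa [clampDeriv, Set.indicator_of_mem (show t ∈ Set.Ico (0 : ℝ) 1 from ⟨ht.1.le, ht1⟩)]
      · rw [intervalIntegrable_iff]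
        exact hx
    rw [integral_congr_ae hae, integral_sub (h.integrable_path hτ)
      (h.integrable_path ⟨le_rfl, zero_le_one⟩), h.integral_path hτ,
      h.integral_path ⟨le_rfl, zero_le_one⟩, sub_self]
  have hH : IntervalIntegrable (fun t => ∫ x, clampDeriv r' t x ∂μ) volume 0 1 := by
    rw [intervalIntegrable_iff_integrableOn_Ioc_of_le zero_le_one]
    exact hI.integral_prod_left
  filter_upwards [hH.ae_hasDerivAt_integral] with t ht hmem
  have ht01 : t ∈ Set.uIcc (0 : ℝ) 1 := by
    rw [Set.uIcc_of_le zero_le_one]; exact ⟨hmem.1.le, hmem.2.le⟩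
  have hd := ht ht01 0 (by simp)
  have hd0 : HasDerivAt (fun b => ∫ t in (0 : ℝ)..b, ∫ x, clampDeriv r' t x ∂μ) 0 t := by
    refine (hasDerivAt_const t (0 : ℝ)).congr_of_eventuallyEq ?_
    filter_upwards [isOpen_Ioo.mem_nhds hmem] with b hb
    exact hzero b ⟨hb.1.le, hb.2.le⟩
  exact hd.unique hd0

end DensityPath

/-- Moment bound for the increments of the `m`-th root of the likelihood along a path of
densities. -/
theorem exists_likelihood_root_increment_le {m : ℝ} (hm : 2 ≤ m) :
    ∃ A, 0 < A ∧ ∀ {S : Type*} [MeasurableSpace S] (μ : Measure S) [IsProbabilityMeasure μ]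
      (r r' : ℝ → S → ℝ) (V : ℝ), 0 < V → DensityPath μ r r' m V → ∀ n : ℕ,
      ∫⁻ X : Fin n → S, ENNReal.ofReal (|Real.exp (1 / m * ∑ i, Real.log (r 1 (X i)))
          - Real.exp (1 / m * ∑ i, Real.log (r 0 (X i)))| ^ m) ∂(Measure.pi fun _ => μ)
        ≤ ENNReal.ofReal (A * (n : ℝ) ^ (m / 2) * V ^ m) := by
  obtain ⟨A, hA, hMZ⟩ := exists_lintegral_abs_sum_rpow_le hm
  have hm0 : 0 < m := by linarith
  refine ⟨A, hA, ?_⟩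
  intro S _ μ _ r r' V hV h n
  -- `l` is the score and `y` the root of the likelihood, with derivative `y` times `1/m` times the
  -- score sum.
  set l : ℝ → S → ℝ := fun t x => clampDeriv r' t x / clampPath r t x with hl
  have ml : Measurable (Function.uncurry l) := h.measurable_clampDeriv.div h.measurable_clampPath
  set y : ℝ → (Fin n → S) → ℝ := fun t X => Real.exp (1 / m * ∑ i, Real.log (clampPath r t (X i)))
    with hy
  set y' : ℝ → (Fin n → S) → ℝ := fun t X => y t X * (1 / m * ∑ i, l t (X i)) with hy'
  have mcomp : ∀ i : Fin n, Measurable fun p : ℝ × (Fin n → S) => (p.1, p.2 i) := fun i =>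
    measurable_fst.prodMk ((measurable_pi_apply i).comp measurable_snd)
  have my : Measurable (Function.uncurry y) :=
    ((Finset.measurable_sum _ fun i _ =>
      (h.measurable_clampPath.comp (mcomp i)).log).const_mul (1 / m)).exp
  have my' : Measurable (Function.uncurry y') :=
    my.mul ((Finset.measurable_sum _ fun i _ => ml.comp (mcomp i)).const_mul (1 / m))
  have hpt : ∀ X : Fin n → S, ENNReal.ofReal (|Real.exp (1 / m * ∑ i, Real.log (r 1 (X i)))
          - Real.exp (1 / m * ∑ i, Real.log (r 0 (X i)))| ^ m)
      ≤ ∫⁻ t in Set.Ioc (0 : ℝ) 1, ENNReal.ofReal (|y' t X| ^ m) := by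
    intro X
    have hd : ∀ t ∈ Set.Icc (0 : ℝ) 1, HasDerivAt
        (fun t => Real.exp (1 / m * ∑ i, Real.log (r t (X i))))
        (Real.exp (1 / m * ∑ i, Real.log (r t (X i)))
          * (1 / m * ∑ i, r' t (X i) / r t (X i))) t := fun t ht =>
      ((HasDerivAt.fun_sum fun i _ =>
        (h.deriv t ht (X i)).log (h.pos t ht (X i)).ne').const_mul (1 / m)).exp
    refine abs_sub_rpow_le_lintegral_deriv (by linarith)
      (y := fun t => Real.exp (1 / m * ∑ i, Real.log (r t (X i)))) (y' := fun t => y' t X)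
      (fun t ht => (hd t ht).continuousAt.continuousWithinAt) (fun t ht => ?_)
      (my'.comp (measurable_id.prodMk measurable_const))
    have ht' : t ∈ Set.Icc (0 : ℝ) 1 := ⟨ht.1.le, ht.2.le⟩
    have hico : t ∈ Set.Ico (0 : ℝ) 1 := ⟨ht.1.le, ht.2⟩
    convert hd t ht' using 1
    simp only [hy', hy, hl, clampPath_of_mem r ht', clampDeriv, Set.indicator_of_mem hico]
  have hmy' : Measurable fun p : (Fin n → S) × ℝ => ENNReal.ofReal (|y' p.2 p.1| ^ m) :=
    ((my'.comp measurable_swap).norm.pow_const m).ennreal_ofReal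
  calc _ ≤ ∫⁻ X : Fin n → S, (∫⁻ t in Set.Ioc (0 : ℝ) 1, ENNReal.ofReal (|y' t X| ^ m))
        ∂(Measure.pi fun _ => μ) := lintegral_mono hpt
    _ = ∫⁻ t in Set.Ioc (0 : ℝ) 1, (∫⁻ X : Fin n → S, ENNReal.ofReal (|y' t X| ^ m)
        ∂(Measure.pi fun _ => μ)) := lintegral_lintegral_swap hmy'.aemeasurable
    _ ≤ ∫⁻ _ in Set.Ioc (0 : ℝ) 1, ENNReal.ofReal (A * (n : ℝ) ^ (m / 2) * V ^ m) := by
        refine lintegral_mono_ae ?_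
        rw [ae_restrict_iff' measurableSet_Ioc]
        have h1 : ∀ᵐ t : ℝ, t ≠ 1 := by simp [ae_iff, measure_singleton]
        filter_upwards [h.ae_integral_clampDeriv_eq_zero (by linarith), h1] with t ht0 ht1 ht
        have hioo : t ∈ Set.Ioo (0 : ℝ) 1 := ⟨ht.1, lt_of_le_of_ne ht.2 ht1⟩
        have ht' : t ∈ Set.Icc (0 : ℝ) 1 := ⟨ht.1.le, ht.2⟩
        have hico : t ∈ Set.Ico (0 : ℝ) 1 := ⟨ht.1.le, hioo.2⟩
        have ht0 := ht0 hioo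
        have mr := (h.meas t ht').ennreal_ofReal
        have hpos := h.pos t ht'
        set ρ : S → ℝ≥0∞ := fun x => ENNReal.ofReal (r t x) with hρ
        have hprob : IsProbabilityMeasure (μ.withDensity ρ) :=
          ⟨by rw [withDensity_apply _ MeasurableSet.univ, Measure.restrict_univ, h.mass t ht']⟩
        have mlt : Measurable (l t) := ml.comp (measurable_const.prodMk measurable_id)
        have hlt : ∀ x, l t x = r' t x / r t x := fun x => by
          simp only [hl, clampPath_of_mem r ht', clampDeriv, Set.indicator_of_mem hico]
        have hlm : ∫⁻ x, ENNReal.ofReal (|l t x| ^ m) ∂(μ.withDensity ρ)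
            ≤ ENNReal.ofReal (V ^ m) := by
          have mlm : Measurable fun x => ENNReal.ofReal (|l t x| ^ m) :=
            (mlt.norm.pow_const m).ennreal_ofReal
          rw [lintegral_withDensity_eq_lintegral_mul _ mr mlm]
          refine le_trans (le_of_eq (lintegral_congr fun x => ?_)) (h.moment t ht')
          rw [Pi.mul_apply, hρ, ← ENNReal.ofReal_mul (hpos x).le, hlt, abs_div,
            abs_of_pos (hpos x), mul_comm]
        have hli : Integrable (fun x => |l t x| ^ m) (μ.withDensity ρ) := by
          refine ⟨(mlt.norm.pow_const m).aestronglyMeasurable, ?_⟩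
          rw [hasFiniteIntegral_iff_ofReal (Eventually.of_forall fun x => by positivity)]
          exact hlm.trans_lt ENNReal.ofReal_lt_top
        have hlr : ∫ x, |l t x| ^ m ∂(μ.withDensity ρ) ≤ V ^ m := by
          rw [integral_eq_lintegral_of_nonneg_ae (Eventually.of_forall fun x => by positivity)
            hli.aestronglyMeasurable]
          exact ENNReal.toReal_le_of_le_ofReal (by positivity) hlm
        have hl0 : ∫ x, l t x ∂(μ.withDensity ρ) = 0 := by
          rw [integral_withDensity_eq_integral_toReal_smul mr
            (Eventually.of_forall fun _ => ENNReal.ofReal_lt_top), ← ht0]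
          refine integral_congr_ae (Eventually.of_forall fun x => ?_)
          simp only [smul_eq_mul, hρ, ENNReal.toReal_ofReal (hpos x).le, hlt, clampDeriv,
            Set.indicator_of_mem hico]
          have := (hpos x).ne'
          field_simp
        have hres := hMZ (μ.withDensity ρ) V (l t) hV mlt hli hlr hl0 n
        have msum : Measurable fun X : Fin n → S => ENNReal.ofReal (|∑ i, l t (X i)| ^ m) :=
          ((Finset.measurable_sum _ fun i _ =>
            mlt.comp (measurable_pi_apply i)).norm.pow_const m).ennreal_ofReal
        have mprod : Measurable fun X : Fin n → S => ∏ i, ρ (X i) :=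
          Finset.measurable_prod _ fun i _ => mr.comp (measurable_pi_apply i)
        -- The factor `y^m = ∏ r(t, X_i)` turns the base measure into the sample law at time `t`,
        -- under which the score is centred and the moment inequality for sums applies.
        rw [pi_withDensity_eq μ n mr, lintegral_withDensity_eq_lintegral_mul _ mprod msum] at hres
        refine le_trans (lintegral_mono fun X => ?_) hres
        rw [Pi.mul_apply, hρ, ← ENNReal.ofReal_prod_of_nonneg fun i _ => (hpos _).le,
          ← ENNReal.ofReal_mul (Finset.prod_nonneg fun i _ => (hpos _).le)]
        refine ENNReal.ofReal_le_ofReal ?_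
        have hym : y t X ^ m = ∏ i, r t (X i) := by
          simp only [hy, clampPath_of_mem r ht']
          rw [← Real.exp_mul, mul_comm, ← mul_assoc, mul_one_div_cancel hm0.ne', one_mul,
            Real.exp_sum]
          exact Finset.prod_congr rfl fun i _ => Real.exp_log (hpos _)
        have hy0 : 0 < y t X := Real.exp_pos _
        simp only [hy']
        rw [abs_mul, abs_of_pos hy0, Real.mul_rpow hy0.le (abs_nonneg _), hym]
        have hpr : 0 ≤ ∏ i, r t (X i) := Finset.prod_nonneg fun i _ => (hpos _).le
        refine mul_le_mul_of_nonneg_left (Real.rpow_le_rpow (abs_nonneg _) ?_ hm0.le) hpr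
        rw [abs_mul, abs_of_pos (by positivity)]
        have : 1 / m ≤ 1 := by rw [div_le_one hm0]; linarith
        exact mul_le_of_le_one_left (abs_nonneg _) this
    _ = _ := by simp

/-! ### Lipschitz bound for the likelihood root under condition D -/

namespace Experiment

variable {S : Type*} [MeasurableSpace S] {d : ℕ} {𝓔 : Experiment S d}

/-- Straight segments stay in a convex `Θ`; the base density cancels from the score, and
Cauchy–Schwarz extracts `|w' - w|`. Using `T + 1` rather than `T` gives `T ≤ (T + 1)^m` and a
positive constant. -/
theorem densityPath_ratio (hconv : Convex ℝ 𝓔.Θ)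
    (hdiff : ∀ x, ∀ θ ∈ 𝓔.Θ, DifferentiableAt ℝ (𝓔.f x) θ) {m T : ℝ} (hm : 1 ≤ m) (hT : 0 ≤ T)
    (hmom : ∀ θ ∈ 𝓔.Θ, ∫⁻ x, ENNReal.ofReal ((‖gradient (𝓔.f x) θ‖ / 𝓔.f x θ) ^ m * 𝓔.f x θ) ∂𝓔.ν
      ≤ ENNReal.ofReal T)
    {θ w w' : EuclideanSpace ℝ (Fin d)} (hθ : θ ∈ 𝓔.Θ) (hw : w ∈ 𝓔.Θ) (hw' : w' ∈ 𝓔.Θ) :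
    DensityPath (𝓔.P θ) (fun t => 𝓔.ratio θ (w + t • (w' - w)))
      (fun t x => inner ℝ (gradient (𝓔.f x) (w + t • (w' - w))) (w' - w) / 𝓔.f x θ) m
      ((T + 1) * ‖w' - w‖) := by
  have hmem : ∀ t ∈ Set.Icc (0 : ℝ) 1, w + t • (w' - w) ∈ 𝓔.Θ := fun t ht =>
    hconv.add_smul_sub_mem hw hw' ht
  have hm0 : 0 < m := by linarith
  refine ⟨fun t ht => (𝓔.measurable_f _ (hmem t ht)).div (𝓔.measurable_f _ hθ),
    fun t ht x => ratio_pos hθ (hmem t ht) x, fun t ht => ?_, fun t ht x => ?_, fun t ht => ?_⟩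
  · rw [lintegral_P hθ, ← 𝓔.lintegral_f _ (hmem t ht)]
    refine lintegral_congr fun x => ?_
    rw [← ENNReal.ofReal_mul (𝓔.pos_f _ hθ x).le, ratio, mul_div_cancel₀ _ (𝓔.pos_f _ hθ x).ne']
  · have h1 : HasDerivAt (fun s : ℝ => w + s • (w' - w)) (w' - w) t := by
      simpa using ((hasDerivAt_id t).smul_const (w' - w)).const_add w
    have h2 := (hdiff x _ (hmem t ht)).hasGradientAt.hasFDerivAt.comp_hasDerivAt t h1
    simpa [ratio, Function.comp_def] using h2.div_const (𝓔.f x θ)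
  · rw [lintegral_P hθ]
    calc _ ≤ ∫⁻ x, ENNReal.ofReal (‖w' - w‖ ^ m) *
          ENNReal.ofReal ((‖gradient (𝓔.f x) (w + t • (w' - w))‖ / 𝓔.f x (w + t • (w' - w))) ^ m
            * 𝓔.f x (w + t • (w' - w))) ∂𝓔.ν := by
          refine lintegral_mono fun x => ?_
          have hp := 𝓔.pos_f _ hθ x
          have hq := 𝓔.pos_f _ (hmem t ht) x
          simp only
          rw [← ENNReal.ofReal_mul hp.le, ← ENNReal.ofReal_mul (by positivity), ratio]
          refine ENNReal.ofReal_le_ofReal ?_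
          generalize w + t • (w' - w) = z at *
          have hi := abs_real_inner_le_norm (gradient (𝓔.f x) z) (w' - w)
          have e1 : |inner ℝ (gradient (𝓔.f x) z) (w' - w) / 𝓔.f x θ| / (𝓔.f x z / 𝓔.f x θ)
              = |inner ℝ (gradient (𝓔.f x) z) (w' - w)| / 𝓔.f x z := by
            rw [abs_div, abs_of_pos hp]; field_simp
          have e2 : (|inner ℝ (gradient (𝓔.f x) z) (w' - w)| / 𝓔.f x z) ^ m
              ≤ ‖w' - w‖ ^ m * (‖gradient (𝓔.f x) z‖ / 𝓔.f x z) ^ m := by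
            rw [← Real.mul_rpow (norm_nonneg _) (by positivity)]
            refine Real.rpow_le_rpow (by positivity) ?_ hm0.le
            rw [mul_div_assoc', mul_comm]
            gcongr
          rw [e1, ← mul_assoc]
          calc _ = (|inner ℝ (gradient (𝓔.f x) z) (w' - w)| / 𝓔.f x z) ^ m * 𝓔.f x z := by
                field_simp
            _ ≤ _ := (mul_le_mul_of_nonneg_right e2 hq.le).trans_eq (mul_assoc _ _ _)
      _ ≤ ENNReal.ofReal (‖w' - w‖ ^ m) * ENNReal.ofReal T := by
          rw [lintegral_const_mul' _ _ ENNReal.ofReal_ne_top]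
          gcongr
          exact hmom _ (hmem t ht)
      _ ≤ _ := by
          rw [← ENNReal.ofReal_mul (by positivity)]
          refine ENNReal.ofReal_le_ofReal ?_
          rw [Real.mul_rpow (by positivity) (norm_nonneg _), mul_comm]
          gcongr
          have : (T + 1) ^ (1 : ℝ) ≤ (T + 1) ^ m :=
            Real.rpow_le_rpow_of_exponent_le (by linarith) hm
          rw [Real.rpow_one] at this
          linarith

/-- Under condition D the `m`-th root of the likelihood is Lipschitz in `L^m`, with `m > d`. -/
theorem CondD.exists_likelihood_root_increment_le (hD : 𝓔.CondD) :
    ∃ m K : ℝ, (d : ℝ) < m ∧ 2 ≤ m ∧ 0 < K ∧ ∀ θ ∈ 𝓔.Θ, ∀ w ∈ 𝓔.Θ, ∀ w' ∈ 𝓔.Θ, ∀ n : ℕ,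
      ∫⁻ X, ENNReal.ofReal (|Real.exp (1 / m * ∑ i, Real.log (𝓔.ratio θ w' (X i)))
          - Real.exp (1 / m * ∑ i, Real.log (𝓔.ratio θ w (X i)))| ^ m) ∂(𝓔.sampleLaw n θ)
        ≤ ENNReal.ofReal (K * (n : ℝ) ^ (m / 2) * ‖w' - w‖ ^ m) := by
  obtain ⟨hconv, hdiff, m, hdm, hm, hsup⟩ := hD
  have hm0 : 0 < m := by linarith
  obtain ⟨A, hA, hbd⟩ := ModDev.exists_likelihood_root_increment_le hm
  set T := (⨆ θ ∈ 𝓔.Θ, ∫⁻ x, ENNReal.ofReal ((‖gradient (𝓔.f x) θ‖ / 𝓔.f x θ) ^ m * 𝓔.f x θ)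
    ∂𝓔.ν).toReal with hT
  have hT0 : 0 ≤ T := ENNReal.toReal_nonneg
  have hmom : ∀ θ ∈ 𝓔.Θ, ∫⁻ x, ENNReal.ofReal ((‖gradient (𝓔.f x) θ‖ / 𝓔.f x θ) ^ m * 𝓔.f x θ)
      ∂𝓔.ν ≤ ENNReal.ofReal T := fun θ hθ => by
    rw [hT, ENNReal.ofReal_toReal hsup.ne]
    exact le_iSup₂ (f := fun θ (_ : θ ∈ 𝓔.Θ) => ∫⁻ x,
      ENNReal.ofReal ((‖gradient (𝓔.f x) θ‖ / 𝓔.f x θ) ^ m * 𝓔.f x θ) ∂𝓔.ν) θ hθ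
  refine ⟨m, A * (T + 1) ^ m, hdm, hm, by positivity, fun θ hθ w hw w' hw' n => ?_⟩
  rcases eq_or_ne w w' with rfl | hne
  · simp [Real.zero_rpow hm0.ne']
  have := 𝓔.isProbabilityMeasure_P hθ
  have hpos : 0 < ‖w' - w‖ := norm_pos_iff.2 (sub_ne_zero.2 hne.symm)
  have h := hbd (𝓔.P θ) _ _ _ (by positivity)
    (densityPath_ratio hconv hdiff (by linarith) hT0 hmom hθ hw hw') n
  simp only [one_smul, zero_smul, add_zero, add_sub_cancel] at h
  refine h.trans (ENNReal.ofReal_le_ofReal (le_of_eq ?_))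
  rw [Real.mul_rpow (by positivity) (norm_nonneg _)]
  ring

end Experiment

/-! ### Dyadic chaining in the unit cube -/

variable {d : ℕ}

/-- The point of the dyadic grid of level `k` with integer coordinates `g`. -/
def gridPoint (k : ℕ) (g : Fin d → ℕ) : Fin d → ℝ := fun i => (g i : ℝ) / 2 ^ k

/-- Integer coordinates of the dyadic approximation from below. -/
def gridIndex (k : ℕ) (t : Fin d → ℝ) : Fin d → ℕ := fun i => ⌊2 ^ k * t i⌋₊

/-- The integer coordinates of the grid of level `k` in the unit cube. -/
def gridSet (d k : ℕ) : Finset (Fin d → ℕ) := Fintype.piFinset fun _ => Finset.range (2 ^ k + 1)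

theorem mem_gridSet {k : ℕ} {g : Fin d → ℕ} : g ∈ gridSet d k ↔ ∀ i, g i ≤ 2 ^ k := by
  simp [gridSet, Fintype.mem_piFinset]

theorem card_gridSet_le (d k : ℕ) : ((gridSet d k).card : ℝ) ≤ ((2 : ℝ) ^ d) ^ (k + 1) := by
  have h : (gridSet d k).card = (2 ^ k + 1) ^ d := by simp [gridSet]
  rw [h, ← pow_mul, mul_comm, pow_mul]
  push_cast
  gcongr
  have : (1 : ℝ) ≤ 2 ^ k := one_le_pow₀ one_le_two
  rw [pow_succ]
  linarith

theorem gridPoint_mem {k : ℕ} {g : Fin d → ℕ} (hg : g ∈ gridSet d k) :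
    gridPoint k g ∈ Set.Icc (0 : Fin d → ℝ) 1 := by
  rw [mem_gridSet] at hg
  refine ⟨fun i => ?_, fun i => ?_⟩
  · show (0 : ℝ) ≤ (g i : ℝ) / 2 ^ k
    positivity
  · show (g i : ℝ) / 2 ^ k ≤ 1
    rw [div_le_one (by positivity)]
    exact_mod_cast hg i

theorem gridIndex_mem {k : ℕ} {t : Fin d → ℝ} (ht : t ∈ Set.Icc (0 : Fin d → ℝ) 1) :
    gridIndex k t ∈ gridSet d k := by
  rw [mem_gridSet]
  intro i
  refine Nat.floor_le_of_le ?_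
  have h1 : t i ≤ 1 := ht.2 i
  push_cast
  have : (0 : ℝ) < 2 ^ k := by positivity
  nlinarith

theorem half_mem_gridSet {k : ℕ} {g : Fin d → ℕ} (hg : g ∈ gridSet d (k + 1)) :
    (fun i => g i / 2) ∈ gridSet d k := by
  rw [mem_gridSet] at hg ⊢
  intro i
  have := hg i
  rw [pow_succ] at this
  show g i / 2 ≤ _
  omega

/-- Successive approximations of a point are child and parent in the dyadic tree, so a chain only
uses increments between a grid point and its parent. -/
theorem gridIndex_half (k : ℕ) (t : Fin d → ℝ) :
    (fun i => gridIndex (k + 1) t i / 2) = gridIndex k t := by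
  funext i
  simp only [gridIndex]
  rw [← Nat.floor_div_ofNat]
  congr 1
  rw [pow_succ]
  simp only [OfNat.ofNat]
  ring_nf

theorem norm_gridPoint_sub_le (k : ℕ) {t : Fin d → ℝ} (ht : t ∈ Set.Icc (0 : Fin d → ℝ) 1) :
    ‖gridPoint k (gridIndex k t) - t‖ ≤ (1 / 2) ^ k := by
  rw [pi_norm_le_iff_of_nonneg (by positivity)]
  intro i
  have h0 : (0 : ℝ) ≤ t i := ht.1 i
  have hp : (0 : ℝ) < 2 ^ k := by positivity
  have h1 := Nat.floor_le (show 0 ≤ 2 ^ k * t i by positivity)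
  have h2 := Nat.lt_floor_add_one (2 ^ k * t i)
  rw [Real.norm_eq_abs, Pi.sub_apply, one_div, inv_pow, ← one_div, abs_le]
  simp only [gridPoint, gridIndex]
  constructor
  · rw [neg_le_sub_iff_le_add, ← add_div, le_div_iff₀ hp]; linarith
  · have : (⌊2 ^ k * t i⌋₊ : ℝ) / 2 ^ k ≤ t i := by rw [div_le_iff₀ hp]; linarith
    have : (0 : ℝ) < 1 / 2 ^ k := by positivity
    linarith

theorem norm_gridPoint_sub_half_le (k : ℕ) (g : Fin d → ℕ) :
    ‖gridPoint (k + 1) g - gridPoint k (fun i => g i / 2)‖ ≤ (1 / 2) ^ (k + 1) := by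
  rw [pi_norm_le_iff_of_nonneg (by positivity)]
  intro i
  have hp : (0 : ℝ) < 2 ^ k := by positivity
  have e : gridPoint (k + 1) g i - gridPoint k (fun i => g i / 2) i
      = ((g i % 2 : ℕ) : ℝ) / 2 ^ (k + 1) := by
    have h := Nat.div_add_mod (g i) 2
    have h' : (g i : ℝ) = 2 * ((g i / 2 : ℕ) : ℝ) + ((g i % 2 : ℕ) : ℝ) := by exact_mod_cast h.symm
    simp only [gridPoint]
    rw [h', pow_succ]
    field_simp
    ring
  rw [Pi.sub_apply, e, Real.norm_eq_abs, abs_of_nonneg (by positivity), one_div, inv_pow, ← one_div]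
  gcongr
  exact_mod_cast Nat.lt_succ_iff.1 (Nat.mod_lt (g i) two_pos)

theorem tendsto_gridPoint {t : Fin d → ℝ} (ht : t ∈ Set.Icc (0 : Fin d → ℝ) 1) :
    Tendsto (fun k => gridPoint k (gridIndex k t)) atTop (𝓝[Set.Icc (0 : Fin d → ℝ) 1] t) := by
  refine tendsto_nhdsWithin_iff.2 ⟨?_, Eventually.of_forall fun k => gridPoint_mem (gridIndex_mem ht)⟩
  rw [tendsto_iff_norm_sub_tendsto_zero]
  exact squeeze_zero (fun _ => norm_nonneg _) (fun k => norm_gridPoint_sub_le k ht)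
    (tendsto_pow_atTop_nhds_zero_of_lt_one (by norm_num) (by norm_num))

/-- If all dyadic increments beyond level `k` obey summable bounds, so do the approximation
errors. -/
theorem abs_sub_gridPoint_le {y : (Fin d → ℝ) → ℝ} (hy : ContinuousOn y (Set.Icc 0 1)) {k : ℕ}
    {a : ℕ → ℝ} {s : ℝ} (ha : ∀ J, ∑ j ∈ Finset.range J, a j ≤ s)
    (h : ∀ j, ∀ g ∈ gridSet d (k + j + 1),
      |y (gridPoint (k + j + 1) g) - y (gridPoint (k + j) fun i => g i / 2)| ≤ a j)
    {t : Fin d → ℝ} (ht : t ∈ Set.Icc (0 : Fin d → ℝ) 1) :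
    |y t - y (gridPoint k (gridIndex k t))| ≤ s := by
  have hJ : ∀ J, |y (gridPoint (k + J) (gridIndex (k + J) t)) - y (gridPoint k (gridIndex k t))|
      ≤ ∑ j ∈ Finset.range J, a j := by
    intro J
    induction J with
    | zero => simp
    | succ J ih =>
      have h1 := h J _ (gridIndex_mem ht)
      rw [gridIndex_half] at h1
      rw [Finset.sum_range_succ]
      calc _ = |(y (gridPoint (k + J + 1) (gridIndex (k + J + 1) t))
            - y (gridPoint (k + J) (gridIndex (k + J) t)))
            + (y (gridPoint (k + J) (gridIndex (k + J) t))
              - y (gridPoint k (gridIndex k t)))| := by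
            rw [← add_assoc]; congr 1; ring
        _ ≤ _ := (abs_add_le _ _).trans (by linarith)
  have hlim : Tendsto (fun J => |y (gridPoint (k + J) (gridIndex (k + J) t))
      - y (gridPoint k (gridIndex k t))|) atTop (𝓝 |y t - y (gridPoint k (gridIndex k t))|) := by
    have h1 := (hy t ht).tendsto.comp (tendsto_gridPoint ht)
    have h2 : Tendsto (fun J => k + J) atTop atTop := tendsto_atTop_mono (fun J => Nat.le_add_left J k) tendsto_id
    exact ((h1.comp h2).sub_const _).abs
  exact le_of_tendsto' hlim fun J => (hJ J).trans (ha J)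

/-- Dyadic chaining for a continuous process with Lipschitz increments in `L^m`, `m > d`. -/
theorem exists_chaining_bound {m : ℝ} (hm : 1 ≤ m) (hdm : (d : ℝ) < m) :
    ∃ K : ℝ, 0 < K ∧ ∀ {Ω : Type*} [MeasurableSpace Ω] (μ : Measure Ω)
      (Y : (Fin d → ℝ) → Ω → ℝ) (L : ℝ), 0 ≤ L →
      (∀ ω, ContinuousOn (fun t => Y t ω) (Set.Icc 0 1)) →
      (∀ t ∈ Set.Icc (0 : Fin d → ℝ) 1, Measurable (Y t)) →
      (∀ t ∈ Set.Icc (0 : Fin d → ℝ) 1, ∀ t' ∈ Set.Icc (0 : Fin d → ℝ) 1,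
        ∫⁻ ω, ENNReal.ofReal (|Y t ω - Y t' ω| ^ m) ∂μ ≤ ENNReal.ofReal (L * ‖t - t'‖ ^ m)) →
      ∀ (k : ℕ) (s : ℝ), 0 < s →
        μ {ω | ∃ t ∈ Set.Icc (0 : Fin d → ℝ) 1, s < |Y t ω - Y (gridPoint k (gridIndex k t)) ω|}
          ≤ ENNReal.ofReal (K * L * ((2 : ℝ) ^ ((d : ℝ) - m)) ^ k / s ^ m) := by
  have hm0 : 0 < m := by linarith
  -- Each level gains `2^(d-m) = q²`: the number of points grows by `2^d`, the moments shrink by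
  -- `2^(-m)`. One factor `q` is spent on decreasing thresholds, through `ρ^m = q`; the other makes
  -- the sum over levels converge.
  set q : ℝ := (2 : ℝ) ^ (((d : ℝ) - m) / 2) with hq
  have hq0 : 0 < q := by positivity
  have hq1 : q < 1 := Real.rpow_lt_one_of_one_lt_of_neg one_lt_two (by linarith)
  have hq2 : q ^ 2 = (2 : ℝ) ^ ((d : ℝ) - m) := by
    rw [hq, ← Real.rpow_two, ← Real.rpow_mul (by norm_num)]
    congr 1; ring
  have hqd : (2 : ℝ) ^ d * ((1 / 2 : ℝ) ^ m) = q ^ 2 := by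
    rw [hq2, Real.rpow_sub two_pos, Real.rpow_natCast, one_div, Real.inv_rpow two_pos.le]
    rfl
  set ρ : ℝ := q ^ (1 / m) with hρ
  have hρ0 : 0 < ρ := by positivity
  have hρ1 : ρ < 1 := Real.rpow_lt_one hq0.le hq1 (by positivity)
  have hρm : ρ ^ m = q := by
    rw [hρ, ← Real.rpow_mul hq0.le, one_div_mul_cancel hm0.ne', Real.rpow_one]
  have h1ρ : 0 < 1 - ρ := by linarith
  have h1q : 0 < 1 - q := by linarith
  refine ⟨2 ^ d / (1 - ρ) ^ m / (1 - q), by positivity, ?_⟩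
  intro Ω _ μ Y L hL hcont hmeas hinc k s hs
  -- Geometric thresholds with total at most `s`; if no increment exceeds its own threshold, no
  -- point deviates by more than `s`.
  set a : ℕ → ℝ := fun j => s * (1 - ρ) * ρ ^ j with ha
  have ha0 : ∀ j, 0 < a j := fun j => by positivity
  have hasum : ∀ J, ∑ j ∈ Finset.range J, a j ≤ s := by
    intro J
    rw [← Finset.mul_sum, geom_sum_eq hρ1.ne]
    have : s * (1 - ρ) * ((ρ ^ J - 1) / (ρ - 1)) = s * (1 - ρ ^ J) := by
      have : ρ - 1 ≠ 0 := by linarith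
      field_simp
      ring
    rw [this]
    have : 0 < ρ ^ J := by positivity
    nlinarith
  set B : ℕ → (Fin d → ℕ) → Set Ω := fun j g =>
    {ω | a j < |Y (gridPoint (k + j + 1) g) ω - Y (gridPoint (k + j) fun i => g i / 2) ω|} with hB
  set c : ℝ := 2 ^ d / (1 - ρ) ^ m * L * (q ^ 2) ^ k / s ^ m with hc
  have hc0 : 0 ≤ c := by positivity
  have hBle : ∀ j, ∀ g ∈ gridSet d (k + j + 1),
      μ (B j g) ≤ ENNReal.ofReal (L * ((1 / 2 : ℝ) ^ m) ^ (k + j + 1) / a j ^ m) := by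
    intro j g hg
    have m1 := gridPoint_mem hg
    have m2 := gridPoint_mem (half_mem_gridSet hg)
    have hF : Measurable fun ω => ENNReal.ofReal (|Y (gridPoint (k + j + 1) g) ω
        - Y (gridPoint (k + j) fun i => g i / 2) ω| ^ m) :=
      (((hmeas _ m1).sub (hmeas _ m2)).norm.pow_const m).ennreal_ofReal
    have ham : 0 < a j ^ m := Real.rpow_pos_of_pos (ha0 j) m
    calc μ (B j g) ≤ μ {ω | ENNReal.ofReal (a j ^ m) ≤ ENNReal.ofReal
          (|Y (gridPoint (k + j + 1) g) ω - Y (gridPoint (k + j) fun i => g i / 2) ω| ^ m)} := by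
          refine measure_mono fun ω hω => ENNReal.ofReal_le_ofReal ?_
          exact Real.rpow_le_rpow (ha0 j).le (le_of_lt hω) hm0.le
      _ ≤ (∫⁻ ω, ENNReal.ofReal (|Y (gridPoint (k + j + 1) g) ω
          - Y (gridPoint (k + j) fun i => g i / 2) ω| ^ m) ∂μ) / ENNReal.ofReal (a j ^ m) :=
          meas_ge_le_lintegral_div hF.aemeasurable (by simpa using ham) ENNReal.ofReal_ne_top
      _ ≤ ENNReal.ofReal (L * ‖gridPoint (k + j + 1) g - gridPoint (k + j) fun i => g i / 2‖ ^ m)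
          / ENNReal.ofReal (a j ^ m) := by gcongr; exact hinc _ m1 _ m2
      _ ≤ _ := by
          rw [← ENNReal.ofReal_div_of_pos ham]
          refine ENNReal.ofReal_le_ofReal ?_
          gcongr
          calc _ ≤ ((1 / 2 : ℝ) ^ (k + j + 1)) ^ m :=
                Real.rpow_le_rpow (norm_nonneg _) (norm_gridPoint_sub_half_le _ g) hm0.le
            _ = _ := by
                rw [← Real.rpow_natCast, ← Real.rpow_mul (by norm_num), mul_comm,
                  Real.rpow_mul (by norm_num), Real.rpow_natCast]
  have hlevel : ∀ j, ((gridSet d (k + j + 1)).card : ℝ)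
      * (L * ((1 / 2 : ℝ) ^ m) ^ (k + j + 1) / a j ^ m) ≤ c * q ^ j := by
    intro j
    have ham : a j ^ m = s ^ m * (1 - ρ) ^ m * q ^ j := by
      rw [ha, Real.mul_rpow (by positivity) (by positivity), Real.mul_rpow hs.le h1ρ.le,
        ← Real.rpow_natCast, ← Real.rpow_mul hρ0.le, mul_comm (j : ℝ), Real.rpow_mul hρ0.le, hρm,
        Real.rpow_natCast]
    have hsm : 0 < s ^ m := by positivity
    have h1m : 0 < (1 - ρ) ^ m := by positivity
    calc _ ≤ ((2 : ℝ) ^ d) ^ (k + j + 1 + 1) * (L * ((1 / 2 : ℝ) ^ m) ^ (k + j + 1) / a j ^ m) := by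
          refine mul_le_mul_of_nonneg_right (card_gridSet_le d _) ?_
          have := ha0 j
          positivity
      _ = 2 ^ d * L * (2 ^ d * (1 / 2 : ℝ) ^ m) ^ (k + j + 1) / a j ^ m := by
          rw [mul_pow]; ring
      _ = c * q ^ j * q ^ 2 := by
          rw [hqd, ham, hc]; field_simp; ring
      _ ≤ c * q ^ j * 1 := by gcongr; exact pow_le_one₀ hq0.le hq1.le
      _ = _ := mul_one _
  have hsub : {ω | ∃ t ∈ Set.Icc (0 : Fin d → ℝ) 1,
      s < |Y t ω - Y (gridPoint k (gridIndex k t)) ω|}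
      ⊆ ⋃ j, ⋃ g ∈ gridSet d (k + j + 1), B j g := by
    rintro ω ⟨t, ht, hts⟩
    by_contra hcon
    simp only [Set.mem_iUnion, not_exists] at hcon
    refine absurd hts (not_lt.2 (abs_sub_gridPoint_le (hcont ω) hasum (fun j g hg => ?_) ht))
    exact not_lt.1 (hcon j g hg)
  calc _ ≤ μ (⋃ j, ⋃ g ∈ gridSet d (k + j + 1), B j g) := measure_mono hsub
    _ ≤ ∑' j, μ (⋃ g ∈ gridSet d (k + j + 1), B j g) := measure_iUnion_le _
    _ ≤ ∑' j, ENNReal.ofReal (c * q ^ j) := by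
        refine ENNReal.tsum_le_tsum fun j => ?_
        refine (measure_biUnion_finset_le _ _).trans ((Finset.sum_le_sum (hBle j)).trans ?_)
        rw [Finset.sum_const, nsmul_eq_mul, ← ENNReal.ofReal_natCast,
          ← ENNReal.ofReal_mul (Nat.cast_nonneg _)]
        exact ENNReal.ofReal_le_ofReal (hlevel j)
    _ = ENNReal.ofReal (∑' j, c * q ^ j) :=
        (ENNReal.ofReal_tsum_of_nonneg (fun j => by positivity)
          ((summable_geometric_of_lt_one hq0.le hq1).mul_left c)).symm
    _ = _ := by
        rw [tsum_mul_left, tsum_geometric_of_lt_one hq0.le hq1, hc, hq2]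
        congr 1
        field_simp


/-! ### Local cubes and the size of the truncated score sum -/

variable {d : ℕ}

theorem norm_le_of_forall_abs_le {v : EuclideanSpace ℝ (Fin d)} {c : ℝ} (hc : 0 ≤ c)
    (h : ∀ i, |v i| ≤ c) : ‖v‖ ≤ ((d : ℝ) + 1) * c := by
  refine abs_le_of_sq_le_sq' ?_ (by positivity) |>.2
  rw [EuclideanSpace.norm_sq_eq]
  calc ∑ i, ‖v i‖ ^ 2 ≤ ∑ _i : Fin d, c ^ 2 :=
        Finset.sum_le_sum fun i _ => by
          have := h i
          rw [Real.norm_eq_abs]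
          gcongr
    _ = d * c ^ 2 := by simp
    _ ≤ _ := by
        have : (0 : ℝ) ≤ d := Nat.cast_nonneg d
        have := sq_nonneg c
        rw [mul_pow]
        gcongr
        nlinarith

/-- The affine map from the unit cube onto the cube of half-side `c` in Euclidean space. -/
def cubeMap (c : ℝ) (t : Fin d → ℝ) : EuclideanSpace ℝ (Fin d) :=
  WithLp.toLp 2 fun i => c * (2 * t i - 1)

theorem norm_cubeMap_le {c : ℝ} (hc : 0 ≤ c) {t : Fin d → ℝ}
    (ht : t ∈ Set.Icc (0 : Fin d → ℝ) 1) : ‖cubeMap c t‖ ≤ ((d : ℝ) + 1) * c := by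
  refine norm_le_of_forall_abs_le hc fun i => ?_
  have h0 : (0 : ℝ) ≤ t i := ht.1 i
  have h1 : t i ≤ 1 := ht.2 i
  show |c * (2 * t i - 1)| ≤ c
  rw [abs_mul, abs_of_nonneg hc]
  refine mul_le_of_le_one_right hc (abs_le.2 ⟨?_, ?_⟩) <;> linarith

theorem norm_cubeMap_sub_le {c : ℝ} (hc : 0 ≤ c) (t t' : Fin d → ℝ) :
    ‖cubeMap c t - cubeMap c t'‖ ≤ 2 * (((d : ℝ) + 1) * c) * ‖t - t'‖ := by
  have : ‖cubeMap c t - cubeMap c t'‖ ≤ ((d : ℝ) + 1) * (2 * c * ‖t - t'‖) := by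
    refine norm_le_of_forall_abs_le (by positivity) fun i => ?_
    show |c * (2 * t i - 1) - c * (2 * t' i - 1)| ≤ _
    have e : c * (2 * t i - 1) - c * (2 * t' i - 1) = 2 * c * (t - t') i := by
      rw [Pi.sub_apply]; ring
    rw [e, abs_mul, abs_of_nonneg (by positivity)]
    gcongr
    exact norm_le_pi_norm (t - t') i
  linarith

theorem exists_cubeMap_eq {c : ℝ} (hc : 0 < c) {v : EuclideanSpace ℝ (Fin d)} (hv : ‖v‖ ≤ c) :
    ∃ t ∈ Set.Icc (0 : Fin d → ℝ) 1, cubeMap c t = v := by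
  have hi : ∀ i, |v i / c| ≤ 1 := fun i => by
    rw [abs_div, abs_of_pos hc, div_le_one hc]
    exact (PiLp.norm_apply_le v i).trans hv
  refine ⟨fun i => (v i / c + 1) / 2, ⟨fun i => ?_, fun i => ?_⟩, ?_⟩
  · show (0 : ℝ) ≤ (v i / c + 1) / 2
    have := (abs_le.1 (hi i)).1
    linarith
  · show (v i / c + 1) / 2 ≤ 1
    have := (abs_le.1 (hi i)).2
    linarith
  · ext i
    show c * (2 * ((v i / c + 1) / 2) - 1) = v i
    field_simp
    ring

theorem continuous_cubeMap (c : ℝ) : Continuous (cubeMap c : (Fin d → ℝ) → _) :=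
  (PiLp.continuous_toLp 2 _).comp (by fun_prop)

namespace Experiment

variable {S : Type*} [MeasurableSpace S] {𝓔 : Experiment S d}
  {θ₀ : EuclideanSpace ℝ (Fin d)} {φ : S → EuclideanSpace ℝ (Fin d)} {ω : ℝ → ℝ} {u : ℕ → ℝ}

theorem fisherForm_sub_left (v v' w : EuclideanSpace ℝ (Fin d)) :
    𝓔.fisherForm θ₀ φ (v - v') w = 𝓔.fisherForm θ₀ φ v w - 𝓔.fisherForm θ₀ φ v' w := by
  simp [fisherForm, sub_dotProduct]

theorem fisherForm_sub_right (v w w' : EuclideanSpace ℝ (Fin d)) :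
    𝓔.fisherForm θ₀ φ v (w - w') = 𝓔.fisherForm θ₀ φ v w - 𝓔.fisherForm θ₀ φ v w' := by
  simp [fisherForm, Matrix.mulVec_sub, dotProduct_sub]

variable (𝓔 θ₀ φ) in
theorem exists_abs_fisherForm_le : ∃ F : ℝ, 0 ≤ F ∧ ∀ v w : EuclideanSpace ℝ (Fin d),
    |𝓔.fisherForm θ₀ φ v w| ≤ F * ‖v‖ * ‖w‖ := by
  refine ⟨∑ i, ∑ j, |𝓔.fisherInfo θ₀ φ i j|, by positivity, fun v w => ?_⟩
  simp only [fisherForm, dotProduct, Matrix.mulVec, Finset.mul_sum, Finset.sum_mul]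
  refine (Finset.abs_sum_le_sum_abs _ _).trans (Finset.sum_le_sum fun i _ => ?_)
  refine (Finset.abs_sum_le_sum_abs _ _).trans (Finset.sum_le_sum fun j _ => ?_)
  have h1 : |v i| ≤ ‖v‖ := PiLp.norm_apply_le v i
  have h2 : |w j| ≤ ‖w‖ := PiLp.norm_apply_le w j
  rw [abs_mul, abs_mul]
  calc _ ≤ ‖v‖ * (|𝓔.fisherInfo θ₀ φ i j| * ‖w‖) := by gcongr
    _ = _ := by ring

/-- Chernoff bound for the log-likelihood ratio. -/
theorem sampleLaw_lt_sum_xi_le {h v : EuclideanSpace ℝ (Fin d)} (hh : θ₀ + h ∈ 𝓔.Θ)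
    (hv : θ₀ + h + v ∈ 𝓔.Θ) (n : ℕ) (s : ℝ) :
    𝓔.sampleLaw n (θ₀ + h) {X | s < ∑ i, 𝓔.xi θ₀ h v (X i)} ≤ ENNReal.ofReal (Real.exp (-s)) := by
  have := 𝓔.isProbabilityMeasure_P hh
  refine (measure_pi_lt_sum_le (𝓔.P (θ₀ + h)) n (measurable_xi hh hv) s).trans_eq ?_
  have h1 : ∫⁻ x, ENNReal.ofReal (Real.exp (𝓔.xi θ₀ h v x)) ∂(𝓔.P (θ₀ + h)) = 1 := by
    rw [lintegral_P hh, ← 𝓔.lintegral_f _ hv]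
    refine lintegral_congr fun x => ?_
    rw [← ENNReal.ofReal_mul (𝓔.pos_f _ hh x).le, xi, Real.exp_log (ratio_pos hh hv x), ratio,
      mul_div_cancel₀ _ (𝓔.pos_f _ hh x).ne']
  rw [h1, one_pow, mul_one]

theorem exists_ball_subset (hθ₀ : θ₀ ∈ 𝓔.Θ) (hu0 : Tendsto u atTop (𝓝 0)) (R C : ℝ) :
    ∀ᶠ n in atTop, ∀ h v : EuclideanSpace ℝ (Fin d), ‖h‖ ≤ R * u n → ‖v‖ ≤ C * u n →
      θ₀ + h + v ∈ 𝓔.Θ := by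
  obtain ⟨r, hr, hball⟩ := Metric.isOpen_iff.1 𝓔.isOpen θ₀ hθ₀
  have h0 : Tendsto (fun n => (R + C) * u n) atTop (𝓝 0) := by simpa using hu0.const_mul (R + C)
  filter_upwards [h0.eventually (gt_mem_nhds hr)] with n hn h v hh hv
  refine hball ?_
  rw [mem_ball_iff_norm, add_assoc, add_sub_cancel_left]
  linarith [norm_add_le h v]

theorem zeta_le_of_lanError {ε t : ℝ} {n : ℕ} {h v : EuclideanSpace ℝ (Fin d)} {X : Fin n → S} :
    𝓔.zeta θ₀ φ ε t h v X ≤ (∑ i, 𝓔.xi θ₀ h v (X i)) + 𝓔.lanError θ₀ φ ε t h v X := by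
  have := neg_abs_le ((∑ i, 𝓔.xi θ₀ h v (X i)) - 𝓔.zeta θ₀ φ ε t h v X)
  rw [lanError]
  linarith

/-- The truncated score sums are of moderate size with high probability. -/
theorem exists_norm_sum_trunc_prob_le (hF : 𝓔.FiniteFisher θ₀ φ ω) (hθ₀ : θ₀ ∈ 𝓔.Θ)
    (hu : ∀ n, 0 < u n) (hu0 : Tendsto u atTop (𝓝 0))
    (hnu : Tendsto (fun n : ℕ => (n : ℝ) * u n ^ 2) atTop atTop)
    (hB : 𝓔.CondB2 θ₀ u ∨ (𝓔.CondB1 θ₀ u ∧ 𝓔.CondC1 θ₀ φ ω ∧ 𝓔.CondC2 θ₀ φ))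
    {ε : ℝ} (hε : 0 < ε) {R M : ℝ} (hR : 0 ≤ R) (hM : 0 < M) :
    ∃ L : ℝ, 0 < L ∧ ∀ᶠ n : ℕ in atTop, ∀ h : EuclideanSpace ℝ (Fin d), ‖h‖ ≤ R * u n →
        𝓔.sampleLaw n (θ₀ + h) {X | L * (n * u n ^ 2) < u n * ‖∑ i, trunc φ ε (u n) (X i)‖}
          ≤ ENNReal.ofReal (Real.exp (-(M * (n * u n ^ 2)))) := by
  obtain ⟨F, hF0, hFle⟩ := 𝓔.exists_abs_fisherForm_le θ₀ φ
  set L := M + 2 + F + R * F with hL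
  have hL0 : 0 < L := by positivity
  refine ⟨((d : ℝ) + 1) * L, by positivity, ?_⟩
  have hlan := eventually_lanError_prob_le hF hθ₀ hu hu0 hnu hB hε hR zero_le_one one_pos
    (show 0 < M + 1 by linarith)
  filter_upwards [hlan, exists_ball_subset hθ₀ hu0 R 1, exists_ball_subset hθ₀ hu0 R 0,
    hnu.eventually_ge_atTop (4 * d + 1)] with n hn hmem hmem0 hN h hh
  obtain ⟨N, hNdef⟩ : ∃ N : ℝ, N = n * u n ^ 2 := ⟨_, rfl⟩
  rw [← hNdef] at hN
  rw [← hNdef]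
  have hN0 : 0 ≤ N := by
    have : (0 : ℝ) ≤ d := Nat.cast_nonneg d
    linarith
  have hun := hu n
  have hθ : θ₀ + h ∈ 𝓔.Θ := by simpa using hmem0 h 0 hh (by simp)
  -- Testing with `±u_n e_i` suffices for a norm bound. For each test vector `2⟨w, Σφ_ε⟩` is at most
  -- the log-likelihood ratio plus the expansion error plus `O(N)`, and the upper tail of the
  -- log-likelihood ratio is free since its exponential has mean one.
  let w : Fin d × Bool → EuclideanSpace ℝ (Fin d) := fun p =>
    EuclideanSpace.single p.1 (if p.2 then u n else -u n)
  have hw : ∀ p, ‖w p‖ ≤ 1 * u n := by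
    rintro ⟨i, b⟩
    cases b <;> simp [w, abs_of_pos hun]
  have hwΘ : ∀ p, θ₀ + h + w p ∈ 𝓔.Θ := fun p => hmem h _ hh (hw p)
  have hsub : {X : Fin n → S | ((d : ℝ) + 1) * L * N < u n * ‖∑ i, trunc φ ε (u n) (X i)‖}
      ⊆ ⋃ p, ({X | N * 1 < 𝓔.lanError θ₀ φ ε (u n) h (w p) X}
        ∪ {X | (M + 1) * N < ∑ i, 𝓔.xi θ₀ h (w p) (X i)}) := by
    intro X hX
    by_contra hcon
    simp only [Set.mem_iUnion, Set.mem_union, Set.mem_ofPred_eq, not_exists, not_or, not_lt] at hcon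
    have hin : ∀ p, inner ℝ (w p) (∑ i, trunc φ ε (u n) (X i)) ≤ L * N := by
      intro p
      obtain ⟨h1, h2⟩ := hcon p
      have h3 := (zeta_le_of_lanError (𝓔 := 𝓔) (θ₀ := θ₀) (φ := φ) (ε := ε) (t := u n)
        (h := h) (v := w p) (X := X)).trans (add_le_add h2 h1)
      have h4 := (le_abs_self _).trans (hFle (w p) (w p))
      have h5 := (le_abs_self _).trans (hFle h (w p))
      have hwp := hw p
      rw [one_mul] at hwp
      have h6 : n * 𝓔.fisherForm θ₀ φ (w p) (w p) ≤ F * N := by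
        calc _ ≤ n * (F * ‖w p‖ * ‖w p‖) := by gcongr
          _ ≤ n * (F * u n * u n) := by gcongr
          _ = _ := by rw [hNdef]; ring
      have h7 : n * 𝓔.fisherForm θ₀ φ h (w p) ≤ R * F * N := by
        calc _ ≤ n * (F * ‖h‖ * ‖w p‖) := by gcongr
          _ ≤ n * (F * (R * u n) * u n) := by gcongr
          _ = _ := by rw [hNdef]; ring
      rw [zeta] at h3
      have h8 : 0 ≤ F * N := by positivity
      have h9 : 0 ≤ R * F * N := by positivity
      have h10 : 0 ≤ M * N := by positivity
      rw [hL]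
      linarith
    refine absurd (show ((d : ℝ) + 1) * L * N < u n * ‖∑ i, trunc φ ε (u n) (X i)‖ from hX)
      (not_lt.2 ?_)
    have hco : ∀ i, |(u n • ∑ i, trunc φ ε (u n) (X i)) i| ≤ L * N := by
      intro i
      have h1 := hin (i, true)
      have h2 := hin (i, false)
      simp only [w, if_true, EuclideanSpace.inner_single_left, Bool.false_eq_true, if_false] at h1 h2
      simp only [conj_trivial] at h1 h2
      rw [PiLp.smul_apply, smul_eq_mul]
      exact abs_le.2 ⟨by linarith, h1⟩
    have := norm_le_of_forall_abs_le (by positivity) hco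
    rw [norm_smul, Real.norm_eq_abs, abs_of_pos hun] at this
    linarith
  calc _ ≤ 𝓔.sampleLaw n (θ₀ + h) (⋃ p, ({X | N * 1 < 𝓔.lanError θ₀ φ ε (u n) h (w p) X}
        ∪ {X | (M + 1) * N < ∑ i, 𝓔.xi θ₀ h (w p) (X i)})) := measure_mono hsub
    _ ≤ ∑ _p : Fin d × Bool, (ENNReal.ofReal (Real.exp (-((M + 1) * N)))
        + ENNReal.ofReal (Real.exp (-((M + 1) * N)))) := by
        refine (measure_iUnion_fintype_le _ _).trans (Finset.sum_le_sum fun p _ => ?_)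
        refine (measure_union_le _ _).trans (add_le_add ?_ ?_)
        · have := hn h (w p) hh (hw p) hθ (hwΘ p)
          rwa [← hNdef] at this
        · exact sampleLaw_lt_sum_xi_le hθ (hwΘ p) n _
    _ = ENNReal.ofReal (4 * d * Real.exp (-((M + 1) * N))) := by
        rw [← ENNReal.ofReal_add (by positivity) (by positivity), Finset.sum_const, nsmul_eq_mul,
          ← ENNReal.ofReal_natCast, ← ENNReal.ofReal_mul (Nat.cast_nonneg _)]
        congr 1
        simp only [Finset.card_univ, Fintype.card_prod, Fintype.card_fin, Fintype.card_bool]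
        push_cast
        ring
    _ ≤ _ := by
        refine ENNReal.ofReal_le_ofReal ?_
        have e : Real.exp (-((M + 1) * N)) = Real.exp (-N) * Real.exp (-(M * N)) := by
          rw [← Real.exp_add]; ring_nf
        rw [e, ← mul_assoc]
        refine mul_le_of_le_one_left (Real.exp_pos _).le ?_
        rw [Real.exp_neg, ← div_eq_mul_inv, div_le_one (Real.exp_pos _)]
        linarith [Real.add_one_le_exp N]

end Experiment

/-! ### From the grid to the whole cube -/

/-- If two `m`-th roots differ by at most half of one of them, their ratio lies between `1/e` and
`e`; so the logarithms of the likelihoods differ by at most `m`, which is negligible against `N`. -/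
theorem abs_sub_le_of_abs_exp_sub_le {m a b s : ℝ} (hm : 0 < m)
    (h : |Real.exp (1 / m * a) - Real.exp (1 / m * b)| ≤ s) (hs : s ≤ Real.exp (1 / m * b) / 2) :
    |a - b| ≤ m := by
  obtain ⟨h1, h2⟩ := abs_le.1 (h.trans hs)
  have hb := Real.exp_pos (1 / m * b)
  have he : 2 ≤ Real.exp 1 := by linarith [Real.add_one_le_exp 1]
  have e1 : 1 / m * a ≤ 1 + 1 / m * b := by
    rw [← Real.exp_le_exp, Real.exp_add]
    nlinarith
  have e2 : 1 / m * b ≤ 1 + 1 / m * a := by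
    rw [← Real.exp_le_exp, Real.exp_add]
    have := Real.exp_pos (1 / m * a)
    nlinarith
  have e3 : m * (1 / m * a) = a := by field_simp
  have e4 : m * (1 / m * b) = b := by field_simp
  have e5 := mul_le_mul_of_nonneg_left e1 hm.le
  have e6 := mul_le_mul_of_nonneg_left e2 hm.le
  rw [mul_add, e3, e4] at e5 e6
  exact abs_le.2 ⟨by linarith, by linarith⟩

namespace Experiment

variable {S : Type*} [MeasurableSpace S] {d : ℕ} {𝓔 : Experiment S d}
  {θ₀ : EuclideanSpace ℝ (Fin d)} {φ : S → EuclideanSpace ℝ (Fin d)} {ω : ℝ → ℝ} {u : ℕ → ℝ}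

theorem abs_zeta_sub_le {F R D L κ ε r : ℝ} {n : ℕ} {h v v' : EuclideanSpace ℝ (Fin d)}
    {X : Fin n → S} (hF0 : 0 ≤ F)
    (hF : ∀ v w : EuclideanSpace ℝ (Fin d), |𝓔.fisherForm θ₀ φ v w| ≤ F * ‖v‖ * ‖w‖)
    (hr : 0 < r) (hR : 0 ≤ R) (hκ : 0 ≤ κ) (hh : ‖h‖ ≤ R * r) (hv : ‖v‖ ≤ D * r)
    (hv' : ‖v'‖ ≤ D * r) (hvv : ‖v - v'‖ ≤ κ * r)
    (hX : r * ‖∑ i, trunc φ ε r (X i)‖ ≤ L * (n * r ^ 2)) :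
    |𝓔.zeta θ₀ φ ε r h v X - 𝓔.zeta θ₀ φ ε r h v' X|
      ≤ κ * (2 * L + F * D + F * R) * (n * r ^ 2) := by
  have e : 𝓔.zeta θ₀ φ ε r h v X - 𝓔.zeta θ₀ φ ε r h v' X
      = 2 * inner ℝ (v - v') (∑ i, trunc φ ε r (X i))
        - 1 / 2 * n * 𝓔.fisherForm θ₀ φ v (v - v') - 1 / 2 * n * 𝓔.fisherForm θ₀ φ (v - v') v'
        - n * 𝓔.fisherForm θ₀ φ h (v - v') := by
    rw [zeta, zeta, fisherForm_sub_right, fisherForm_sub_right, fisherForm_sub_left, inner_sub_left]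
    ring
  have h1 : |inner ℝ (v - v') (∑ i, trunc φ ε r (X i))| ≤ κ * (L * (n * r ^ 2)) := by
    calc _ ≤ ‖v - v'‖ * ‖∑ i, trunc φ ε r (X i)‖ := abs_real_inner_le_norm _ _
      _ ≤ κ * r * ‖∑ i, trunc φ ε r (X i)‖ := by gcongr
      _ ≤ _ := by rw [mul_assoc]; gcongr
  have hDr : 0 ≤ D * r := (norm_nonneg _).trans hv
  have h2 : n * |𝓔.fisherForm θ₀ φ v (v - v')| ≤ κ * (F * D) * (n * r ^ 2) := by
    calc _ ≤ n * (F * ‖v‖ * ‖v - v'‖) := by gcongr; exact hF _ _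
      _ ≤ n * (F * (D * r) * (κ * r)) := by gcongr
      _ = _ := by ring
  have h3 : n * |𝓔.fisherForm θ₀ φ (v - v') v'| ≤ κ * (F * D) * (n * r ^ 2) := by
    calc _ ≤ n * (F * ‖v - v'‖ * ‖v'‖) := by gcongr; exact hF _ _
      _ ≤ n * (F * (κ * r) * (D * r)) := by gcongr
      _ = _ := by ring
  have h4 : n * |𝓔.fisherForm θ₀ φ h (v - v')| ≤ κ * (F * R) * (n * r ^ 2) := by
    calc _ ≤ n * (F * ‖h‖ * ‖v - v'‖) := by gcongr; exact hF _ _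
      _ ≤ n * (F * (R * r) * (κ * r)) := by gcongr
      _ = _ := by ring
  have hn : (0 : ℝ) ≤ n := Nat.cast_nonneg n
  obtain ⟨a1, a2⟩ := abs_le.1 h1
  have b1 := mul_le_mul_of_nonneg_left (abs_le.1 (le_refl |𝓔.fisherForm θ₀ φ v (v - v')|)).1 hn
  have b2 := mul_le_mul_of_nonneg_left (le_abs_self (𝓔.fisherForm θ₀ φ v (v - v'))) hn
  have c1 := mul_le_mul_of_nonneg_left (abs_le.1 (le_refl |𝓔.fisherForm θ₀ φ (v - v') v'|)).1 hn
  have c2 := mul_le_mul_of_nonneg_left (le_abs_self (𝓔.fisherForm θ₀ φ (v - v') v')) hn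
  have d1 := mul_le_mul_of_nonneg_left (abs_le.1 (le_refl |𝓔.fisherForm θ₀ φ h (v - v')|)).1 hn
  have d2 := mul_le_mul_of_nonneg_left (le_abs_self (𝓔.fisherForm θ₀ φ h (v - v'))) hn
  rw [e]
  exact abs_le.2 ⟨by linarith, by linarith⟩

theorem zeta_zero (ε r : ℝ) {n : ℕ} (h : EuclideanSpace ℝ (Fin d)) (X : Fin n → S) :
    𝓔.zeta θ₀ φ ε r h 0 X = 0 := by
  simp [zeta, fisherForm]

/-- Control of the expansion error on a cube from its control on a dyadic grid. -/
theorem lanError_le_of_grid {F R C L δ m ε r : ℝ} {n k : ℕ} {h : EuclideanSpace ℝ (Fin d)}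
    {X : Fin n → S} (hF0 : 0 ≤ F)
    (hF : ∀ v w : EuclideanSpace ℝ (Fin d), |𝓔.fisherForm θ₀ φ v w| ≤ F * ‖v‖ * ‖w‖)
    (hr : 0 < r) (hR : 0 ≤ R) (hC : 0 < C) (hδ : 0 < δ) (hm : 0 < m) (hh : ‖h‖ ≤ R * r)
    (hX : r * ‖∑ i, trunc φ ε r (X i)‖ ≤ L * (n * r ^ 2))
    (hgrid : ∀ g ∈ gridSet d k, 𝓔.lanError θ₀ φ ε r h (cubeMap (C * r) (gridPoint k g)) X
      ≤ n * r ^ 2 * (δ / 4))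
    (hcont : ∀ t ∈ Set.Icc (0 : Fin d → ℝ) 1,
      |Real.exp (1 / m * ∑ i, 𝓔.xi θ₀ h (cubeMap (C * r) t) (X i))
        - Real.exp (1 / m * ∑ i, 𝓔.xi θ₀ h (cubeMap (C * r) (gridPoint k (gridIndex k t))) (X i))|
      ≤ Real.exp (1 / m * -(((d + 1) * C * (2 * L + F * ((d + 1) * C) + F * R) + δ)
          * (n * r ^ 2))) / 2)
    (hk : 2 * ((d + 1) * C) * (1 / 2) ^ k * (2 * L + F * ((d + 1) * C) + F * R) ≤ δ / 4)
    (hmδ : m ≤ δ / 4 * (n * r ^ 2)) {v : EuclideanSpace ℝ (Fin d)} (hv : ‖v‖ ≤ C * r) :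
    𝓔.lanError θ₀ φ ε r h v X ≤ n * r ^ 2 * δ := by
  obtain ⟨t, ht, rfl⟩ := exists_cubeMap_eq (by positivity) hv
  have hN : 0 ≤ n * r ^ 2 := by positivity
  set D : ℝ := (d + 1) * C with hD
  have hD0 : 0 < D := by positivity
  set g := gridIndex k t with hg
  have hgm : g ∈ gridSet d k := gridIndex_mem ht
  set w := cubeMap (C * r) (gridPoint k g) with hw
  set z := cubeMap (C * r) t with hz
  have hwn : ‖w‖ ≤ D * r := (norm_cubeMap_le (by positivity) (gridPoint_mem hgm)).trans_eq (by
    rw [hD]; ring)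
  have hzn : ‖z‖ ≤ D * r := (norm_cubeMap_le (by positivity) ht).trans_eq (by rw [hD]; ring)
  have hzw : ‖z - w‖ ≤ 2 * D * (1 / 2) ^ k * r := by
    refine (norm_cubeMap_sub_le (by positivity) _ _).trans ?_
    rw [norm_sub_rev]
    calc _ ≤ 2 * (((d : ℝ) + 1) * (C * r)) * (1 / 2) ^ k := by
          gcongr
          exact norm_gridPoint_sub_le k ht
      _ = _ := by rw [hD]; ring
  have hζ := abs_zeta_sub_le (ε := ε) (X := X) hF0 hF hr hR (by positivity) hh hzn hwn hzw hX
  have hζ' : |𝓔.zeta θ₀ φ ε r h z X - 𝓔.zeta θ₀ φ ε r h w X| ≤ δ / 4 * (n * r ^ 2) :=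
    hζ.trans (by gcongr)
  have hζw := abs_zeta_sub_le (v' := 0) (ε := ε) (X := X) hF0 hF hr hR hD0.le hh hwn
    (by rw [norm_zero]; positivity) (by rwa [sub_zero]) hX
  rw [zeta_zero, sub_zero] at hζw
  have hlw := hgrid g hgm
  -- A lower bound for the log-likelihood at grid points: the quadratic is bounded below on the
  -- score event, and the error there is small. It makes the absolute bound `hcont` a relative one.
  have hlow : -((D * (2 * L + F * D + F * R) + δ) * (n * r ^ 2)) ≤ ∑ i, 𝓔.xi θ₀ h w (X i) := by
    have h1 := (abs_le.1 hζw).1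
    have h2 := hlw
    rw [lanError] at h2
    have h3 := (abs_le.1 h2).1
    have h4 := mul_nonneg hδ.le hN
    linarith
  have hξ := abs_sub_le_of_abs_exp_sub_le hm (hcont t ht) (by
    have := Real.exp_le_exp.2 (mul_le_mul_of_nonneg_left hlow (show 0 ≤ 1 / m by positivity))
    linarith)
  rw [lanError] at hlw ⊢
  have e1 := abs_le.1 hlw
  have e2 := abs_le.1 hζ'
  have e3 := abs_le.1 hξ
  have h4 := mul_nonneg hδ.le hN
  -- The budget: `δ/4` each for the grid error, the variation of the quadratic, and the variation
  -- `m` of the log-likelihood.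
  exact abs_le.2 ⟨by linarith [e1.1, e2.2, e3.1], by linarith [e1.2, e2.1, e3.2]⟩

/-- Chaining bound for the `m`-th root of the likelihood on a cube of side of order `r`. -/
theorem CondD.exists_likelihood_root_chaining (hD : 𝓔.CondD) :
    ∃ m K : ℝ, (d : ℝ) < m ∧ 2 ≤ m ∧ 0 < K ∧ ∀ (h : EuclideanSpace ℝ (Fin d)) (c : ℝ) (n : ℕ),
      0 ≤ c → θ₀ + h ∈ 𝓔.Θ → (∀ t ∈ Set.Icc (0 : Fin d → ℝ) 1, θ₀ + h + cubeMap c t ∈ 𝓔.Θ) →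
      ∀ (k : ℕ) (s : ℝ), 0 < s → 𝓔.sampleLaw n (θ₀ + h)
        {X | ∃ t ∈ Set.Icc (0 : Fin d → ℝ) 1,
          s < |Real.exp (1 / m * ∑ i, 𝓔.xi θ₀ h (cubeMap c t) (X i))
            - Real.exp (1 / m * ∑ i, 𝓔.xi θ₀ h (cubeMap c (gridPoint k (gridIndex k t))) (X i))|}
        ≤ ENNReal.ofReal (K * (n * c ^ 2) ^ (m / 2) * ((2 : ℝ) ^ ((d : ℝ) - m)) ^ k / s ^ m) := by
  obtain ⟨m, K, hdm, hm, hK, hinc⟩ := hD.exists_likelihood_root_increment_le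
  have hm0 : 0 < m := by linarith
  obtain ⟨K', hK', hch⟩ := exists_chaining_bound (d := d) (by linarith) hdm
  refine ⟨m, K' * (K * (2 * ((d : ℝ) + 1)) ^ m), hdm, hm, by positivity, ?_⟩
  intro h c n hc hh hcube k s hs
  have hY : ∀ t ∈ Set.Icc (0 : Fin d → ℝ) 1, Measurable fun X : Fin n → S =>
      Real.exp (1 / m * ∑ i, 𝓔.xi θ₀ h (cubeMap c t) (X i)) := fun t ht =>
    ((Finset.measurable_sum _ fun i _ =>
      (measurable_xi hh (hcube t ht)).comp (measurable_pi_apply i)).const_mul _).exp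
  have hcont : ∀ X : Fin n → S, ContinuousOn
      (fun t => Real.exp (1 / m * ∑ i, 𝓔.xi θ₀ h (cubeMap c t) (X i))) (Set.Icc 0 1) := by
    intro X
    refine Real.continuous_exp.comp_continuousOn (continuousOn_const.mul
      (continuousOn_finsetSum _ fun i _ t ht => ContinuousAt.continuousWithinAt ?_))
    have h1 : ContinuousAt (fun t : Fin d → ℝ => θ₀ + h + cubeMap c t) t :=
      (continuous_const.add (continuous_cubeMap c)).continuousAt
    have h2 := ContinuousAt.comp (f := fun t : Fin d → ℝ => θ₀ + h + cubeMap c t)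
      (hD.2.1 (X i) _ (hcube t ht)).continuousAt h1
    exact (h2.div_const (𝓔.f (X i) (θ₀ + h))).log (ratio_pos hh (hcube t ht) (X i)).ne'
  have hL : ∀ x : ℝ, 0 ≤ x → K * (n : ℝ) ^ (m / 2) * (2 * (((d : ℝ) + 1) * c) * x) ^ m
      = K * (2 * ((d : ℝ) + 1)) ^ m * (n * c ^ 2) ^ (m / 2) * x ^ m := by
    intro x hx
    have e : (n * c ^ 2) ^ (m / 2) = (n : ℝ) ^ (m / 2) * c ^ m := by
      rw [Real.mul_rpow (Nat.cast_nonneg n) (by positivity), ← Real.rpow_two,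
        ← Real.rpow_mul hc]
      congr 2; ring
    rw [e, Real.mul_rpow (by positivity) hx, ← mul_assoc 2, Real.mul_rpow (by positivity) hc]
    ring
  have hres := hch (𝓔.sampleLaw n (θ₀ + h))
    (fun t X => Real.exp (1 / m * ∑ i, 𝓔.xi θ₀ h (cubeMap c t) (X i)))
    (K * (2 * ((d : ℝ) + 1)) ^ m * (n * c ^ 2) ^ (m / 2)) (by positivity) hcont hY
    (fun t ht t' ht' => ?_) k s hs
  · refine hres.trans (ENNReal.ofReal_le_ofReal (le_of_eq ?_))
    ring
  · refine (hinc _ hh _ (hcube t' ht') _ (hcube t ht) n).trans (ENNReal.ofReal_le_ofReal ?_)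
    rw [← hL _ (norm_nonneg _), add_sub_add_left_eq_sub]
    gcongr
    exact norm_cubeMap_sub_le hc t t'

end Experiment
-- Uniform exponential bound
namespace Experiment

variable {S : Type*} [MeasurableSpace S] {d : ℕ} {𝓔 : Experiment S d}
  {θ₀ : EuclideanSpace ℝ (Fin d)} {φ : S → EuclideanSpace ℝ (Fin d)} {ω : ℝ → ℝ} {u : ℕ → ℝ}

/-- Uniform version of the exponential bound for the expansion error. -/
theorem eventually_exists_lanError_prob_le (hF : 𝓔.FiniteFisher θ₀ φ ω) (hθ₀ : θ₀ ∈ 𝓔.Θ)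
    (hu : ∀ n, 0 < u n) (hu0 : Tendsto u atTop (𝓝 0))
    (hnu : Tendsto (fun n : ℕ => (n : ℝ) * u n ^ 2) atTop atTop)
    (hB : 𝓔.CondB2 θ₀ u ∨ (𝓔.CondB1 θ₀ u ∧ 𝓔.CondC1 θ₀ φ ω ∧ 𝓔.CondC2 θ₀ φ))
    (hD : 𝓔.CondD) {ε : ℝ} (hε : 0 < ε) {R C δ M : ℝ} (hR : 0 ≤ R) (hC : 0 < C) (hδ : 0 < δ)
    (hM : 0 < M) :
    ∀ᶠ n : ℕ in atTop, ∀ h : EuclideanSpace ℝ (Fin d), ‖h‖ ≤ R * u n →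
        𝓔.sampleLaw n (θ₀ + h) {X | ∃ v : EuclideanSpace ℝ (Fin d), ‖v‖ ≤ C * u n ∧
          n * u n ^ 2 * δ < 𝓔.lanError θ₀ φ ε (u n) h v X}
          ≤ ENNReal.ofReal (Real.exp (-(M * (n * u n ^ 2)))) := by
  obtain ⟨F, hF0, hFle⟩ := 𝓔.exists_abs_fisherForm_le θ₀ φ
  obtain ⟨m, K, hdm, hm, hK, hchain⟩ := hD.exists_likelihood_root_chaining (θ₀ := θ₀)
  obtain ⟨L, hL, hsum⟩ := exists_norm_sum_trunc_prob_le hF hθ₀ hu hu0 hnu hB hε hR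
    (show 0 < M + 1 by linarith)
  have hm0 : 0 < m := by linarith
  have hdm0 : 0 < m - d := by linarith
  have hlog : 0 < Real.log 2 := Real.log_pos one_lt_two
  set D : ℝ := (d + 1) * C with hDdef
  have hD0 : 0 < D := by positivity
  set Q : ℝ := 2 * L + F * D + F * R with hQ
  have hQ0 : 0 < Q := by positivity
  set B : ℝ := D * Q + δ with hBdef
  have hB0 : 0 < B := by positivity
  -- Chosen so that at level `k ≥ aN` the chaining factor `2^((d-m)k)` is at most `exp(-(B + M +
  -- 2)N)`: `B` compensates the division by `s^m`, one unit the polynomial factor `N^(m/2)`, and `M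
  -- + 1` remains.
  set a : ℝ := (B + M + 2) / ((m - d) * Real.log 2) with ha
  have ha0 : 0 < a := by positivity
  set k : ℕ → ℕ := fun n => ⌈a * (n * u n ^ 2)⌉₊ with hk
  have hkt : Tendsto k atTop atTop := tendsto_nat_ceil_atTop.comp (hnu.const_mul_atTop ha0)
  -- The exponent includes `d * a`, the exponential growth rate of the number of grid points.
  have hlan := eventually_lanError_prob_le hF hθ₀ hu hu0 hnu hB hε hR hD0.le
    (show 0 < δ / 4 by positivity) (show 0 < d * a + M + 2 by positivity)
  have hkδ : ∀ᶠ n in atTop, 2 * D * (1 / 2) ^ k n * Q ≤ δ / 4 := by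
    have h1 : Tendsto (fun n => 2 * D * (1 / 2 : ℝ) ^ k n * Q) atTop (𝓝 (2 * D * 0 * Q)) :=
      ((tendsto_pow_atTop_nhds_zero_of_lt_one (by norm_num) (by norm_num)).comp hkt).const_mul _
        |>.mul_const Q
    rw [mul_zero, zero_mul] at h1
    filter_upwards [h1.eventually (gt_mem_nhds (show 0 < δ / 4 by positivity))] with n hn using hn.le
  have hpoly : ∀ᶠ n : ℕ in atTop, K * (C ^ 2) ^ (m / 2) * 2 ^ m * ((n * u n ^ 2) ^ (m / 2)
      * Real.exp (-1 * (n * u n ^ 2))) ≤ 1 := by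
    have h1 := ((tendsto_rpow_mul_exp_neg_mul_atTop_nhds_zero (m / 2) 1 one_pos).comp hnu).const_mul
      (K * (C ^ 2) ^ (m / 2) * 2 ^ m)
    rw [mul_zero] at h1
    filter_upwards [h1.eventually (gt_mem_nhds one_pos)] with n hn using hn.le
  filter_upwards [hlan, hsum, hkδ, hpoly, exists_ball_subset hθ₀ hu0 R D,
    exists_ball_subset hθ₀ hu0 R 0, hnu.eventually_ge_atTop (2 * d + 2),
    hnu.eventually_ge_atTop (m / (δ / 4))] with n hlan hsum hkδ hpoly hmem hmem0 hN2 hNm h hh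
  have hun := hu n
  have hθ : θ₀ + h ∈ 𝓔.Θ := by simpa using hmem0 h 0 hh (by simp)
  have hcn : ∀ t ∈ Set.Icc (0 : Fin d → ℝ) 1, ‖cubeMap (C * u n) t‖ ≤ D * u n := fun t ht =>
    (norm_cubeMap_le (by positivity) ht).trans_eq (by rw [hDdef]; ring)
  have hcube : ∀ t ∈ Set.Icc (0 : Fin d → ℝ) 1, θ₀ + h + cubeMap (C * u n) t ∈ 𝓔.Θ := fun t ht =>
    hmem h _ hh (hcn t ht)
  have hd0 : (0 : ℝ) ≤ d := Nat.cast_nonneg d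
  have hmδ : m ≤ δ / 4 * (n * u n ^ 2) := by
    rwa [div_le_iff₀ (by positivity), mul_comm] at hNm
  obtain ⟨N, hNdef⟩ : ∃ N : ℝ, N = n * u n ^ 2 := ⟨_, rfl⟩
  rw [← hNdef] at hN2 hpoly hlan hsum ⊢
  have hN0 : 0 ≤ N := by linarith
  have hkn1 : a * N ≤ k n := by rw [hNdef]; exact Nat.le_ceil _
  have hkn2 : (k n : ℝ) ≤ a * N + 1 := by
    rw [hNdef]; exact (Nat.ceil_lt_add_one (by positivity)).le
  set s : ℝ := Real.exp (1 / m * -(B * N)) / 2 with hs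
  have hs0 : 0 < s := by positivity
  have hsub : {X : Fin n → S | ∃ v : EuclideanSpace ℝ (Fin d), ‖v‖ ≤ C * u n ∧
        N * δ < 𝓔.lanError θ₀ φ ε (u n) h v X}
      ⊆ (⋃ g ∈ gridSet d (k n), {X | N * (δ / 4)
          < 𝓔.lanError θ₀ φ ε (u n) h (cubeMap (C * u n) (gridPoint (k n) g)) X})
        ∪ {X | L * N < u n * ‖∑ i, trunc φ ε (u n) (X i)‖}
        ∪ {X | ∃ t ∈ Set.Icc (0 : Fin d → ℝ) 1,
          s < |Real.exp (1 / m * ∑ i, 𝓔.xi θ₀ h (cubeMap (C * u n) t) (X i))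
            - Real.exp (1 / m * ∑ i, 𝓔.xi θ₀ h
              (cubeMap (C * u n) (gridPoint (k n) (gridIndex (k n) t))) (X i))|} := by
    rintro X ⟨v, hv, hXv⟩
    by_contra hcon
    simp only [Set.mem_union, Set.mem_iUnion, Set.mem_ofPred_eq, not_or, not_exists, not_and,
      not_lt] at hcon
    obtain ⟨⟨h1, h2⟩, h3⟩ := hcon
    refine absurd hXv (not_lt.2 ?_)
    rw [hNdef] at h1 h2 ⊢
    refine lanError_le_of_grid hF0 hFle hun hR hC hδ hm0 hh h2 h1 (fun t ht => ?_) hkδ hmδ hv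
    rw [← hNdef]
    exact h3 t ht
  have hp1 : 𝓔.sampleLaw n (θ₀ + h) (⋃ g ∈ gridSet d (k n), {X | N * (δ / 4)
          < 𝓔.lanError θ₀ φ ε (u n) h (cubeMap (C * u n) (gridPoint (k n) g)) X})
      ≤ ENNReal.ofReal (Real.exp (-((M + 1) * N))) := by
    calc _ ≤ ∑ _g ∈ gridSet d (k n), ENNReal.ofReal (Real.exp (-((d * a + M + 2) * N))) :=
          (measure_biUnion_finset_le _ _).trans (Finset.sum_le_sum fun g hg =>
            hlan h _ hh (hcn _ (gridPoint_mem hg)) hθ (hcube _ (gridPoint_mem hg)))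
      _ = ENNReal.ofReal ((gridSet d (k n)).card * Real.exp (-((d * a + M + 2) * N))) := by
          rw [Finset.sum_const, nsmul_eq_mul, ← ENNReal.ofReal_natCast,
            ← ENNReal.ofReal_mul (Nat.cast_nonneg _)]
      _ ≤ _ := by
          refine ENNReal.ofReal_le_ofReal ?_
          have h2e : (2 : ℝ) ≤ Real.exp 1 := by linarith [Real.add_one_le_exp 1]
          calc _ ≤ ((2 : ℝ) ^ d) ^ (k n + 1) * Real.exp (-((d * a + M + 2) * N)) := by
                gcongr
                exact card_gridSet_le d _
            _ ≤ (Real.exp 1 ^ d) ^ (k n + 1) * Real.exp (-((d * a + M + 2) * N)) := by gcongr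
            _ = Real.exp (d * (k n + 1) + -((d * a + M + 2) * N)) := by
                rw [Real.exp_add, ← pow_mul, ← Real.exp_nat_mul]
                push_cast
                rw [mul_one]
            _ ≤ _ := by
                refine Real.exp_le_exp.2 ?_
                have := mul_le_mul_of_nonneg_left hkn2 hd0
                linarith
  have hp3' : K * (n * (C * u n) ^ 2) ^ (m / 2) * ((2 : ℝ) ^ ((d : ℝ) - m)) ^ k n / s ^ m
      ≤ Real.exp (-((M + 1) * N)) := by
    have hsm : s ^ m = Real.exp (-(B * N)) / 2 ^ m := by
      rw [hs, Real.div_rpow (Real.exp_pos _).le two_pos.le, ← Real.exp_mul]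
      congr 2
      field_simp
    have hq : ((2 : ℝ) ^ ((d : ℝ) - m)) ^ k n ≤ Real.exp (-((B + M + 2) * N)) := by
      rw [Real.rpow_def_of_pos two_pos, ← Real.exp_nat_mul]
      refine Real.exp_le_exp.2 ?_
      have h1 : a * ((m - d) * Real.log 2) = B + M + 2 := by
        rw [ha]; field_simp
      have h2 := mul_le_mul_of_nonneg_right hkn1 (mul_pos hdm0 hlog).le
      nlinarith
    have hnc : (n * (C * u n) ^ 2) ^ (m / 2) = (C ^ 2) ^ (m / 2) * N ^ (m / 2) := by
      rw [← Real.mul_rpow (by positivity) hN0, hNdef]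
      congr 1; ring
    rw [hsm, hnc]
    calc _ ≤ K * ((C ^ 2) ^ (m / 2) * N ^ (m / 2)) * Real.exp (-((B + M + 2) * N))
          / (Real.exp (-(B * N)) / 2 ^ m) := by gcongr
      _ = K * (C ^ 2) ^ (m / 2) * 2 ^ m * (N ^ (m / 2) * Real.exp (-1 * N))
          * Real.exp (-((M + 1) * N)) := by
          have e : Real.exp (-((B + M + 2) * N))
              = Real.exp (-1 * N) * Real.exp (-((M + 1) * N)) * Real.exp (-(B * N)) := by
            rw [← Real.exp_add, ← Real.exp_add]; ring_nf
          rw [e]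
          field_simp
      _ ≤ 1 * Real.exp (-((M + 1) * N)) := by gcongr
      _ = _ := one_mul _
  have hp3 := (hchain h (C * u n) n (by positivity) hθ hcube (k n) s hs0).trans
    (ENNReal.ofReal_le_ofReal hp3')
  calc _ ≤ _ := measure_mono hsub
    _ ≤ ENNReal.ofReal (Real.exp (-((M + 1) * N))) + ENNReal.ofReal (Real.exp (-((M + 1) * N)))
        + ENNReal.ofReal (Real.exp (-((M + 1) * N))) :=
        (measure_union_le _ _).trans (add_le_add ((measure_union_le _ _).trans
          (add_le_add hp1 (hsum h hh))) hp3)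
    _ = ENNReal.ofReal (3 * Real.exp (-((M + 1) * N))) := by
        rw [← ENNReal.ofReal_add (by positivity) (by positivity),
          ← ENNReal.ofReal_add (by positivity) (by positivity)]
        congr 1; ring
    _ ≤ _ := by
        refine ENNReal.ofReal_le_ofReal ?_
        have e : Real.exp (-((M + 1) * N)) = Real.exp (-N) * Real.exp (-(M * N)) := by
          rw [← Real.exp_add]; ring_nf
        rw [e, ← mul_assoc]
        refine mul_le_of_le_one_left (Real.exp_pos _).le ?_
        rw [Real.exp_neg, ← div_eq_mul_inv, div_le_one (Real.exp_pos _)]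
        linarith [Real.add_one_le_exp N]

end Experiment
end ModDev

end

/-! ### Assembly -/

theorem theorem1 {S : Type*} [MeasurableSpace S] {d : ℕ} (𝓔 : ModDev.Experiment S d)
    (θ₀ : EuclideanSpace ℝ (Fin d)) (hθ₀ : θ₀ ∈ 𝓔.Θ)
    (φ : S → EuclideanSpace ℝ (Fin d)) (ω : ℝ → ℝ) (hF : 𝓔.FiniteFisher θ₀ φ ω)
    (hI : (𝓔.fisherInfo θ₀ φ).rank = d) (hA0 : 𝓔.CondA0)
    (u : ℕ → ℝ) (hu : ∀ n, 0 < u n) (hu0 : Tendsto u atTop (𝓝 0))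
    (hnu : Tendsto (fun n : ℕ => (n : ℝ) * u n ^ 2) atTop atTop)
    (hB : 𝓔.CondB2 θ₀ u ∨ (𝓔.CondB1 θ₀ u ∧ 𝓔.CondC1 θ₀ φ ω ∧ 𝓔.CondC2 θ₀ φ))
    (ε : ℝ) (hε : 0 < ε) :
    (∀ C : ℝ, 0 < C → ∃ ω₁ ω₂ : ℝ → ℝ, ModDev.IsRate ω₁ ∧ ModDev.IsRate ω₂ ∧
      ∀ R : ℝ, 0 < R → ∃ C₁ : ℝ, 0 < C₁ ∧
        ∀ b : EuclideanSpace ℝ (Fin d), ‖b‖ ≤ R → ∀ n : ℕ, θ₀ + u n • b ∈ 𝓔.Θ →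
        ∀ v : EuclideanSpace ℝ (Fin d), ‖v‖ < C * u n → θ₀ + u n • b + v ∈ 𝓔.Θ →
          (𝓔.sampleLaw n (θ₀ + u n • b)).real
              {X | n * u n ^ 2 * ω₁ (u n) < 𝓔.lanError θ₀ φ ε (u n) (u n • b) v X}
            < C₁ * Real.exp (-(n * u n ^ 2 / ω₂ (u n)))) ∧
    (𝓔.CondD → 𝓔.CondE θ₀ φ ε u →
      ∀ C : ℝ, 0 < C → ∃ ω₃ ω₄ : ℝ → ℝ, ModDev.IsRate ω₃ ∧ ModDev.IsRate ω₄ ∧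
      ∀ R : ℝ, 0 < R → ∃ C₁ : ℝ, 0 < C₁ ∧
        ∀ b : EuclideanSpace ℝ (Fin d), ‖b‖ ≤ R → ∀ n : ℕ, θ₀ + u n • b ∈ 𝓔.Θ →
          (𝓔.sampleLaw n (θ₀ + u n • b)).real
              {X | ENNReal.ofReal (n * u n ^ 2 * ω₃ (u n)) <
                ⨆ v ∈ {v : EuclideanSpace ℝ (Fin d) | ‖v‖ < C * u n ∧ θ₀ + u n • b + v ∈ 𝓔.Θ},
                  ENNReal.ofReal (𝓔.lanError θ₀ φ ε (u n) (u n • b) v X)}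
            < C₁ * Real.exp (-(n * u n ^ 2 / ω₄ (u n)))) := by
  have norm_smul_le : ∀ {R : ℝ} {b : EuclideanSpace ℝ (Fin d)} (n : ℕ), ‖b‖ ≤ R →
      ‖u n • b‖ ≤ R * u n := fun n hb => by
    rw [norm_smul, Real.norm_eq_abs, abs_of_pos (hu n), mul_comm]
    exact mul_le_mul_of_nonneg_right hb (hu n).le
  have prob : ∀ n (b : EuclideanSpace ℝ (Fin d)), θ₀ + u n • b ∈ 𝓔.Θ →
      IsProbabilityMeasure (𝓔.sampleLaw n (θ₀ + u n • b)) := fun n b hb => by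
    have := 𝓔.isProbabilityMeasure_P hb
    exact inferInstanceAs (IsProbabilityMeasure (Measure.pi fun _ => 𝓔.P (θ₀ + u n • b)))
  constructor
  · intro C hC
    obtain ⟨ω₁, ω₂, h₁, h₂, h⟩ := ModDev.exists_rates (u := u) hu
      (fun n (b v : EuclideanSpace ℝ (Fin d)) =>
        θ₀ + u n • b ∈ 𝓔.Θ ∧ ‖v‖ < C * u n ∧ θ₀ + u n • b + v ∈ 𝓔.Θ)
      (fun n b v δ => (𝓔.sampleLaw n (θ₀ + u n • b)).real
        {X | n * u n ^ 2 * δ < 𝓔.lanError θ₀ φ ε (u n) (u n • b) v X})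
      (fun n b v hd δ δ' hδ => by
        have := prob n b hd.1
        refine measureReal_mono fun X hX => ?_
        rw [Set.mem_ofPred_eq] at hX ⊢
        refine lt_of_le_of_lt ?_ hX
        gcongr)
      (fun n b v δ hd => by
        have := prob n b hd.1
        exact measureReal_le_one)
      (fun R δ M hR hδ hM => by
        filter_upwards [ModDev.Experiment.eventually_lanError_prob_le hF hθ₀ hu hu0 hnu hB hε hR.le
          hC.le hδ hM] with n hn b v hb hd
        exact ENNReal.toReal_le_of_le_ofReal (Real.exp_pos _).le
          (hn _ v (norm_smul_le n hb) hd.2.1.le hd.1 hd.2.2))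
    refine ⟨ω₁, ω₂, h₁, h₂, fun R hR => ?_⟩
    obtain ⟨C₁, hC₁, hle⟩ := h R hR
    exact ⟨C₁, hC₁, fun b hb n hθ v hv hθv => hle b hb n v ⟨hθ, hv, hθv⟩⟩
  · intro hD _ C hC
    -- The displacement is absorbed into the event, so no further index remains. A supremum above
    -- the threshold is attained above it by some single displacement, which is the event already
    -- bounded.
    obtain ⟨ω₁, ω₂, h₁, h₂, h⟩ := ModDev.exists_rates (u := u) (ι := Unit) hu
      (fun n (b : EuclideanSpace ℝ (Fin d)) _ => θ₀ + u n • b ∈ 𝓔.Θ)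
      (fun n b _ δ => (𝓔.sampleLaw n (θ₀ + u n • b)).real
        {X | ENNReal.ofReal (n * u n ^ 2 * δ) <
          ⨆ v ∈ {v : EuclideanSpace ℝ (Fin d) | ‖v‖ < C * u n ∧ θ₀ + u n • b + v ∈ 𝓔.Θ},
            ENNReal.ofReal (𝓔.lanError θ₀ φ ε (u n) (u n • b) v X)})
      (fun n b _ hd δ δ' hδ => by
        have := prob n b hd
        refine measureReal_mono fun X hX => ?_
        rw [Set.mem_ofPred_eq] at hX ⊢
        refine lt_of_le_of_lt (ENNReal.ofReal_le_ofReal ?_) hX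
        gcongr)
      (fun n b _ δ hd => by
        have := prob n b hd
        exact measureReal_le_one)
      (fun R δ M hR hδ hM => by
        filter_upwards [ModDev.Experiment.eventually_exists_lanError_prob_le hF hθ₀ hu hu0 hnu hB
          hD hε hR.le hC hδ hM] with n hn b _ hb hd
        refine ENNReal.toReal_le_of_le_ofReal (Real.exp_pos _).le
          ((measure_mono fun X hX => ?_).trans (hn _ (norm_smul_le n hb)))
        rw [Set.mem_ofPred_eq] at hX
        obtain ⟨v, hX⟩ := lt_iSup_iff.1 hX
        obtain ⟨hv, hX⟩ := lt_iSup_iff.1 hX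
        exact ⟨v, hv.1.le, (ENNReal.ofReal_lt_ofReal_iff'.1 hX).1⟩)
    refine ⟨ω₁, ω₂, h₁, h₂, fun R hR => ?_⟩
    obtain ⟨C₁, hC₁, hle⟩ := h R hR
    exact ⟨C₁, hC₁, fun b hb n hθ => hle b hb n () hθ⟩
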